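/- Let $H(p)=p\log_2\frac1p+(1-p)\log_2\frac1{1-p}$ be the binary entropy function. In the $k$-LPN problem of length $n$ with noise rate $\eta$ there is a hidden vector $x\in\{0,1\}^n$ of Hamming weight $k$; the learner is given $n$ and $k$ and draws independent examples $(a,\ell)$, where $a$ is uniform on $\{0,1\}^n$ and, independently of $a$, $\ell=\sum_i a_ix_i \pmod 2$ with probability $1-\nu$ and $\ell=1+\sum_i a_ix_i \pmod 2$ with probability $\nu$, for some unknown $\nu\le\eta$. The learner solves the problem with confidence parameter $\delta$ if, for every such $x$ and $\nu$, it outputs $x$ with probability at least $1-\delta$. An algorithm is a program for a random-access machine with addition and (truncated) subtraction, and its running time is the logarithmic cost; bounds on samples and time are required on every sequence of examples. **Statement.** There is an absolute constant $C>0$ such that for every noise rate $\eta\in(0,\frac13)$ and every constant confidence parameter $\delta\in(0,1)$ there are an algorithm and an $n_0$ (both depending on $\eta$ and $\delta$ only) such that, for all $n\ge n_0$ and all $1\le k\le n$, the algorithm solves the $k$-LPN problem of length $n$ with noise rate $\eta$ and confidence parameter $\delta$, using at most $C\,k\log n$ samples and running time at most $$\binom{n}{\lceil k/2\rceil}^{1+C\,H(1.5\,\eta)}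 .$$ For $k\ge n_0$ the running time is also at most $\binom{n}{\lfloor k/2\rfloor}^{1+C\,H(1.5\,\eta)}$. -/

import Mathlib

open MeasureTheory ProbabilityTheory

namespace LPN

/-- A labelled example: a vector of `{0,1}^n` together with a label. -/
abbrev Example (n : ℕ) : Type := (Fin n → ZMod 2) × ZMod 2

/-- The law of one example `(a, ⟨a, x⟩ + e)` for the hidden vector `x` at noise rate `ν`: `a` is
uniform on `{0,1}^n` and, independently of `a`, the noise bit `e` is `1` with probability `ν`. -/
noncomputable def exampleMeasure {n : ℕ} (x : Fin n → ZMod 2) (ν : unitInterval) :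
    Measure (Example n) :=
  ((uniformOn (Set.univ : Set (Fin n → ZMod 2))).prod
    (bernoulliMeasure (1 : ZMod 2) 0 ν)).map (fun p => (p.1, p.1 ⬝ᵥ x + p.2))

/-- The law of an infinite sequence of independent examples. -/
noncomputable def sourceMeasure {n : ℕ} (x : Fin n → ZMod 2) (ν : unitInterval) :
    Measure (ℕ → Example n) :=
  Measure.infinitePi (fun _ : ℕ => exampleMeasure x ν)

/-- Programs of a random-access machine, in structured form. There are registers `r 0, r 1, …`, of
which a program mentions finitely many, and an unbounded memory `mem 0, mem 1, …`; every cell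
holds a natural number. The only arithmetic is addition and truncated subtraction. -/
inductive Prog : Type
  /-- Do nothing. -/
  | skip : Prog
  /-- `r d := v`. -/
  | const (d v : ℕ) : Prog
  /-- `r d := r a + r b`. -/
  | add (d a b : ℕ) : Prog
  /-- `r d := r a - r b` (and `0` if `r a < r b`). -/
  | sub (d a b : ℕ) : Prog
  /-- `r d := mem (r a)`. -/
  | load (d a : ℕ) : Prog
  /-- `mem (r a) := r b`. -/
  | store (a b : ℕ) : Prog
  /-- Draw the next example `(α, ℓ)` and write `α 0, …, α (n-1), ℓ` to the cells
  `mem (r a), …, mem (r a + n)`. -/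
  | draw (a : ℕ) : Prog
  /-- Sequential composition. -/
  | seq (p q : Prog) : Prog
  /-- `if r a ≠ 0 then p else q`. -/
  | ite (a : ℕ) (p q : Prog) : Prog
  /-- `while r a ≠ 0 do p`. -/
  | loop (a : ℕ) (p : Prog) : Prog

/-- A machine configuration: registers, memory, and the number of examples drawn so far. -/
structure State : Type where
  reg : ℕ → ℕ
  mem : ℕ → ℕ
  drawn : ℕ

/-- The initial configuration on input `(n, k)`. -/
def State.init (n k : ℕ) : State where
  reg := fun i => if i = 0 then n else if i = 1 then k else 0
  mem := fun _ => 0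
  drawn := 0

/-- Assign `v` to register `d`. -/
def State.setReg (σ : State) (d v : ℕ) : State :=
  { σ with reg := Function.update σ.reg d v }

/-- Assign `v` to memory cell `i`. -/
def State.setMem (σ : State) (i v : ℕ) : State :=
  { σ with mem := Function.update σ.mem i v }

/-- Write the example `e` to the `n + 1` memory cells from `b` on, and count it as drawn. -/
def State.putExample {n : ℕ} (σ : State) (b : ℕ) (e : Example n) : State where
  reg := σ.reg
  mem := fun j =>
    if h : b ≤ j ∧ j - b < n then (e.1 ⟨j - b, h.2⟩).val
    else if j = b + n then e.2.val
    else σ.mem j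
  drawn := σ.drawn + 1

/-- `Exec ω p σ t τ`: with the examples of the source being `ω 0, ω 1, …`, program `p`, started in
`σ`, halts in `τ` after running time `t`. Running time is the logarithmic cost: every elementary
instruction and every test costs `1` plus the number of binary digits of the numbers and of the
memory addresses that it handles, and drawing an example costs as much as writing `n + 1` cells.
(`Nat.size` is the number of binary digits.) -/
inductive Exec {n : ℕ} (ω : ℕ → Example n) : Prog → State → ℕ → State → Prop
  | skip (σ : State) : Exec ω Prog.skip σ 1 σ
  | const (d v : ℕ) (σ : State) :
      Exec ω (Prog.const d v) σ (1 + Nat.size v) (σ.setReg d v)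
  | add (d a b : ℕ) (σ : State) :
      Exec ω (Prog.add d a b) σ (1 + Nat.size (σ.reg a) + Nat.size (σ.reg b))
        (σ.setReg d (σ.reg a + σ.reg b))
  | sub (d a b : ℕ) (σ : State) :
      Exec ω (Prog.sub d a b) σ (1 + Nat.size (σ.reg a) + Nat.size (σ.reg b))
        (σ.setReg d (σ.reg a - σ.reg b))
  | load (d a : ℕ) (σ : State) :
      Exec ω (Prog.load d a) σ (1 + Nat.size (σ.reg a) + Nat.size (σ.mem (σ.reg a)))
        (σ.setReg d (σ.mem (σ.reg a)))
  | store (a b : ℕ) (σ : State) :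
      Exec ω (Prog.store a b) σ (1 + Nat.size (σ.reg a) + Nat.size (σ.reg b))
        (σ.setMem (σ.reg a) (σ.reg b))
  | draw (a : ℕ) (σ : State) :
      Exec ω (Prog.draw a) σ ((n + 1) * (2 + Nat.size (σ.reg a + n)))
        (σ.putExample (σ.reg a) (ω σ.drawn))
  | seq {p q : Prog} {σ σ' τ : State} {t t' : ℕ} :
      Exec ω p σ t σ' → Exec ω q σ' t' τ → Exec ω (Prog.seq p q) σ (t + t') τ
  | iteTrue {a : ℕ} {p q : Prog} {σ τ : State} {t : ℕ} :
      σ.reg a ≠ 0 → Exec ω p σ t τ → Exec ω (Prog.ite a p q) σ (1 + Nat.size (σ.reg a) + t) τ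
  | iteFalse {a : ℕ} {p q : Prog} {σ τ : State} {t : ℕ} :
      σ.reg a = 0 → Exec ω q σ t τ → Exec ω (Prog.ite a p q) σ (1 + Nat.size (σ.reg a) + t) τ
  | loopTrue {a : ℕ} {p : Prog} {σ σ' τ : State} {t t' : ℕ} :
      σ.reg a ≠ 0 → Exec ω p σ t σ' → Exec ω (Prog.loop a p) σ' t' τ →
        Exec ω (Prog.loop a p) σ (1 + Nat.size (σ.reg a) + t + t') τ
  | loopFalse {a : ℕ} {p : Prog} {σ : State} :
      σ.reg a = 0 → Exec ω (Prog.loop a p) σ (1 + Nat.size (σ.reg a)) σ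

/-- The memory of `σ` holds the vector `x` in the cells `0, …, n-1`. -/
def State.Outputs {n : ℕ} (σ : State) (x : Fin n → ZMod 2) : Prop :=
  ∀ i : Fin n, σ.mem i = (x i).val

/-- On input `(n, k)` the program `p` solves the problem of learning `k`-parities of length `n` with
noise rate (at most) `η`, with confidence parameter `δ`, at most `s` samples and running time at
most `t`: on every sequence of examples it halts within the bounds on time and samples, and for
every hidden vector of Hamming weight `k` it outputs that vector with probability at least
`1 - δ`. -/
def Solves (p : Prog) (n k : ℕ) (η δ s t : ℝ) : Prop :=
  (∀ ω : ℕ → Example n, ∃ (c : ℕ) (τ : State),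
      Exec ω p (State.init n k) c τ ∧ (c : ℝ) ≤ t ∧ (τ.drawn : ℝ) ≤ s) ∧
    ∀ x : Fin n → ZMod 2, hammingNorm x = k → ∀ ν : unitInterval, (ν : ℝ) ≤ η →
      ENNReal.ofReal (1 - δ) ≤
        sourceMeasure x ν {ω | ∃ (c : ℕ) (τ : State),
          Exec ω p (State.init n k) c τ ∧ τ.Outputs x}

/-- The binary entropy function (in bits). -/
noncomputable def entropy (p : ℝ) : ℝ :=
  p * Real.logb 2 (1 / p) + (1 - p) * Real.logb 2 (1 / (1 - p))

end LPN

/-! The proof is a meet in the middle in which the error pattern is guessed as well.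

Statistics. As `η < 1/3`, some integer `b ≥ 3` has `η < 1/b ≤ 1.5 η` (`exists_nat_inv_between`).
Take `m = 256 k L` examples, `L = ⌊log₂(n/k)⌋ + 1`, and the threshold `t = ⌈m/b⌉`. By Hoeffding's
inequality the hidden vector `x` most likely disagrees with at most `t` examples. Any other vector
disagrees with an example with probability exactly `1/2`, whereas `t ≤ 3m/8`. A union bound shows
that most likely no other vector of weight at most `2⌈k/2⌉` stays below the threshold
(`measure_unique_ge`).

Search. Let `h = ⌈k/2⌉`, let `A` be the matrix of examples and `y` the vector of labels. Then `x` is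
a sum of vectors `l`, `l'` of weight at most `h`, and `A l' = A l + y + e`, where `e` has weight at
most `t`. All `A l'` are entered in a table indexed by `m`-bit keys, and all sums `A l + y + e` are
looked up. Every hit yields a vector of weight at most `2h` with at most `t` disagreements, so by
uniqueness it yields `x` (`learner_spec`, `learner_outputs`).

Time. If `V` and `V'` count the candidates for `l` and for `e`, there are `V V'` lookups. Here `V ≤
(h + 1) (n choose h)`, and `V' ≤ b 2^(m H(1/b))` by `subsetCount_le_exp`. Since `2^m` is at most a
fixed power of the binomial coefficient (`two_pow_sampleCount_le`), `V'` only adds a multiple of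
`H(1.5 η)` to the exponent; factors polynomial in `m` are absorbed for large `n` (`cost_le`).
Rounding `k/2` down instead of up costs a factor of at most `n`, absorbed for large `k`
(`choose_succ_le_rpow`).

Machine. An error pattern is a set of columns of an identity matrix appended to the examples, so one
breadth-first procedure (`expand_spec`) generates both families, with one column addition per set.
The table is never cleared, because memory starts out zero. `Runs` counts elementary steps and keeps
numbers below a bound `M`; the logarithmic cost is then at most the number of steps times `unitCost
M`, which is linear in `m`. -/

namespace LPN

/-! ### Runs with bounded registers and cells -/

/-- All registers and memory cells hold numbers that are at most `M`. -/
def State.Bounded (M : ℕ) (σ : State) : Prop :=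
  (∀ r, σ.reg r ≤ M) ∧ ∀ a, σ.mem a ≤ M

/-- An upper bound for the cost of a single instruction on numbers that are at most `M`. -/
def unitCost (M : ℕ) : ℕ := 2 + 2 * Nat.size M

/-- The program `p` takes `σ` to `τ`; if `σ` is bounded by `M`, then so is `τ`, and at most `N`
elementary steps are made. -/
def Runs (M : ℕ) {n : ℕ} (ω : ℕ → Example n) (p : Prog) (σ : State) (N : ℕ) (τ : State) : Prop :=
  ∃ c, Exec ω p σ c τ ∧ (σ.Bounded M → τ.Bounded M ∧ c ≤ N * unitCost M)

lemma State.Bounded.setReg {M : ℕ} {σ : State} (h : σ.Bounded M) (d : ℕ) {v : ℕ} (hv : v ≤ M) :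
    (σ.setReg d v).Bounded M := by
  refine ⟨fun r => ?_, h.2⟩
  simp only [State.setReg, Function.update_apply]
  split_ifs
  exacts [hv, h.1 r]

lemma State.Bounded.setMem {M : ℕ} {σ : State} (h : σ.Bounded M) (d : ℕ) {v : ℕ} (hv : v ≤ M) :
    (σ.setMem d v).Bounded M := by
  refine ⟨h.1, fun r => ?_⟩
  simp only [State.setMem, Function.update_apply]
  split_ifs
  exacts [hv, h.2 r]

lemma State.Bounded.putExample {M n : ℕ} {σ : State} (h : σ.Bounded M) (b : ℕ) (e : Example n)
    (hM : 1 ≤ M) : (σ.putExample b e).Bounded M := by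
  have hz : ∀ z : ZMod 2, z.val ≤ M := fun z => by
    have := ZMod.val_lt z
    omega
  refine ⟨h.1, fun r => ?_⟩
  simp only [State.putExample]
  split_ifs
  exacts [hz _, hz _, h.2 r]

section
variable {M n : ℕ} {ω : ℕ → Example n} {p q : Prog} {σ σ' τ : State} {N N' : ℕ}

lemma Runs.mono (h : Runs M ω p σ N τ) (hN : N ≤ N') : Runs M ω p σ N' τ := by
  obtain ⟨c, hc, hb⟩ := h
  exact ⟨c, hc, fun h' => ⟨(hb h').1, (hb h').2.trans (Nat.mul_le_mul_right _ hN)⟩⟩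

lemma Runs.seq (h : Runs M ω p σ N σ') (h' : Runs M ω q σ' N' τ) :
    Runs M ω (p.seq q) σ (N + N') τ := by
  obtain ⟨c, hc, hb⟩ := h
  obtain ⟨c', hc', hb'⟩ := h'
  refine ⟨c + c', hc.seq hc', fun hσ => ?_⟩
  obtain ⟨h1, h2⟩ := hb hσ
  obtain ⟨h3, h4⟩ := hb' h1
  refine ⟨h3, ?_⟩
  rw [Nat.add_mul]
  omega

lemma Runs.iteTrue {a : ℕ} (ha : σ.reg a ≠ 0) (h : Runs M ω p σ N τ) :
    Runs M ω (Prog.ite a p q) σ (N + 1) τ := by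
  obtain ⟨c, hc, hb⟩ := h
  refine ⟨_, hc.iteTrue ha, fun hσ => ?_⟩
  obtain ⟨h1, h2⟩ := hb hσ
  have h3 := Nat.size_le_size (hσ.1 a)
  refine ⟨h1, ?_⟩
  rw [Nat.add_mul]
  simp only [unitCost] at *
  omega

lemma Runs.iteFalse {a : ℕ} (ha : σ.reg a = 0) (h : Runs M ω q σ N τ) :
    Runs M ω (Prog.ite a p q) σ (N + 1) τ := by
  obtain ⟨c, hc, hb⟩ := h
  refine ⟨_, hc.iteFalse ha, fun hσ => ?_⟩
  obtain ⟨h1, h2⟩ := hb hσ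
  have h3 := Nat.size_le_size (hσ.1 a)
  refine ⟨h1, ?_⟩
  rw [Nat.add_mul]
  simp only [unitCost] at *
  omega

lemma Runs.loopFalse {a : ℕ} (ha : σ.reg a = 0) : Runs M ω (Prog.loop a p) σ 1 σ := by
  refine ⟨_, Exec.loopFalse ha, fun hσ => ⟨hσ, ?_⟩⟩
  have h3 := Nat.size_le_size (hσ.1 a)
  simp only [unitCost]
  omega

lemma Runs.loopTrue {a : ℕ} (ha : σ.reg a ≠ 0) (h : Runs M ω p σ N σ')
    (h' : Runs M ω (Prog.loop a p) σ' N' τ) :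
    Runs M ω (Prog.loop a p) σ (N' + N + 1) τ := by
  obtain ⟨c, hc, hb⟩ := h
  obtain ⟨c', hc', hb'⟩ := h'
  refine ⟨_, Exec.loopTrue ha hc hc', fun hσ => ?_⟩
  obtain ⟨h1, h2⟩ := hb hσ
  obtain ⟨h4, h5⟩ := hb' h1
  have h3 := Nat.size_le_size (hσ.1 a)
  refine ⟨h4, ?_⟩
  rw [Nat.add_mul, Nat.add_mul]
  simp only [unitCost] at *
  omega

/-- A draw is charged as one elementary step per cell written; the bound on the last address keeps
the price of each cell below `unitCost M`. -/
lemma Runs.draw {a : ℕ} (hM : 1 ≤ M) (h : σ.reg a + n ≤ M) :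
    Runs M ω (Prog.draw a) σ (n + 1) (σ.putExample (σ.reg a) (ω σ.drawn)) := by
  refine ⟨_, Exec.draw a σ, fun hσ => ⟨hσ.putExample _ _ hM, ?_⟩⟩
  have h3 := Nat.size_le_size h
  apply Nat.mul_le_mul_left
  simp only [unitCost]
  omega

/-- A loop whose invariant `I` carries a bound on the number of remaining steps. -/
lemma Runs.loop {a : ℕ} {I : ℕ → State → Prop} (hpos : ∀ N σ, I N σ → 1 ≤ N)
    (hstep : ∀ N σ, I N σ → σ.reg a ≠ 0 →
      ∃ c N' σ', Runs M ω p σ c σ' ∧ I N' σ' ∧ N' + c + 1 ≤ N) (hI : I N σ) :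
    ∃ τ, Runs M ω (Prog.loop a p) σ N τ ∧ (∃ N', I N' τ) ∧ τ.reg a = 0 := by
  -- The budget is the termination measure: the test alone makes it drop in every round.
  induction N using Nat.strong_induction_on generalizing σ with
  | _ N ih =>
    by_cases ha : σ.reg a = 0
    · exact ⟨σ, (Runs.loopFalse ha).mono (hpos _ _ hI), ⟨N, hI⟩, ha⟩
    · obtain ⟨c, N', σ', h1, h2, h3⟩ := hstep N σ hI ha
      obtain ⟨τ, h4, h5, h6⟩ := ih N' (by omega) h2
      exact ⟨τ, (Runs.loopTrue ha h1 h4).mono h3, h5, h6⟩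

/-- A loop that counts down. -/
lemma Runs.countdown {a : ℕ} {I : ℕ → State → Prop} {c i : ℕ} (ha : ∀ i σ, I i σ → σ.reg a = i)
    (hstep : ∀ i σ, I (i + 1) σ → ∃ σ', Runs M ω p σ c σ' ∧ I i σ') (hI : I i σ) :
    ∃ τ, Runs M ω (Prog.loop a p) σ ((c + 1) * i + 1) τ ∧ I 0 τ := by
  induction i generalizing σ with
  | zero => exact ⟨σ, (Runs.loopFalse (ha _ _ hI)).mono (by omega), hI⟩
  | succ i ih =>
    obtain ⟨σ', h1, h2⟩ := hstep i σ hI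
    obtain ⟨τ, h3, h4⟩ := ih h2
    refine ⟨τ, (Runs.loopTrue ?_ h1 h3).mono (by rw [Nat.mul_succ]; omega), h4⟩
    rw [ha _ _ hI]
    omega

end

/-! ### Straight-line programs -/

/-- The sequential composition of a list of programs. -/
def block : List Prog → Prog
  | [] => .skip
  | [p] => p
  | p :: q :: l => .seq p (block (q :: l))

/-- The final state of a straight-line program. -/
def Prog.eval : Prog → State → State
  | .const d v, σ => σ.setReg d v
  | .add d a b, σ => σ.setReg d (σ.reg a + σ.reg b)
  | .sub d a b, σ => σ.setReg d (σ.reg a - σ.reg b)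
  | .load d a, σ => σ.setReg d (σ.mem (σ.reg a))
  | .store a b, σ => σ.setMem (σ.reg a) (σ.reg b)
  | .seq p q, σ => q.eval (p.eval σ)
  | _, σ => σ

/-- The program is a straight-line program that keeps numbers bounded by `M`. -/
def Prog.Keeps (M : ℕ) : Prog → State → Prop
  | .skip, _ => True
  | .const _ v, _ => v ≤ M
  | .add _ a b, σ => σ.reg a + σ.reg b ≤ M
  | .sub _ _ _, _ => True
  | .load _ _, _ => True
  | .store _ _, _ => True
  | .seq p q, σ => p.Keeps M σ ∧ q.Keeps M (p.eval σ)
  | _, _ => False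

/-- The number of instructions of a straight-line program. -/
def Prog.steps : Prog → ℕ
  | .seq p q => p.steps + q.steps
  | _ => 1

/-- `Keeps` asks for something only at constants and additions; the other instructions copy or
decrease numbers that are already bounded. -/
lemma Runs.straight {M n : ℕ} {ω : ℕ → Example n} {p : Prog} {σ : State} (h : p.Keeps M σ) :
    Runs M ω p σ p.steps (p.eval σ) := by
  induction p generalizing σ with
  | skip => exact ⟨_, .skip σ, fun hσ => ⟨hσ, by simp [Prog.steps, unitCost]; omega⟩⟩
  | const d v =>
    refine ⟨_, .const d v σ, fun hσ => ⟨hσ.setReg d h, ?_⟩⟩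
    have := Nat.size_le_size (show v ≤ M from h)
    simp only [Prog.steps, unitCost]
    omega
  | add d a b =>
    refine ⟨_, .add d a b σ, fun hσ => ⟨hσ.setReg d h, ?_⟩⟩
    have := Nat.size_le_size (hσ.1 a)
    have := Nat.size_le_size (hσ.1 b)
    simp only [Prog.steps, unitCost]
    omega
  | sub d a b =>
    refine ⟨_, .sub d a b σ, fun hσ => ⟨hσ.setReg d ((Nat.sub_le _ _).trans (hσ.1 a)), ?_⟩⟩
    have := Nat.size_le_size (hσ.1 a)
    have := Nat.size_le_size (hσ.1 b)
    simp only [Prog.steps, unitCost]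
    omega
  | load d a =>
    refine ⟨_, .load d a σ, fun hσ => ⟨hσ.setReg d (hσ.2 _), ?_⟩⟩
    have := Nat.size_le_size (hσ.1 a)
    have := Nat.size_le_size (hσ.2 (σ.reg a))
    simp only [Prog.steps, unitCost]
    omega
  | store a b =>
    refine ⟨_, .store a b σ, fun hσ => ⟨hσ.setMem _ (hσ.1 _), ?_⟩⟩
    have := Nat.size_le_size (hσ.1 a)
    have := Nat.size_le_size (hσ.1 b)
    simp only [Prog.steps, unitCost]
    omega
  | seq p q ihp ihq => exact (ihp h.1).seq (ihq h.2)
  | draw a => exact h.elim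
  | ite a p q => exact h.elim
  | loop a p => exact h.elim

/-! ### What a program leaves unchanged -/

/-- The registers that a program may change. -/
def Prog.writes : Prog → List ℕ
  | .const d _ => [d]
  | .add d _ _ => [d]
  | .sub d _ _ => [d]
  | .load d _ => [d]
  | .seq p q => p.writes ++ q.writes
  | .ite _ p q => p.writes ++ q.writes
  | .loop _ p => p.writes
  | _ => []

/-- The program draws no examples. -/
def Prog.noDraw : Prog → Bool
  | .draw _ => false
  | .seq p q => p.noDraw && q.noDraw
  | .ite _ p q => p.noDraw && q.noDraw
  | .loop _ p => p.noDraw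
  | _ => true

/-- The frame rule for registers. As `writes` is syntactic, `decide` settles the side condition for
concrete programs. -/
lemma Exec.reg_eq {n : ℕ} {ω : ℕ → Example n} {p : Prog} {σ τ : State} {c : ℕ}
    (h : Exec ω p σ c τ) {r : ℕ} (hr : r ∉ p.writes) : τ.reg r = σ.reg r := by
  induction h with
  | skip | store | draw | loopFalse => rfl
  | const | add | sub | load =>
    simp only [Prog.writes, List.mem_singleton] at hr
    simp [State.setReg, hr]
  | seq _ _ ih1 ih2 =>
    simp only [Prog.writes, List.mem_append, not_or] at hr
    rw [ih2 hr.2, ih1 hr.1]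
  | iteTrue _ _ ih =>
    simp only [Prog.writes, List.mem_append, not_or] at hr
    exact ih hr.1
  | iteFalse _ _ ih =>
    simp only [Prog.writes, List.mem_append, not_or] at hr
    exact ih hr.2
  | loopTrue _ _ _ ih1 ih2 => rw [ih2 hr, ih1 hr]

lemma Exec.drawn_eq {n : ℕ} {ω : ℕ → Example n} {p : Prog} {σ τ : State} {c : ℕ}
    (h : Exec ω p σ c τ) (hp : p.noDraw = true) : τ.drawn = σ.drawn := by
  induction h with
  | skip | store | loopFalse => rfl
  | const | add | sub | load => rfl
  | draw => simp [Prog.noDraw] at hp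
  | seq _ _ ih1 ih2 =>
    simp only [Prog.noDraw, Bool.and_eq_true] at hp
    rw [ih2 hp.2, ih1 hp.1]
  | iteTrue _ _ ih =>
    simp only [Prog.noDraw, Bool.and_eq_true] at hp
    exact ih hp.1
  | iteFalse _ _ ih =>
    simp only [Prog.noDraw, Bool.and_eq_true] at hp
    exact ih hp.2
  | loopTrue _ _ _ ih1 ih2 => rw [ih2 hp, ih1 hp]

lemma Runs.reg_eq {M n : ℕ} {ω : ℕ → Example n} {p : Prog} {σ τ : State} {N : ℕ}
    (h : Runs M ω p σ N τ) {r : ℕ} (hr : r ∉ p.writes) : τ.reg r = σ.reg r := by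
  obtain ⟨c, hc, -⟩ := h
  exact hc.reg_eq hr

lemma Runs.drawn_eq {M n : ℕ} {ω : ℕ → Example n} {p : Prog} {σ τ : State} {N : ℕ}
    (h : Runs M ω p σ N τ) (hp : p.noDraw = true) : τ.drawn = σ.drawn := by
  obtain ⟨c, hc, -⟩ := h
  exact hc.drawn_eq hp

/-! ### Bit vectors in memory -/

/-- One of the two truncated differences is zero and the other is the exclusive or. This is how the
machine adds bits with addition and subtraction alone. -/
lemma val_add_eq (x y : ZMod 2) : (x + y).val = x.val - y.val + (y.val - x.val) := by
  revert x y
  decide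

lemma val_le_one (x : ZMod 2) : x.val ≤ 1 := Nat.le_of_lt_succ (ZMod.val_lt x)

/-- Add, modulo two, the bit at `r 16` and the bit at `r 15`, write it to `r 17`, and advance. -/
def xorBody : Prog :=
  block [.load 19 16, .load 20 15, .sub 21 19 20, .sub 22 20 19, .add 21 21 22, .store 17 21,
    .add 16 16 2, .add 17 17 2, .add 15 15 5, .sub 18 18 2]

/-- The column of the row-major matrix is read with stride `R`. Everything that is read lies below
the target `d`, so the writes cannot spoil later reads. -/
lemma xorLoop_spec {M n : ℕ} {ω : ℕ → Example n} {σ : State} {f g : ℕ → ZMod 2} {m s d a R : ℕ}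
    (h2 : σ.reg 2 = 1) (h5 : σ.reg 5 = R) (hs : σ.reg 16 = s) (hd : σ.reg 17 = d)
    (ha : σ.reg 15 = a) (hm : σ.reg 18 = m) (hf : ∀ i < m, σ.mem (s + i) = (f i).val)
    (hg : ∀ i < m, σ.mem (a + R * i) = (g i).val) (hsd : s + m ≤ d)
    (had : ∀ i < m, a + R * i < d) (hM : d + m ≤ M) (hM' : a + R * m ≤ M) (hM1 : 1 ≤ M) :
    ∃ τ, Runs M ω (.loop 18 xorBody) σ (11 * m + 1) τ ∧ τ.reg 17 = d + m ∧
      (∀ i < m, τ.mem (d + i) = (f i + g i).val) ∧ ∀ j < d, τ.mem j = σ.mem j := by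
  let I : ℕ → State → Prop := fun i τ => ∃ e, e + i = m ∧ τ.reg 18 = i ∧ τ.reg 2 = 1 ∧
    τ.reg 5 = R ∧ τ.reg 16 = s + e ∧ τ.reg 17 = d + e ∧ τ.reg 15 = a + R * e ∧
    (∀ i < e, τ.mem (d + i) = (f i + g i).val) ∧ ∀ j < d, τ.mem j = σ.mem j
  have hstep : ∀ i τ, I (i + 1) τ → ∃ τ', Runs M ω xorBody τ 10 τ' ∧ I i τ' := by
    rintro i τ ⟨e, he, h18, h2, h5, h16, h17, h15, hx, hj⟩
    have hX : τ.mem (s + e) = (f e).val := by rw [hj _ (by omega), hf _ (by omega)]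
    have hY : τ.mem (a + R * e) = (g e).val := by
      rw [hj _ (had _ (by omega)), hg _ (by omega)]
    have hle := val_le_one (f e + g e)
    have hmul : a + R * e + R ≤ M := by
      have := Nat.mul_le_mul_left R (show e + 1 ≤ m by omega)
      rw [Nat.mul_succ] at this
      omega
    refine ⟨_, Runs.straight ?_, e + 1, ?_⟩
    · simp [xorBody, block, Prog.Keeps, Prog.eval, State.setReg, State.setMem,
        h2, h5, h16, h17, h15, hX, hY, ← val_add_eq]
      omega
    · simp [xorBody, block, Prog.eval, State.setReg, State.setMem,
        h2, h5, h16, h17, h15, h18, hX, hY, ← val_add_eq, Function.update_apply]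
      refine ⟨by omega, by omega, by omega, by ring, fun i hi => ?_, fun j hj' => ?_⟩
      · split_ifs with hie
        · rw [hie]
        · exact hx i (by omega)
      · rw [if_neg (by omega)]
        exact hj j hj'
  obtain ⟨τ, h1, e, he, -, -, -, -, h17, -, hx, hj⟩ := Runs.countdown (M := M) (ω := ω)
    (p := xorBody) (σ := σ) (a := 18) (I := I) (c := 10) (i := m) (fun i τ h => by
      obtain ⟨e, -, h, -⟩ := h
      exact h) hstep
    ⟨0, by simp [h2, h5, hs, hd, ha, hm]⟩
  obtain rfl : e = m := by omega
  exact ⟨τ, h1, h17, hx, hj⟩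

/-- The number with the binary digits `f 0, …, f (i - 1)`, the first one being the leading one. -/
def digitsVal (f : ℕ → ZMod 2) : ℕ → ℕ
  | 0 => 0
  | i + 1 => digitsVal f i + digitsVal f i + (f i).val

lemma digitsVal_lt (f : ℕ → ZMod 2) (i : ℕ) : digitsVal f i < 2 ^ i := by
  induction i with
  | zero => simp [digitsVal]
  | succ i ih =>
    have := val_le_one (f i)
    simp only [digitsVal, pow_succ]
    omega

/-- Binary expansions of equal length are injective, so a table cell determines the bits of its
entry and collisions need no treatment. -/
lemma digitsVal_inj {f g : ℕ → ZMod 2} {i : ℕ} :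
    digitsVal f i = digitsVal g i ↔ ∀ j < i, f j = g j := by
  induction i with
  | zero => simp [digitsVal]
  | succ i ih =>
    have h1 := val_le_one (f i)
    have h2 := val_le_one (g i)
    simp only [digitsVal, Nat.lt_succ_iff_lt_or_eq]
    constructor
    · intro h j hj
      rcases hj with hj | rfl
      · exact ih.1 (by omega) j hj
      · exact ZMod.val_injective 2 (by omega)
    · intro h
      rw [ih.2 fun j hj => h j (Or.inl hj), h i (Or.inr rfl)]

/-- Append the sum of the bits at `r 16` and `r 17` to the binary number in `r 24`, and advance. -/
def keyBody : Prog :=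
  block [.load 19 16, .load 20 17, .sub 21 19 20, .sub 22 20 19, .add 21 21 22, .add 24 24 24,
    .add 24 24 21, .add 16 16 2, .add 17 17 2, .sub 18 18 2]

lemma keyLoop_spec {M n : ℕ} {ω : ℕ → Example n} {σ : State} {f g : ℕ → ZMod 2} {m s d : ℕ}
    (h2 : σ.reg 2 = 1) (hs : σ.reg 16 = s) (hd : σ.reg 17 = d) (hk : σ.reg 24 = 0)
    (hm : σ.reg 18 = m) (hf : ∀ i < m, σ.mem (s + i) = (f i).val)
    (hg : ∀ i < m, σ.mem (d + i) = (g i).val)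
    (hM : d + m ≤ M) (hM' : s + m ≤ M) (hM2 : 2 ^ m ≤ M) :
    ∃ τ, Runs M ω (.loop 18 keyBody) σ (11 * m + 1) τ ∧
      τ.reg 24 = digitsVal (fun i => f i + g i) m ∧ τ.mem = σ.mem := by
  let I : ℕ → State → Prop := fun i τ => ∃ e, e + i = m ∧ τ.reg 18 = i ∧ τ.reg 2 = 1 ∧
    τ.reg 16 = s + e ∧ τ.reg 17 = d + e ∧ τ.reg 24 = digitsVal (fun i => f i + g i) e ∧
    τ.mem = σ.mem
  have hstep : ∀ i τ, I (i + 1) τ → ∃ τ', Runs M ω keyBody τ 10 τ' ∧ I i τ' := by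
    rintro i τ ⟨e, he, h18, h2, h16, h17, h24, hj⟩
    have hX : τ.mem (s + e) = (f e).val := by rw [hj, hf _ (by omega)]
    have hY : τ.mem (d + e) = (g e).val := by rw [hj, hg _ (by omega)]
    have hle := val_le_one (f e + g e)
    have hlt := digitsVal_lt (fun i => f i + g i) (e + 1)
    have hpow : 2 ^ (e + 1) ≤ 2 ^ m := Nat.pow_le_pow_right (by norm_num) (by omega)
    have hone : 1 ≤ 2 ^ m := Nat.one_le_two_pow
    simp only [digitsVal] at hlt
    refine ⟨_, Runs.straight ?_, e + 1, ?_⟩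
    · simp [keyBody, block, Prog.Keeps, Prog.eval, State.setReg,
        h2, h16, h17, h24, hX, hY, ← val_add_eq]
      omega
    · simp [keyBody, block, Prog.eval, State.setReg, digitsVal,
        h2, h16, h17, h18, h24, hX, hY, ← val_add_eq]
      exact ⟨by omega, by omega, by omega, hj⟩
  obtain ⟨τ, h1, e, he, -, -, -, -, h24, hj⟩ := Runs.countdown (M := M) (ω := ω)
    (p := keyBody) (σ := σ) (a := 18) (I := I) (c := 10) (i := m) (fun i τ h => by
      obtain ⟨e, -, h, -⟩ := h
      exact h) hstep
    ⟨0, by simp [h2, hs, hd, hm, hk, digitsVal]⟩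
  obtain rfl : e = m := by omega
  exact ⟨τ, h1, h24, hj⟩

/-! ### Trees of sets of columns in memory -/

/-- The registers that hold constants have their values. -/
structure State.HasConsts (σ : State) (m R : ℕ) : Prop where
  one : σ.reg 2 = 1
  zero : σ.reg 3 = 0
  len : σ.reg 4 = m
  row : σ.reg 5 = R
  three : σ.reg 32 = 3
  width : σ.reg 34 = m + 3

lemma State.HasConsts.of_runs {M n m R N : ℕ} {ω : ℕ → Example n} {p : Prog} {σ τ : State}
    (h : σ.HasConsts m R) (hr : Runs M ω p σ N τ) (hp : ∀ r ∈ [2, 3, 4, 5, 32, 34], r ∉ p.writes) :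
    τ.HasConsts m R where
  one := (hr.reg_eq (hp 2 (by simp))).trans h.one
  zero := (hr.reg_eq (hp 3 (by simp))).trans h.zero
  len := (hr.reg_eq (hp 4 (by simp))).trans h.len
  row := (hr.reg_eq (hp 5 (by simp))).trans h.row
  three := (hr.reg_eq (hp 32 (by simp))).trans h.three
  width := (hr.reg_eq (hp 34 (by simp))).trans h.width

/-- Write a node at `r 12`: three header cells, then the sum of the bits of the node at `r 11` and
of the matrix column at `r 15`. -/
def pushNode : Prog :=
  .seq (block [.store 12 13, .add 17 12 2, .store 17 14, .add 17 17 2, .store 17 11, .add 17 17 2,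
    .add 16 11 32, .add 18 4 3]) (.seq (.loop 18 xorBody) (.add 12 17 3))

/-- A node consists of a header (remaining depth, last column, address of the parent) and `m` bits.
The bits are those of the parent plus one column, whence the linear cost. -/
lemma pushNode_spec {M n : ℕ} {ω : ℕ → Example n} {σ : State} {f g : ℕ → ZMod 2}
    {m R T A r j a : ℕ} (hc : σ.HasConsts m R) (h12 : σ.reg 12 = T) (h11 : σ.reg 11 = A)
    (h13 : σ.reg 13 = r) (h14 : σ.reg 14 = j) (h15 : σ.reg 15 = a)
    (hf : ∀ i < m, σ.mem (A + 3 + i) = (f i).val) (hg : ∀ i < m, σ.mem (a + R * i) = (g i).val)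
    (hAT : A + 3 + m ≤ T) (haT : ∀ i < m, a + R * i < T) (hM : T + (m + 3) ≤ M)
    (hM' : a + R * m ≤ M) :
    ∃ τ, Runs M ω pushNode σ (11 * m + 10) τ ∧ τ.reg 12 = T + (m + 3) ∧ τ.mem T = r ∧
      τ.mem (T + 1) = j ∧ τ.mem (T + 2) = A ∧
      (∀ i < m, τ.mem (T + 3 + i) = (f i + g i).val) ∧ ∀ x < T, τ.mem x = σ.mem x := by
  have h2 := hc.one
  have h3 := hc.zero
  have h4 := hc.len
  have h5 := hc.row
  have h32 := hc.three
  let p := block [.store 12 13, .add 17 12 2, .store 17 14, .add 17 17 2, .store 17 11,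
    .add 17 17 2, .add 16 11 32, .add 18 4 3]
  have hp : Runs M ω p σ 8 (p.eval σ) := Runs.straight (by
    simp [p, block, Prog.Keeps, Prog.eval, State.setReg, State.setMem, h2, h3, h4, h11, h12, h32]
    omega)
  have hr : (p.eval σ).reg = fun i => if i = 18 then m else if i = 16 then A + 3 else
      if i = 17 then T + 3 else σ.reg i := by
    funext i
    simp [p, block, Prog.eval, State.setReg, State.setMem, h2, h3, h4, h11, h12, h32,
      Function.update_apply]
  have hmem : (p.eval σ).mem = fun x => if x = T + 2 then A else if x = T + 1 then j else
      if x = T then r else σ.mem x := by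
    funext x
    simp [p, block, Prog.eval, State.setReg, State.setMem, h2, h3, h4, h11, h12, h13, h14, h32,
      Function.update_apply]
  obtain ⟨τ, h, ht, hb, hl⟩ := xorLoop_spec (M := M) (ω := ω) (σ := p.eval σ) (f := f) (g := g)
    (m := m) (s := A + 3) (d := T + 3) (a := a) (R := R) (by simp [hr, h2]) (by simp [hr, h5])
    (by simp [hr]) (by simp [hr]) (by simp [hr, h15]) (by simp [hr])
    (fun i hi => by
      rw [hmem]
      simp only
      rw [if_neg (by omega), if_neg (by omega), if_neg (by omega), hf i hi])
    (fun i hi => by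
      have := haT i hi
      rw [hmem]
      simp only
      rw [if_neg (by omega), if_neg (by omega), if_neg (by omega), hg i hi])
    (by omega) (fun i hi => by have := haT i hi; omega) (by omega) (by omega) (by omega)
  have h3' : τ.reg 3 = 0 := by rw [h.reg_eq (by decide), hr]; simpa using h3
  have hadd : Runs M ω (.add 12 17 3) τ 1 (τ.setReg 12 (T + (m + 3))) := by
    have := Runs.straight (M := M) (ω := ω) (p := .add 12 17 3) (σ := τ)
      (by simp only [Prog.Keeps]; omega)
    rw [Prog.eval, ht, h3', show T + 3 + m + 0 = T + (m + 3) by ring] at this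
    exact this
  refine ⟨_, (hp.seq (h.seq hadd)).mono (by omega), by simp [State.setReg], ?_, ?_, ?_, ?_, ?_⟩
  · exact (hl T (by omega)).trans (by simp [hmem])
  · exact (hl (T + 1) (by omega)).trans (by simp [hmem])
  · exact (hl (T + 2) (by omega)).trans (by simp [hmem])
  · exact hb
  · intro x hx
    refine (hl x (by omega)).trans ?_
    rw [hmem]
    simp only
    rw [if_neg (by omega), if_neg (by omega), if_neg (by omega)]

/-- The parameters of a tree of sets of columns: `m` is the number of bits of a node, `depth` the
maximal size of a set, `cols` the number of columns, `base` the address of the root and `parent` the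
parent cell of the root; `root` are the bits of the root and `col i j` is the bit in row `i` of
column `j`. -/
structure Tree where
  m : ℕ
  depth : ℕ
  cols : ℕ
  base : ℕ
  parent : ℕ
  root : ℕ → ZMod 2
  col : ℕ → ℕ → ZMod 2

namespace Tree

/-- The bits of the node for a list of columns. -/
def bits (T : Tree) (l : List ℕ) (i : ℕ) : ZMod 2 := T.root i + (l.map (T.col i)).sum

/-- The address of the node with a given number. -/
def addr (T : Tree) (q : ℕ) : ℕ := T.base + (T.m + 3) * q

lemma addr_succ (T : Tree) (q : ℕ) : T.addr (q + 1) = T.addr q + (T.m + 3) := by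
  simp only [addr]
  ring

lemma addr_le (T : Tree) {q q' : ℕ} (h : q ≤ q') : T.addr q ≤ T.addr q' :=
  Nat.add_le_add_left (Nat.mul_le_mul_left _ h) _

lemma addr_lt (T : Tree) {q q' : ℕ} (h : q < q') : T.addr q + (T.m + 3) ≤ T.addr q' := by
  rw [← addr_succ]
  exact T.addr_le h

/-- The last column of a list (the lists are built up backwards). -/
def last (T : Tree) (l : List ℕ) : ℕ := l.headD T.cols

/-- The memory holds the nodes for the lists in `Q`. -/
structure Holds (T : Tree) (mem : ℕ → ℕ) (Q : List (List ℕ)) : Prop where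
  rem : ∀ q l, Q[q]? = some l → mem (T.addr q) = T.depth - l.length
  last : ∀ q l, Q[q]? = some l → mem (T.addr q + 1) = T.last l
  bits : ∀ q l, Q[q]? = some l → ∀ i < T.m, mem (T.addr q + 3 + i) = (T.bits l i).val
  root : ∀ q, Q[q]? = some [] → mem (T.addr q + 2) = T.parent
  parent : ∀ q j l, Q[q]? = some (j :: l) →
    ∃ q', Q[q']? = some l ∧ mem (T.addr q + 2) = T.addr q'
  lt : ∀ l ∈ Q, ∀ j ∈ l, j < T.cols
  length_le : ∀ l ∈ Q, l.length ≤ T.depth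

/-- Only the cells of the nodes matter, so writing to the output, to the table or behind the tree
does no harm. -/
lemma Holds.congr {T : Tree} {mem mem' : ℕ → ℕ} {Q : List (List ℕ)} (h : T.Holds mem Q)
    (hm : ∀ q < Q.length, ∀ x, T.addr q ≤ x → x < T.addr q + (T.m + 3) → mem' x = mem x) :
    T.Holds mem' Q where
  rem q l hq := by
    rw [hm q (List.getElem?_eq_some_iff.1 hq).1 _ (by omega) (by omega)]
    exact h.rem q l hq
  last q l hq := by
    rw [hm q (List.getElem?_eq_some_iff.1 hq).1 _ (by omega) (by omega)]
    exact h.last q l hq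
  bits q l hq i hi := by
    rw [hm q (List.getElem?_eq_some_iff.1 hq).1 _ (by omega) (by omega)]
    exact h.bits q l hq i hi
  root q hq := by
    rw [hm q (List.getElem?_eq_some_iff.1 hq).1 _ (by omega) (by omega)]
    exact h.root q hq
  parent q j l hq := by
    rw [hm q (List.getElem?_eq_some_iff.1 hq).1 _ (by omega) (by omega)]
    exact h.parent q j l hq
  lt := h.lt
  length_le := h.length_le

lemma Holds.congr_lt {T : Tree} {mem mem' : ℕ → ℕ} {Q : List (List ℕ)} (h : T.Holds mem Q)
    (hm : ∀ x < T.addr Q.length, mem' x = mem x) : T.Holds mem' Q :=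
  h.congr fun _ hq x _ hx => hm x (hx.trans_le (T.addr_lt hq))

/-- Appending keeps the positions of the old nodes, hence their addresses and parents; only the new
node has to be checked. -/
lemma Holds.push {T : Tree} {mem mem' : ℕ → ℕ} {Q : List (List ℕ)} {l : List ℕ} {q j : ℕ}
    (h : T.Holds mem Q) (hm : ∀ x < T.addr Q.length, mem' x = mem x) (hq : Q[q]? = some l)
    (hl : l.length < T.depth) (hj : j < T.cols)
    (h0 : mem' (T.addr Q.length) = T.depth - (l.length + 1))
    (h1 : mem' (T.addr Q.length + 1) = j) (h2 : mem' (T.addr Q.length + 2) = T.addr q)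
    (h3 : ∀ i < T.m, mem' (T.addr Q.length + 3 + i) = (T.bits l i + T.col i j).val) :
    T.Holds mem' (Q ++ [j :: l]) := by
  have h' := h.congr_lt hm
  have key : ∀ {q' : ℕ} {l' : List ℕ}, (Q ++ [j :: l])[q']? = some l' →
      Q[q']? = some l' ∨ q' = Q.length ∧ l' = j :: l := by
    intro q' l' hq'
    rcases lt_or_ge q' Q.length with hlt | hge
    · rw [List.getElem?_append_left hlt] at hq'
      exact Or.inl hq'
    · rw [List.getElem?_append_right hge] at hq'
      have := (List.getElem?_eq_some_iff.1 hq').1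
      simp only [List.length_singleton] at this
      rw [show q' - Q.length = 0 by omega] at hq'
      simp only [List.getElem?_cons_zero, Option.some.injEq] at hq'
      exact Or.inr ⟨by omega, hq'.symm⟩
  have app : ∀ {q' : ℕ} {l' : List ℕ}, Q[q']? = some l' → (Q ++ [j :: l])[q']? = some l' := by
    intro q' l' hq'
    rw [List.getElem?_append_left (List.getElem?_eq_some_iff.1 hq').1, hq']
  refine ⟨?_, ?_, ?_, ?_, ?_, ?_, ?_⟩
  · intro q' l' hq'
    rcases key hq' with hq' | ⟨rfl, rfl⟩
    · exact h'.rem _ _ hq'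
    · simpa using h0
  · intro q' l' hq'
    rcases key hq' with hq' | ⟨rfl, rfl⟩
    · exact h'.last _ _ hq'
    · simpa [Tree.last] using h1
  · intro q' l' hq' i hi
    rcases key hq' with hq' | ⟨rfl, rfl⟩
    · exact h'.bits _ _ hq' i hi
    · rw [h3 i hi]
      simp only [Tree.bits, List.map_cons, List.sum_cons]
      congr 1
      ring
  · intro q' hq'
    rcases key hq' with hq' | ⟨-, h⟩
    · exact h'.root _ hq'
    · simp at h
  · intro q' j' l' hq'
    rcases key hq' with hq' | ⟨rfl, h⟩
    · obtain ⟨q2, h3, h4⟩ := h'.parent _ _ _ hq'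
      exact ⟨q2, app h3, h4⟩
    · obtain ⟨rfl, rfl⟩ := List.cons.inj h
      exact ⟨q, app hq, h2⟩
  · intro l' hl'
    rcases List.mem_append.1 hl' with hl' | hl'
    · exact h'.lt _ hl'
    · rw [List.mem_singleton.1 hl']
      intro x hx
      rcases List.mem_cons.1 hx with rfl | hx
      · exact hj
      · exact h'.lt l (List.mem_of_getElem? hq) x hx
  · intro l' hl'
    rcases List.mem_append.1 hl' with hl' | hl'
    · exact h'.length_le _ hl'
    · rw [List.mem_singleton.1 hl', List.length_cons]
      exact hl

end Tree

/-- The number of sets of at most `r` out of `j` columns. -/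
def subsetCount : ℕ → ℕ → ℕ
  | 0, _ => 1
  | _ + 1, 0 => 1
  | j + 1, r + 1 => subsetCount j (r + 1) + subsetCount j r

lemma subsetCount_zero_right (j : ℕ) : subsetCount j 0 = 1 := by cases j <;> rfl

lemma subsetCount_pos (j r : ℕ) : 1 ≤ subsetCount j r := by
  induction j generalizing r with
  | zero => simp [subsetCount]
  | succ j ih =>
    cases r with
    | zero => simp [subsetCount]
    | succ r =>
      have := ih (r + 1)
      simp only [subsetCount]
      omega

/-- The recursion distinguishes whether the last column is used, as the branching of the tree does;
Pascal's rule converts it into binomial coefficients. -/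
lemma subsetCount_eq_sum (j r : ℕ) :
    subsetCount j r = ∑ i ∈ Finset.range (r + 1), j.choose i := by
  induction j generalizing r with
  | zero =>
    rw [Finset.sum_range_succ']
    simp [subsetCount]
  | succ j ih =>
    cases r with
    | zero => simp [subsetCount]
    | succ r =>
      rw [subsetCount, ih, ih, Finset.sum_range_succ' _ (r + 1), Finset.sum_range_succ' _ (r + 1)]
      simp only [Nat.choose_succ_succ, Finset.sum_add_distrib, Nat.choose_zero_right]
      ring

/-! ### Breadth-first generation of all small sets of columns -/

/-- Write the child of the node at `r 11` for the preceding column. -/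
def childBody : Prog := .seq (block [.sub 14 14 2, .add 15 28 14]) pushNode

/-- Write the children of the node at `r 11`, and go to the next node. -/
def expandBody : Prog :=
  .seq (.load 13 11) (.seq
    (.ite 13 (.seq (block [.sub 13 13 2, .add 17 11 2, .load 14 17]) (.loop 14 childBody)) .skip)
    (block [.add 11 11 34, .sub 25 12 11]))

/-- Generate the tree whose root is at `r 11`, and whose columns start at `r 28`. -/
def expand : Prog := .seq (.sub 25 12 11) (.loop 25 expandBody)

/-- The memory holds the columns of the tree, in front of the tree. -/
structure Tree.HasMatrix (T : Tree) (mem : ℕ → ℕ) (off R : ℕ) : Prop where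
  lt : ∀ i < T.m, ∀ j < T.cols, off + j + R * i < T.base
  eq : ∀ i < T.m, ∀ j < T.cols, mem (off + j + R * i) = (T.col i j).val

/-- The number of nodes of the subtree of a node. -/
def Tree.weight (T : Tree) (l : List ℕ) : ℕ := subsetCount (T.last l) (T.depth - l.length)

/-- Each subtree contains its root. Thus a bound on the total weight of the waiting nodes also
bounds the space they occupy. -/
lemma Tree.length_le_sum_weight (T : Tree) (U : List (List ℕ)) :
    U.length ≤ (U.map T.weight).sum := by
  induction U with
  | nil => simp
  | cons l U ih =>
    have := subsetCount_pos (T.last l) (T.depth - l.length)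
    simp only [List.length_cons, List.map_cons, List.sum_cons, Tree.weight] at *
    omega

section
variable {M n : ℕ} {ω : ℕ → Example n} {σ : State} {T : Tree} {R off V q : ℕ}
  {Q : List (List ℕ)} {l : List ℕ}

/-- Children are written for the columns `J - 1, …, 0`, all smaller than the last column of the
parent, so sets are built as increasing lists. Unfolding Pascal's recursion, `subsetCount J (r + 1)`
is one for the node itself plus `subsetCount j r` for each child `j < J`. -/
lemma childLoop_spec {J r : ℕ} (hc : σ.HasConsts T.m R) (hmat : T.HasMatrix σ.mem off R)
    (hM : T.addr V ≤ M) (hM' : off + T.cols + R * T.m ≤ M) (hQ : T.Holds σ.mem Q)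
    (hq : Q[q]? = some l) (hl : T.depth - l.length = r + 1) (hJ : T.last l = J)
    (h11 : σ.reg 11 = T.addr q) (h12 : σ.reg 12 = T.addr Q.length) (h13 : σ.reg 13 = r)
    (h14 : σ.reg 14 = J) (h28 : σ.reg 28 = off)
    (hV : Q.length + subsetCount J (r + 1) ≤ V + 1) :
    ∃ (E : List (List ℕ)) (τ : State),
      Runs M ω (.loop 14 childBody) σ ((11 * T.m + 13) * J + 1) τ ∧ T.Holds τ.mem (Q ++ E) ∧
      τ.reg 12 = T.addr (Q ++ E).length ∧ E.length = J ∧ (∀ j < J, j :: l ∈ E) ∧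
      1 + (E.map T.weight).sum = subsetCount J (r + 1) ∧
      ∀ x < T.addr Q.length, τ.mem x = σ.mem x := by
  have hJc : J ≤ T.cols := by
    rw [← hJ]
    cases l with
    | nil => simp [Tree.last]
    | cons j l => exact (hQ.lt _ (List.mem_of_getElem? hq) j (by simp)).le
  have hqQ : q < Q.length := (List.getElem?_eq_some_iff.1 hq).1
  let I : ℕ → State → Prop := fun j τ => ∃ E : List (List ℕ), τ.HasConsts T.m R ∧ j ≤ J ∧
    τ.reg 11 = T.addr q ∧ τ.reg 12 = T.addr (Q ++ E).length ∧ τ.reg 13 = r ∧ τ.reg 14 = j ∧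
    τ.reg 28 = off ∧ T.Holds τ.mem (Q ++ E) ∧ E.length + j = J ∧
    (∀ j' < J, j ≤ j' → j' :: l ∈ E) ∧
    subsetCount j (r + 1) + (E.map T.weight).sum = subsetCount J (r + 1) ∧
    ∀ x < T.addr Q.length, τ.mem x = σ.mem x
  have hstep : ∀ j τ, I (j + 1) τ →
      ∃ τ', Runs M ω childBody τ (11 * T.m + 12) τ' ∧ I j τ' := by
    rintro j τ ⟨E, hc, hjJ, h11, h12, h13, h14, h28, hE, hlen, hmem, hsum, hlow⟩
    let p := block [.sub 14 14 2, .add 15 28 14]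
    have hdup : (E.length : ℕ) ≤ (E.map T.weight).sum := T.length_le_sum_weight E
    have hs1 := subsetCount_pos j (r + 1)
    have hs2 := subsetCount_pos j r
    have hbase : T.base ≤ T.addr Q.length := Nat.le_add_right _ _
    have hle : T.addr Q.length ≤ T.addr (Q ++ E).length := T.addr_le (by simp)
    -- The term `subsetCount (j + 1) (r + 1)` is at least two, which leaves room for the child about
    -- to be written.
    have hVlen : (Q ++ E).length + 1 ≤ V := by
      simp only [subsetCount] at hsum
      rw [List.length_append]
      omega
    have hnext := T.addr_le hVlen
    rw [Tree.addr_succ] at hnext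
    have hqa := T.addr_lt hqQ
    have h2 := hc.one
    have hp : Runs M ω p τ 2 (p.eval τ) := Runs.straight (by
      simp [p, block, Prog.Keeps, Prog.eval, State.setReg, h14, h28, h2]
      omega)
    have hpm : (p.eval τ).mem = τ.mem := by simp [p, block, Prog.eval, State.setReg]
    have hr : (p.eval τ).reg = fun i => if i = 15 then off + j else if i = 14 then j else
        τ.reg i := by
      funext i
      simp [p, block, Prog.eval, State.setReg, h14, h28, h2, Function.update_apply]
    obtain ⟨τ', h, ht, hb0, hb1, hb2, hb3, hl'⟩ := pushNode_spec (M := M) (ω := ω)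
      (σ := p.eval τ) (f := T.bits l) (g := fun i => T.col i j) (m := T.m) (R := R)
      (T := T.addr (Q ++ E).length) (A := T.addr q) (r := r) (j := j) (a := off + j)
      (hc.of_runs hp (by decide)) (by simp [hr, h12]) (by simp [hr, h11]) (by simp [hr, h13])
      (by simp [hr]) (by simp [hr])
      (fun i hi => by
        rw [hpm]
        refine hE.bits q l ?_ i hi
        rw [List.getElem?_append_left hqQ, hq])
      (fun i hi => by
        have := hmat.lt i hi j (by omega)
        rw [hpm, hlow _ (by omega)]
        exact hmat.eq i hi j (by omega))
      (by omega) (fun i hi => by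
        have := hmat.lt i hi j (by omega)
        omega) (by omega) (by omega)
    have hrun := hp.seq h
    have hw : T.weight (j :: l) = subsetCount j r := by
      simp only [Tree.weight, Tree.last, List.headD_cons, List.length_cons]
      congr 1
      omega
    rw [hpm] at hl'
    refine ⟨τ', hrun.mono (by omega), E ++ [j :: l], hc.of_runs hrun (by decide), by omega,
      ?_, ?_, ?_, ?_, ?_, ?_, ?_, ?_, ?_, ?_⟩
    · rw [hrun.reg_eq (by decide), h11]
    · rw [ht, ← Tree.addr_succ]
      simp [add_assoc]
    · rw [hrun.reg_eq (by decide), h13]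
    · rw [h.reg_eq (by decide), hr]
      simp
    · rw [hrun.reg_eq (by decide), h28]
    · rw [← List.append_assoc]
      refine hE.push hl' (q := q) ?_ (by omega) (by omega) (by rw [hb0]; omega) hb1 hb2 hb3
      rw [List.getElem?_append_left hqQ, hq]
    · simp
      omega
    · intro j' hj' hjj'
      rcases eq_or_lt_of_le hjj' with rfl | hlt
      · simp
      · exact List.mem_append_left _ (hmem j' hj' hlt)
    · simp only [List.map_append, List.map_cons, List.map_nil, List.sum_append, List.sum_cons,
        List.sum_nil, hw]
      simp only [subsetCount] at hsum
      omega
    · intro x hx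
      rw [hl' x (by omega), hlow x hx]
  obtain ⟨τ, hrun, E, -, -, -, h12, -, -, -, hE, hlen, hmem, hsum, hlow⟩ :=
    Runs.countdown (M := M) (ω := ω) (p := childBody) (σ := σ) (a := 14) (I := I)
      (c := 11 * T.m + 12) (i := J) (fun i τ h => by
        obtain ⟨e, -, -, -, -, -, h, -⟩ := h
        exact h) hstep
      ⟨[], hc, le_rfl, h11, by simpa using h12, h13, h14, h28, by simpa using hQ, by simp,
        fun j' h h' => by omega, by simp, fun _ _ => rfl⟩
  refine ⟨E, τ, hrun.mono (le_of_eq (by ring)), hE, h12, by omega, fun j hj => hmem j hj (by omega), ?_,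
    hlow⟩
  rw [← hsum]
  simp [subsetCount]

/-- The stored nodes are themselves the queue: `P` has been expanded and `U` is waiting. Expanding a
node trades its weight for one plus the weights of its children, so `P.length` plus the weight of
`U` is always `V`. Once nothing waits, there are exactly `V` nodes. -/
lemma expand_spec (hc : σ.HasConsts T.m R) (hmat : T.HasMatrix σ.mem off R)
    (hV : subsetCount T.cols T.depth = V) (hM : T.addr V ≤ M)
    (hM' : off + T.cols + R * T.m ≤ M) (hQ : T.Holds σ.mem [[]])
    (h11 : σ.reg 11 = T.addr 0) (h12 : σ.reg 12 = T.addr 1) (h28 : σ.reg 28 = off) :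
    ∃ (Q : List (List ℕ)) (τ : State),
      Runs M ω expand σ ((11 * T.m + 22) * V + 2) τ ∧ T.Holds τ.mem Q ∧ Q.length = V ∧
      τ.reg 12 = T.addr V ∧ Q[0]? = some [] ∧
      (∀ l ∈ Q, l.length < T.depth → ∀ j < T.last l, j :: l ∈ Q) ∧
      ∀ x < T.base, τ.mem x = σ.mem x := by
  -- The last equation is the time budget: `9` steps for every node expanded and `11 * T.m + 13` for
  -- every node written.
  let I : ℕ → State → Prop := fun N τ => ∃ P U : List (List ℕ), τ.HasConsts T.m R ∧
    τ.reg 11 = T.addr P.length ∧ τ.reg 12 = T.addr (P ++ U).length ∧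
    τ.reg 25 = T.addr (P ++ U).length - T.addr P.length ∧ τ.reg 28 = off ∧
    T.Holds τ.mem (P ++ U) ∧ P.length + (U.map T.weight).sum = V ∧ (P ++ U)[0]? = some [] ∧
    (∀ l ∈ P, l.length < T.depth → ∀ j < T.last l, j :: l ∈ P ++ U) ∧
    (∀ x < T.base, τ.mem x = σ.mem x) ∧
    N + 9 * P.length + (11 * T.m + 13) * (P ++ U).length = (11 * T.m + 22) * V + 1
  have hpos : ∀ N τ, I N τ → 1 ≤ N := by
    rintro N τ ⟨P, U, -, -, -, -, -, -, hw, -, -, -, hN⟩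
    have h1 := T.length_le_sum_weight U
    have h2 : (P ++ U).length ≤ V := by rw [List.length_append]; omega
    have h3 := Nat.mul_le_mul_left (11 * T.m + 13) h2
    have h4 : (11 * T.m + 22) * V = (11 * T.m + 13) * V + 9 * V := by ring
    omega
  have hstep : ∀ N τ, I N τ → τ.reg 25 ≠ 0 →
      ∃ c N' τ', Runs M ω expandBody τ c τ' ∧ I N' τ' ∧ N' + c + 1 ≤ N := by
    rintro N τ ⟨P, U, hc, h11, h12, h25, h28, hH, hw, hnil, hcl, hlow, hN⟩ hne
    obtain ⟨l, U, rfl⟩ : ∃ l U', U = l :: U' := by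
      cases U with
      | nil => simp [h25] at hne
      | cons l U => exact ⟨l, U, rfl⟩
    have hq : (P ++ l :: U)[P.length]? = some l := by simp
    have hlen : (P ++ l :: U).length = P.length + 1 + U.length := by
      simp
      omega
    have hlw := T.length_le_sum_weight U
    simp only [List.map_cons, List.sum_cons] at hw
    have hwpos : 1 ≤ T.weight l := subsetCount_pos _ _
    have hlenV : P.length + 1 ≤ V := by omega
    have haV := T.addr_le hlenV
    rw [Tree.addr_succ] at haV
    have hbase : T.base ≤ T.addr P.length := Nat.le_add_right _ _
    -- the first instruction
    have hload : Runs M ω (.load 13 11) τ 1 (τ.setReg 13 (T.depth - l.length)) := by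
      have := Runs.straight (M := M) (ω := ω) (p := .load 13 11) (σ := τ) trivial
      rw [Prog.eval, h11, hH.rem _ _ hq] at this
      exact this
    -- the conditional
    have hmid : ∃ (E : List (List ℕ)) (τ' : State), Runs M ω
        (.ite 13 (.seq (block [.sub 13 13 2, .add 17 11 2, .load 14 17]) (.loop 14 childBody))
          .skip) (τ.setReg 13 (T.depth - l.length)) (5 + (11 * T.m + 13) * E.length) τ' ∧
        T.Holds τ'.mem (P ++ l :: U ++ E) ∧ τ'.reg 12 = T.addr (P ++ l :: U ++ E).length ∧
        1 + (E.map T.weight).sum = T.weight l ∧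
        (l.length < T.depth → ∀ j < T.last l, j :: l ∈ E) ∧
        (∀ x < T.addr (P ++ l :: U).length, τ'.mem x = τ.mem x) := by
      by_cases hd : T.depth - l.length = 0
      · refine ⟨[], τ.setReg 13 (T.depth - l.length), (Runs.iteFalse (by simp [State.setReg, hd])
          (Runs.straight (p := .skip) trivial)).mono (by simp [Prog.steps]), by
            rw [List.append_nil]
            exact hH,
          by simpa [State.setReg] using h12, ?_, fun h => by omega, fun _ _ => rfl⟩
        simp [Tree.weight, hd, subsetCount_zero_right]
      · obtain ⟨r, hr⟩ := Nat.exists_eq_succ_of_ne_zero hd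
        let p := block [.sub 13 13 2, .add 17 11 2, .load 14 17]
        let σ' := τ.setReg 13 (T.depth - l.length)
        have h2 := hc.one
        have hp : Runs M ω p σ' 3 (p.eval σ') := Runs.straight (by
          simp [p, block, Prog.Keeps, Prog.eval, State.setReg, σ', h11, h2]
          omega)
        have hpm : (p.eval σ').mem = τ.mem := by simp [p, block, Prog.eval, State.setReg, σ']
        have hpr : (p.eval σ').reg = fun i => if i = 14 then T.last l else
            if i = 17 then T.addr P.length + 1 else if i = 13 then r else τ.reg i := by
          funext i
          simp [p, block, Prog.eval, State.setReg, σ', h11, h2, hr, hH.last _ _ hq,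
            Function.update_apply]
        obtain ⟨E, τ', hrun, hE, ht, hElen, hEmem, hEsum, hElow⟩ := childLoop_spec (M := M)
          (ω := ω) (σ := p.eval σ') (T := T) (R := R) (off := off) (V := V) (q := P.length)
          (Q := P ++ l :: U) (l := l) (J := T.last l) (r := r)
          ((hc.of_runs hload (by decide)).of_runs hp (by decide))
          ⟨hmat.lt, fun i hi j hj => by
            rw [hpm, hlow _ (hmat.lt i hi j hj)]
            exact hmat.eq i hi j hj⟩ hM hM' (by rw [hpm]; exact hH) hq (by omega) rfl
          (by simp [hpr, h11]) (by simp [hpr, h12]) (by simp [hpr]) (by simp [hpr])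
          (by simp [hpr, h28]) (by
            rw [hlen]
            rw [Tree.weight, hr] at hw
            simp only [Nat.succ_eq_add_one] at hw
            omega)
        refine ⟨E, τ', (Runs.iteTrue (by simp [State.setReg, σ', hd]) (hp.seq hrun)).mono ?_, hE, ht,
          ?_, fun _ => hEmem, ?_⟩
        · rw [hElen]
          omega
        · rw [hEsum, Tree.weight, hr]
        · rw [hpm] at hElow
          exact hElow
    obtain ⟨E, τ', hrun, hE, h12', hEsum, hEcl, hElow⟩ := hmid
    have hrun1 := hload.seq hrun
    have h11' : τ'.reg 11 = T.addr P.length := by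
      rw [hrun1.reg_eq (by decide), h11]
    have hc' : τ'.HasConsts T.m R := hc.of_runs hrun1 (by decide)
    let p := block [.add 11 11 34, .sub 25 12 11]
    have h34 := hc'.width
    have hp : Runs M ω p τ' 2 (p.eval τ') := Runs.straight (by
      simp [p, block, Prog.Keeps, h11', h34]
      omega)
    have hpm : (p.eval τ').mem = τ'.mem := by simp [p, block, Prog.eval, State.setReg]
    have hpr : (p.eval τ').reg = fun i => if i = 25 then
          T.addr (P ++ l :: U ++ E).length - T.addr (P.length + 1) else
        if i = 11 then T.addr (P.length + 1) else τ'.reg i := by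
      funext i
      simp only [Tree.addr_succ]
      simp [p, block, Prog.eval, State.setReg, h11', h34, h12', Function.update_apply]
    have hfin : Runs M ω expandBody τ (1 + (5 + (11 * T.m + 13) * E.length + 2)) (p.eval τ') :=
      hload.seq (hrun.seq hp)
    have hlist : (P ++ [l]) ++ (U ++ E) = P ++ l :: U ++ E := by simp
    have hlen' : (P ++ [l]).length = P.length + 1 := by simp
    have hbudget : 9 + (11 * T.m + 13) * E.length ≤ N := by
      have h1 := T.length_le_sum_weight E
      have h2 : (P ++ l :: U).length + E.length ≤ V := by omega
      have h3 := Nat.mul_le_mul_left (11 * T.m + 13) h2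
      have h4 : (11 * T.m + 22) * V = (11 * T.m + 13) * V + 9 * V := by ring
      rw [Nat.mul_add] at h3
      omega
    refine ⟨_, N - (9 + (11 * T.m + 13) * E.length), p.eval τ', hfin, ⟨P ++ [l], U ++ E,
      hc.of_runs hfin (by decide), ?_, ?_, ?_, ?_, ?_, ?_, ?_, ?_, ?_, ?_⟩, ?_⟩
    · rw [hlen', hpr]
      simp
    · rw [hlist, hpr]
      simp [h12']
    · rw [hlist, hlen', hpr]
      simp
    · rw [hfin.reg_eq (by decide), h28]
    · rw [hlist, hpm]
      exact hE
    · rw [hlen', List.map_append, List.sum_append]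
      omega
    · rw [hlist, List.getElem?_append_left (by omega), hnil]
    · intro l' hl' hd j hj
      rw [hlist]
      rcases List.mem_append.1 hl' with hl' | hl'
      · exact List.mem_append_left _ (hcl l' hl' hd j hj)
      · rw [List.mem_singleton.1 hl'] at hd hj ⊢
        exact List.mem_append_right _ (hEcl hd j hj)
    · intro x hx
      rw [hpm, hElow x (hx.trans_le (Nat.le_add_right _ _)), hlow x hx]
    · rw [hlen', hlist, List.length_append,
        Nat.mul_add (11 * T.m + 13) (P ++ l :: U).length E.length]
      omega
    · omega
  have hrun0 : Runs M ω (.sub 25 12 11) σ 1 (σ.setReg 25 (T.addr 1 - T.addr 0)) := by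
    have := Runs.straight (M := M) (ω := ω) (p := .sub 25 12 11) (σ := σ) trivial
    rw [Prog.eval, h11, h12] at this
    exact this
  have hV1 : 1 ≤ V := hV ▸ subsetCount_pos _ _
  obtain ⟨τ, hrun, ⟨N', P, U, -, -, h12', h25, -, hH, hw, hnil, hcl, hlow, -⟩, h0⟩ :=
    Runs.loop (M := M) (ω := ω) (p := expandBody) (a := 25) (I := I) hpos hstep
      (σ := σ.setReg 25 (T.addr 1 - T.addr 0)) (N := (11 * T.m + 22) * V + 1 - (11 * T.m + 13))
      ⟨[], [[]], hc.of_runs hrun0 (by decide), by simpa [State.setReg] using h11,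
        by simpa [State.setReg] using h12, by simp [State.setReg],
        by simpa [State.setReg] using h28, hQ, by simp [Tree.weight, Tree.last, hV], by simp,
        by simp, fun _ _ => rfl, by
          have := Nat.mul_le_mul_left (11 * T.m + 22) hV1
          simp
          omega⟩
  -- Register 25 holds the distance from the current node to the end of the tree, and addresses of
  -- nodes strictly increase.
  obtain rfl : U = [] := by
    cases U with
    | nil => rfl
    | cons l U =>
      have := T.addr_lt (show P.length < (P ++ l :: U).length by simp)
      omega
  simp only [List.append_nil, List.map_nil, List.sum_nil, add_zero] at *
  refine ⟨P, τ, (hrun0.seq hrun).mono (by omega), hH, hw, by rw [h12', hw], hnil, hcl, hlow⟩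

end

/-- A loop with a fixed number of rounds. -/
lemma Runs.iterate {M n : ℕ} {ω : ℕ → Example n} {p : Prog} {σ : State} {a K c : ℕ}
    {I : ℕ → State → Prop} (hne : ∀ q < K, ∀ σ, I q σ → σ.reg a ≠ 0)
    (hK : ∀ σ, I K σ → σ.reg a = 0)
    (hstep : ∀ q < K, ∀ σ, I q σ → ∃ σ', Runs M ω p σ c σ' ∧ I (q + 1) σ') (h0 : I 0 σ) :
    ∃ τ, Runs M ω (.loop a p) σ ((c + 1) * K + 1) τ ∧ I K τ := by
  suffices h : ∀ d q σ, q + d = K → I q σ →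
      ∃ τ, Runs M ω (.loop a p) σ ((c + 1) * d + 1) τ ∧ I K τ from h K 0 σ (by omega) h0
  intro d
  induction d with
  | zero =>
    intro q σ hq hI
    obtain rfl : q = K := by omega
    exact ⟨σ, (Runs.loopFalse (hK _ hI)).mono (by omega), hI⟩
  | succ d ih =>
    intro q σ hq hI
    obtain ⟨σ', h1, h2⟩ := hstep q (by omega) σ hI
    obtain ⟨τ, h3, h4⟩ := ih (q + 1) σ' (by omega) h2
    exact ⟨τ, (Runs.loopTrue (hne q (by omega) σ hI) h1 h3).mono (by rw [Nat.mul_succ]; omega), h4⟩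

/-! ### The table of keys -/

/-- Compute the table address for the sum of the bits of the nodes at `r 23` and `r 29`. -/
def findKey : Prog :=
  .seq (block [.add 16 23 32, .add 17 29 32, .const 24 0, .add 18 4 3])
    (.seq (.loop 18 keyBody) (.add 24 24 8))

lemma findKey_spec {M n m R X u e : ℕ} {ω : ℕ → Example n} {σ : State} {f g : ℕ → ZMod 2}
    (hc : σ.HasConsts m R) (h23 : σ.reg 23 = u) (h29 : σ.reg 29 = e) (h8 : σ.reg 8 = X)
    (hf : ∀ i < m, σ.mem (u + 3 + i) = (f i).val) (hg : ∀ i < m, σ.mem (e + 3 + i) = (g i).val)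
    (hu : u + (m + 3) ≤ M) (he : e + (m + 3) ≤ M) (hX : X + 2 ^ m ≤ M) :
    ∃ τ, Runs M ω findKey σ (11 * m + 6) τ ∧ τ.mem = σ.mem ∧
      τ.reg 24 = X + digitsVal (fun i => f i + g i) m := by
  have h3 := hc.zero
  have h4 := hc.len
  have h32 := hc.three
  let p := block [.add 16 23 32, .add 17 29 32, .const 24 0, .add 18 4 3]
  have hp : Runs M ω p σ 4 (p.eval σ) := Runs.straight (by
    simp [p, block, Prog.Keeps, Prog.eval, State.setReg, h3, h4, h23, h29, h32]
    omega)
  have hpm : (p.eval σ).mem = σ.mem := by simp [p, block, Prog.eval, State.setReg]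
  have hpr : (p.eval σ).reg = fun i => if i = 18 then m else if i = 24 then 0 else
      if i = 17 then e + 3 else if i = 16 then u + 3 else σ.reg i := by
    funext i
    simp [p, block, Prog.eval, State.setReg, h3, h4, h23, h29, h32, Function.update_apply]
  obtain ⟨τ, h, h24, hm⟩ := keyLoop_spec (M := M) (ω := ω) (σ := p.eval σ) (f := f) (g := g)
    (m := m) (s := u + 3) (d := e + 3) (by simp [hpr, hc.one]) (by simp [hpr]) (by simp [hpr])
    (by simp [hpr]) (by simp [hpr]) (by rwa [hpm]) (by rwa [hpm]) (by omega) (by omega) (by omega)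
  have h8' : τ.reg 8 = X := by
    rw [h.reg_eq (by decide), hpr]
    simpa using h8
  have hlt := digitsVal_lt (fun i => f i + g i) m
  have hadd : Runs M ω (.add 24 24 8) τ 1 _ := Runs.straight (p := .add 24 24 8) (by
    simp only [Prog.Keeps]
    omega)
  refine ⟨_, (hp.seq (h.seq hadd)).mono (by omega), hm.trans hpm, ?_⟩
  simp only [Prog.eval, State.setReg, Function.update_self]
  rw [h24, h8', add_comm]

/-- Enter the nodes between `r 9` and `r 10` into the table. -/
def fillTable : Prog :=
  .seq (block [.add 23 9 3, .add 29 9 3, .sub 25 10 23])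
    (.loop 25 (.seq findKey (block [.store 24 23, .add 23 23 34, .sub 25 10 23])))

/-- Every entry of the table at `X` is zero or the address of a node with that key. -/
def Tree.TableSound (T : Tree) (mem : ℕ → ℕ) (Q : List (List ℕ)) (X : ℕ) : Prop :=
  ∀ κ < 2 ^ T.m, mem (X + κ) = 0 ∨
    ∃ q l, Q[q]? = some l ∧ digitsVal (T.bits l) T.m = κ ∧ mem (X + κ) = T.addr q

/-- Sets with equal keys overwrite each other, which is harmless: any representative will do, and a
nonzero cell remains nonzero because addresses of nodes are positive. -/
lemma fillTable_spec {M n R X : ℕ} {ω : ℕ → Example n} {σ : State} {T : Tree}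
    {Q : List (List ℕ)} (hc : σ.HasConsts T.m R) (hQ : T.Holds σ.mem Q) (h0 : Q[0]? = some [])
    (hroot : ∀ i, T.root i = 0) (h8 : σ.reg 8 = X) (h9 : σ.reg 9 = T.addr 0)
    (h10 : σ.reg 10 = T.addr Q.length) (hX : X + 2 ^ T.m ≤ T.base)
    (htab : ∀ κ < 2 ^ T.m, σ.mem (X + κ) = 0) (hM : T.addr Q.length ≤ M) :
    ∃ τ, Runs M ω fillTable σ ((11 * T.m + 10) * Q.length + 4) τ ∧ T.Holds τ.mem Q ∧
      T.TableSound τ.mem Q X ∧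
      (∀ l ∈ Q, τ.mem (X + digitsVal (T.bits l) T.m) ≠ 0) ∧
      ∀ x, x < X ∨ X + 2 ^ T.m ≤ x → τ.mem x = σ.mem x := by
  have hlen : 0 < Q.length := (List.getElem?_eq_some_iff.1 h0).1
  have hpow : 1 ≤ 2 ^ T.m := Nat.one_le_two_pow
  have h01 := T.addr_lt hlen
  have hb0 : T.base ≤ T.addr 0 := Nat.le_add_right _ _
  let I : ℕ → State → Prop := fun q τ => τ.HasConsts T.m R ∧ τ.reg 8 = X ∧
    τ.reg 10 = T.addr Q.length ∧ τ.reg 23 = T.addr q ∧ τ.reg 29 = T.addr 0 ∧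
    τ.reg 25 = T.addr Q.length - T.addr q ∧ T.Holds τ.mem Q ∧ T.TableSound τ.mem Q X ∧
    (∀ q' < q, ∀ l, Q[q']? = some l → τ.mem (X + digitsVal (T.bits l) T.m) ≠ 0) ∧
    ∀ x, x < X ∨ X + 2 ^ T.m ≤ x → τ.mem x = σ.mem x
  let p := block [.add 23 9 3, .add 29 9 3, .sub 25 10 23]
  have h3 := hc.zero
  have hp : Runs M ω p σ 3 (p.eval σ) := Runs.straight (by
    simp [p, block, Prog.Keeps, Prog.eval, State.setReg, h3, h9]
    omega)
  have hpm : (p.eval σ).mem = σ.mem := by simp [p, block, Prog.eval, State.setReg]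
  have hpr : (p.eval σ).reg = fun i => if i = 25 then T.addr Q.length - T.addr 0 else
      if i = 29 then T.addr 0 else if i = 23 then T.addr 0 else σ.reg i := by
    funext i
    simp [p, block, Prog.eval, State.setReg, h3, h9, h10, Function.update_apply]
  have hinit : I 0 (p.eval σ) := by
    refine ⟨hc.of_runs hp (by decide), ?_, ?_, ?_, ?_, ?_, ?_, ?_, ?_, ?_⟩
    · simp [hpr, h8]
    · simp [hpr, h10]
    · simp [hpr]
    · simp [hpr]
    · simp [hpr]
    · rwa [hpm]
    · intro κ hκ
      rw [hpm]
      exact Or.inl (htab κ hκ)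
    · intro q hq
      omega
    · intro x _
      rw [hpm]
  obtain ⟨τ, hrun, -, -, -, -, -, -, hH, hs, hne, hmem⟩ := Runs.iterate (M := M) (ω := ω)
    (p := .seq findKey (block [.store 24 23, .add 23 23 34, .sub 25 10 23]))
    (a := 25) (K := Q.length) (c := 11 * T.m + 9) (I := I)
    (fun q hq τ h => by
      obtain ⟨-, -, -, -, -, h, -⟩ := h
      have := T.addr_lt hq
      omega)
    (fun τ h => by
      obtain ⟨-, -, -, -, -, h, -⟩ := h
      omega)
    (fun q hq τ h => by
      obtain ⟨hc, h8, h10, h23, h29, -, hH, hs, hne, hmem⟩ := h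
      obtain ⟨l, hl⟩ : ∃ l, Q[q]? = some l := ⟨_, List.getElem?_eq_getElem hq⟩
      have hqa := T.addr_lt hq
      obtain ⟨τ', hr, hm, h24⟩ := findKey_spec (M := M) (ω := ω) hc h23 h29 h8
        (hH.bits q l hl) (hH.bits 0 [] h0) (by omega) (by omega) (by omega)
      -- The root has zero bits, so the routine that computes the key of a sum also serves for a
      -- single node.
      have hbits : (fun i => T.bits l i + T.bits [] i) = T.bits l := by
        funext i
        simp [Tree.bits, hroot]
      rw [hbits] at h24
      have h23' : τ'.reg 23 = T.addr q := by rw [hr.reg_eq (by decide), h23]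
      have h10' : τ'.reg 10 = T.addr Q.length := by rw [hr.reg_eq (by decide), h10]
      have h34 : τ'.reg 34 = T.m + 3 := (hc.of_runs hr (by decide)).width
      let p := block [.store 24 23, .add 23 23 34, .sub 25 10 23]
      have hp : Runs M ω p τ' 3 (p.eval τ') := Runs.straight (by
        simp [p, block, Prog.Keeps, Prog.eval, State.setMem, h23', h34]
        omega)
      have hpm : (p.eval τ').mem = fun x => if x = X + digitsVal (T.bits l) T.m then T.addr q
          else τ.mem x := by
        funext x
        simp [p, block, Prog.eval, State.setReg, State.setMem, Function.update_apply, h24, h23', hm]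
      have hrun := hr.seq hp
      have hlt := digitsVal_lt (T.bits l) T.m
      have haddr : T.addr q ≠ 0 := by
        have : T.base ≤ T.addr q := Nat.le_add_right _ _
        omega
      refine ⟨_, hrun, hc.of_runs hrun (by decide), ?_, ?_, ?_, ?_, ?_, ?_, ?_, ?_, ?_⟩
      · rw [hrun.reg_eq (by decide), h8]
      · rw [hrun.reg_eq (by decide), h10]
      · simp [p, block, Prog.eval, State.setReg, State.setMem, h23', h34, Tree.addr_succ]
      · rw [hrun.reg_eq (by decide), h29]
      · simp [p, block, Prog.eval, State.setReg, State.setMem, h23', h34, h10', Tree.addr_succ]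
      · refine hH.congr fun q' _ x hx _ => ?_
        have : T.base ≤ T.addr q' := Nat.le_add_right _ _
        rw [hpm]
        simp only
        rw [if_neg (by omega)]
      · intro κ hκ
        rw [hpm]
        simp only [Nat.add_left_cancel_iff]
        split_ifs with h
        · exact Or.inr ⟨q, l, hl, h.symm, rfl⟩
        · exact hs κ hκ
      · intro q' hq' l' hl'
        rw [hpm]
        simp only [Nat.add_left_cancel_iff]
        split_ifs with h
        · exact haddr
        · rcases Nat.lt_succ_iff_lt_or_eq.1 hq' with hq' | rfl
          · exact hne q' hq' l' hl'
          · rw [hl] at hl'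
            exact absurd (by rw [Option.some.inj hl']) h
      · intro x hx
        rw [hpm]
        simp only
        rw [if_neg (by omega), hmem x hx])
    hinit
  refine ⟨τ, (hp.seq hrun).mono (by change 3 + ((11 * T.m + 10) * Q.length + 1) ≤ _; omega), hH, hs,
    fun l hl => ?_, fun x hx => ?_⟩
  · obtain ⟨q, hq⟩ := List.mem_iff_getElem?.1 hl
    exact hne q (List.getElem?_eq_some_iff.1 hq).1 l hq
  · exact hmem x hx

/-! ### Output -/

/-- Flip the output cells that belong to the columns of the node at `r 23`. -/
def flipSet : Prog :=
  .seq (block [.add 17 23 2, .add 16 17 2, .load 19 16])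
    (.loop 19 (block [.load 20 17, .load 21 20, .sub 21 2 21, .store 20 21, .add 23 19 3,
      .add 17 23 2, .add 16 17 2, .load 19 16]))

lemma one_sub_val (x : ZMod 2) : 1 - x.val = (x + 1).val := by
  revert x
  decide

/-- The loop follows parent pointers down to the sentinel `0` of the root; all other parents have
positive addresses. Since cells are flipped rather than set, two successive calls add their vectors
modulo two. -/
lemma flipLoop_spec {M n R : ℕ} {ω : ℕ → Example n} {T : Tree} {Q : List (List ℕ)}
    (hpar : T.parent = 0) (hbase : T.cols < T.base) (hM : T.addr Q.length ≤ M) (l : List ℕ) :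
    ∀ {σ : State} {q : ℕ} {f : ℕ → ZMod 2}, σ.HasConsts T.m R → T.Holds σ.mem Q →
      Q[q]? = some l → σ.reg 17 = T.addr q + 1 → σ.reg 19 = σ.mem (T.addr q + 2) →
      (∀ x < T.cols, σ.mem x = (f x).val) →
      ∃ τ, Runs M ω (.loop 19 (block [.load 20 17, .load 21 20, .sub 21 2 21, .store 20 21,
          .add 23 19 3, .add 17 23 2, .add 16 17 2, .load 19 16])) σ (9 * l.length + 1) τ ∧
        (∀ x < T.cols, τ.mem x = (f x + l.count x).val) ∧
        ∀ x, T.cols ≤ x → τ.mem x = σ.mem x := by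
  induction l with
  | nil =>
    intro σ q f hc hQ hq h17 h19 hf
    exact ⟨σ, Runs.loopFalse (by rw [h19, hQ.root q hq, hpar]), by simpa using hf,
      fun _ _ => rfl⟩
  | cons j l ih =>
    intro σ q f hc hQ hq h17 h19 hf
    obtain ⟨q', hq', hpa⟩ := hQ.parent q j l hq
    have hlast := hQ.last q _ hq
    simp only [Tree.last, List.headD_cons] at hlast
    have hj : j < T.cols := hQ.lt _ (List.mem_of_getElem? hq) j (by simp)
    have hb : T.base ≤ T.addr q' := Nat.le_add_right _ _
    have hq'a := T.addr_lt (List.getElem?_eq_some_iff.1 hq').1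
    have h2 := hc.one
    have h3 := hc.zero
    rw [hpa] at h19
    have hfj := hf j hj
    let p := block [.load 20 17, .load 21 20, .sub 21 2 21, .store 20 21, .add 23 19 3,
      .add 17 23 2, .add 16 17 2, .load 19 16]
    have hp : Runs M ω p σ 8 (p.eval σ) := Runs.straight (by
      simp [p, block, Prog.Keeps, Prog.eval, State.setReg, State.setMem, h19, h17, h2, h3]
      omega)
    have hpm : (p.eval σ).mem = fun x => if x = j then (f j + 1).val else σ.mem x := by
      funext x
      simp [p, block, Prog.eval, State.setReg, State.setMem, h17, h2, hlast, hfj,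
        Function.update_apply, one_sub_val]
    have h17' : (p.eval σ).reg 17 = T.addr q' + 1 := by
      simp [p, block, Prog.eval, State.setReg, State.setMem, h19, h2, h3]
    have h19' : (p.eval σ).reg 19 = (p.eval σ).mem (T.addr q' + 2) := by
      simp [p, block, Prog.eval, State.setReg, State.setMem, h19, h2, h3]
    obtain ⟨τ, hrun, hcol, hoth⟩ := ih (f := fun x => f x + if x = j then 1 else 0)
      (hc.of_runs hp (by decide))
      (hQ.congr fun q2 _ x hx _ => by
        have : T.base ≤ T.addr q2 := Nat.le_add_right _ _
        rw [hpm]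
        simp only
        rw [if_neg (by omega)]) hq' h17' h19'
      (fun x hx => by
        rw [hpm]
        by_cases h : x = j
        · simp [h]
        · simp [h, hf x hx])
    refine ⟨τ, (Runs.loopTrue (by omega) hp hrun).mono (by simp; omega), fun x hx => ?_,
      fun x hx => ?_⟩
    · rw [hcol x hx, List.count_cons]
      by_cases h : x = j
      · subst h
        simp only [if_true, beq_self_eq_true]
        congr 1
        push_cast
        ring
      · have h' : ¬ j = x := fun e => h e.symm
        simp [h, h']
    · rw [hoth x hx, hpm]
      simp only
      rw [if_neg (by omega)]

lemma flipSet_spec {M n R q : ℕ} {ω : ℕ → Example n} {T : Tree} {Q : List (List ℕ)}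
    {σ : State} {l : List ℕ} {f : ℕ → ZMod 2} (hpar : T.parent = 0) (hbase : T.cols < T.base)
    (hM : T.addr Q.length ≤ M) (hc : σ.HasConsts T.m R) (hQ : T.Holds σ.mem Q)
    (hq : Q[q]? = some l) (h23 : σ.reg 23 = T.addr q) (hf : ∀ x < T.cols, σ.mem x = (f x).val) :
    ∃ τ, Runs M ω flipSet σ (9 * l.length + 4) τ ∧
      (∀ x < T.cols, τ.mem x = (f x + l.count x).val) ∧
      ∀ x, T.cols ≤ x → τ.mem x = σ.mem x := by
  have hqa := T.addr_lt (List.getElem?_eq_some_iff.1 hq).1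
  have h2 := hc.one
  let p := block [.add 17 23 2, .add 16 17 2, .load 19 16]
  have hp : Runs M ω p σ 3 (p.eval σ) := Runs.straight (by
    simp [p, block, Prog.Keeps, Prog.eval, State.setReg, h23, h2]
    omega)
  have hpm : (p.eval σ).mem = σ.mem := by simp [p, block, Prog.eval, State.setReg]
  obtain ⟨τ, hrun, hcol, hoth⟩ := flipLoop_spec (M := M) (ω := ω) hpar hbase hM l
    (hc.of_runs hp (by decide)) (by rwa [hpm]) hq
    (by simp [p, block, Prog.eval, State.setReg, h23, h2])
    (by simp [p, block, Prog.eval, State.setReg, h23, h2]) (by rwa [hpm])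
  rw [hpm] at hoth
  exact ⟨τ, (hp.seq hrun).mono (by omega), hcol, hoth⟩

/-! ### Search for a matching pair -/

/-- Look up the sum of the nodes at `r 23` and `r 29`, record a match, and go to the next `r 29`. -/
def tryPair : Prog :=
  .seq findKey (.seq (.load 19 24) (.seq (.ite 19 (block [.add 26 23 3, .add 27 19 3]) .skip)
    (block [.add 29 29 34, .sub 30 12 29])))

/-- Try all error patterns for the node at `r 23`, and go to the next node. -/
def tryNode : Prog :=
  .seq (block [.add 29 10 3, .sub 30 12 29]) (.seq (.loop 30 tryPair)
    (block [.add 23 23 34, .sub 25 10 23]))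

/-- Look for a node and an error pattern whose sum is in the table. -/
def search : Prog :=
  .seq (block [.add 26 9 3, .add 27 9 3, .add 23 9 3, .sub 25 10 23]) (.loop 25 tryNode)

/-- The table entry for the sum of two sets. -/
def pairCell (T T' : Tree) (mem : ℕ → ℕ) (X : ℕ) (l e : List ℕ) : ℕ :=
  mem (X + digitsVal (fun i => T.bits l i + T'.bits e i) T.m)

/-- The numbers `a` and `b` are the addresses of two nodes. -/
def Tree.ArePair (T : Tree) (Q : List (List ℕ)) (l₁ l₂ : List ℕ) (a b : ℕ) : Prop :=
  ∃ q₁ q₂, Q[q₁]? = some l₁ ∧ Q[q₂]? = some l₂ ∧ a = T.addr q₁ ∧ b = T.addr q₂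

/-- The numbers `a` and `b` are the addresses of two nodes, and these match if `p` holds. -/
def Tree.Match (T T' : Tree) (Q Q' : List (List ℕ)) (p : Prop)
    (a b : ℕ) : Prop :=
  ∃ l₁ l₂, T.ArePair Q l₁ l₂ a b ∧
    (p → ∃ e ∈ Q', ∀ i < T.m, T.bits l₂ i = T.bits l₁ i + T'.bits e i)

section
variable {M n R X V : ℕ} {ω : ℕ → Example n} {σ : State} {T T' : Tree} {Q Q' : List (List ℕ)}

/-- The proposition `p` records that a hit has occurred. Soundness of the table makes every nonzero
entry a genuine match, so a later hit may safely replace an earlier one. -/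
lemma tryPair_spec {l e : List ℕ} {q q' : ℕ} {p p' : Prop} (hm : T'.m = T.m)
    (hc : σ.HasConsts T.m R) (hQ : T.Holds σ.mem Q) (hQ' : T'.Holds σ.mem Q')
    (hs : T.TableSound σ.mem Q X) (hX : X + 2 ^ T.m ≤ M) (hM : T.addr Q.length ≤ M)
    (hM' : T'.addr Q'.length ≤ M) (h8 : σ.reg 8 = X) (h12 : σ.reg 12 = T'.addr Q'.length)
    (hq : Q[q]? = some l) (hq' : Q'[q']? = some e) (h23 : σ.reg 23 = T.addr q)
    (h29 : σ.reg 29 = T'.addr q')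
    (hmat : T.Match T' Q Q' p (σ.reg 26) (σ.reg 27))
    (hp : p' → p ∨ pairCell T T' σ.mem X l e ≠ 0) :
    ∃ τ, Runs M ω tryPair σ (11 * T.m + 12) τ ∧ τ.mem = σ.mem ∧
      τ.reg 29 = T'.addr (q' + 1) ∧ τ.reg 30 = T'.addr Q'.length - T'.addr (q' + 1) ∧
      T.Match T' Q Q' p' (τ.reg 26) (τ.reg 27) := by
  have hqa := T.addr_lt (List.getElem?_eq_some_iff.1 hq).1
  have hqa' := T'.addr_lt (List.getElem?_eq_some_iff.1 hq').1
  rw [hm] at hqa'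
  obtain ⟨τ₁, hr, hmem, h24⟩ := findKey_spec (M := M) (ω := ω) hc h23 h29 h8
    (hQ.bits q l hq) (by rw [← hm]; exact hQ'.bits q' e hq') (by omega) (by omega) hX
  set v := pairCell T T' σ.mem X l e with hv
  have hload : Runs M ω (.load 19 24) τ₁ 1 (τ₁.setReg 19 v) := by
    have := Runs.straight (M := M) (ω := ω) (p := .load 19 24) (σ := τ₁) trivial
    rw [Prog.eval, h24, hmem] at this
    exact this
  have hrl := hr.seq hload
  have hc₁ := hc.of_runs hrl (by decide)
  have hval : v = 0 ∨ ∃ q₂ l₂, Q[q₂]? = some l₂ ∧ v = T.addr q₂ ∧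
      ∀ i < T.m, T.bits l₂ i = T.bits l i + T'.bits e i := by
    rcases hs _ (digitsVal_lt (fun i => T.bits l i + T'.bits e i) T.m) with h | ⟨q₂, l₂, h1, h2, h3⟩
    · exact Or.inl h
    · exact Or.inr ⟨q₂, l₂, h1, h3, digitsVal_inj.1 h2⟩
  have hmid : ∃ τ₂, Runs M ω (.ite 19 (block [.add 26 23 3, .add 27 19 3]) .skip)
      (τ₁.setReg 19 v) 3 τ₂ ∧ τ₂.mem = σ.mem ∧
      T.Match T' Q Q' p' (τ₂.reg 26) (τ₂.reg 27) := by
    by_cases h0 : v = 0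
    · refine ⟨_, (Runs.iteFalse (by simpa [State.setReg] using h0)
        (Runs.straight (p := .skip) trivial)).mono (by simp [Prog.steps]), hmem, ?_⟩
      obtain ⟨l₁, l₂, h1, h2⟩ := hmat
      refine ⟨l₁, l₂, ?_, fun hp' => h2 ((hp hp').resolve_right (by simpa using h0))⟩
      have e1 := hrl.reg_eq (show 26 ∉ _ by decide)
      have e2 := hrl.reg_eq (show 27 ∉ _ by decide)
      simp only [Prog.eval]
      rwa [e1, e2]
    · obtain ⟨q₂, l₂, h1, h2, h3⟩ := hval.resolve_left h0
      have hq₂ := T.addr_lt (List.getElem?_eq_some_iff.1 h1).1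
      have e3 := hc₁.zero
      have e23 : (τ₁.setReg 19 v).reg 23 = T.addr q := by rw [hrl.reg_eq (by decide), h23]
      have e19 : (τ₁.setReg 19 v).reg 19 = v := by simp [State.setReg]
      refine ⟨_, (Runs.iteTrue (by rw [e19]; exact h0) (Runs.straight ?_)).mono ?_, ?_, l, l₂,
        ⟨q, q₂, hq, h1, ?_, ?_⟩, fun _ => ⟨e, List.mem_of_getElem? hq', h3⟩⟩
      · simp only [block, Prog.Keeps, Prog.eval]
        rw [e23, e3]
        refine ⟨by omega, ?_⟩
        have : ((τ₁.setReg 19 v).setReg 26 (T.addr q + 0)).reg 19 = v := by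
          simp [State.setReg]
        have h3' : ((τ₁.setReg 19 v).setReg 26 (T.addr q + 0)).reg 3 = 0 := by
          simpa [State.setReg] using e3
        rw [this, h3']
        omega
      · simp [block, Prog.steps]
      · simp [block, Prog.eval, State.setReg, hmem]
      · simp only [block, Prog.eval, e23, e3]
        simp [State.setReg]
      · simp [State.setReg] at e3
        simp [block, Prog.eval, State.setReg, e3, h2]
  obtain ⟨τ₂, hr₂, hmem₂, hmat₂⟩ := hmid
  have hr2 := hr.seq (hload.seq hr₂)
  have h12' : τ₂.reg 12 = T'.addr Q'.length := by rw [hr2.reg_eq (by decide), h12]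
  have h29' : τ₂.reg 29 = T'.addr q' := by rw [hr2.reg_eq (by decide), h29]
  have h34 := (hc.of_runs hr2 (by decide)).width
  have hlast : Runs M ω (block [.add 29 29 34, .sub 30 12 29]) τ₂ 2 _ := Runs.straight (by
    simp [block, Prog.Keeps, h29', h34]
    omega)
  refine ⟨_, (hr.seq (hload.seq (hr₂.seq hlast))).mono (by omega), ?_, ?_, ?_, ?_⟩
  · simp [block, Prog.eval, State.setReg, hmem₂]
  · simp [block, Prog.eval, State.setReg, Tree.addr_succ, h29', h34, hm]
  · simp [block, Prog.eval, State.setReg, Tree.addr_succ, h29', h34, hm, h12']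
  · rw [hlast.reg_eq (by decide), hlast.reg_eq (by decide)]
    exact hmat₂

lemma tryNode_spec {l : List ℕ} {q : ℕ} {p p' : Prop} (hm : T'.m = T.m)
    (hc : σ.HasConsts T.m R) (hQ : T.Holds σ.mem Q) (hQ' : T'.Holds σ.mem Q')
    (hs : T.TableSound σ.mem Q X) (hX : X + 2 ^ T.m ≤ M) (hM : T.addr Q.length ≤ M)
    (hM' : T'.addr Q'.length ≤ M) (h8 : σ.reg 8 = X) (h10 : σ.reg 10 = T'.addr 0)
    (h10' : T.addr Q.length = T'.addr 0) (h12 : σ.reg 12 = T'.addr Q'.length)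
    (hq : Q[q]? = some l) (h23 : σ.reg 23 = T.addr q)
    (hmat : T.Match T' Q Q' p (σ.reg 26) (σ.reg 27))
    (hp : p' → p ∨ ∃ e ∈ Q', pairCell T T' σ.mem X l e ≠ 0) :
    ∃ τ, Runs M ω tryNode σ ((11 * T.m + 13) * Q'.length + 5) τ ∧ τ.mem = σ.mem ∧
      τ.reg 23 = T.addr (q + 1) ∧ τ.reg 25 = T.addr Q.length - T.addr (q + 1) ∧
      T.Match T' Q Q' p' (τ.reg 26) (τ.reg 27) := by
  have hqa := T.addr_lt (List.getElem?_eq_some_iff.1 hq).1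
  let I : ℕ → State → Prop := fun k τ => τ.HasConsts T.m R ∧ τ.reg 8 = X ∧
    τ.reg 10 = T'.addr 0 ∧ τ.reg 12 = T'.addr Q'.length ∧ τ.reg 23 = T.addr q ∧
    τ.reg 29 = T'.addr k ∧ τ.reg 30 = T'.addr Q'.length - T'.addr k ∧ τ.mem = σ.mem ∧
    T.Match T' Q Q'
      (p ∨ ∃ k' < k, ∃ e, Q'[k']? = some e ∧ pairCell T T' σ.mem X l e ≠ 0)
      (τ.reg 26) (τ.reg 27)
  have h3 := hc.zero
  have hini : Runs M ω (block [.add 29 10 3, .sub 30 12 29]) σ 2 _ := Runs.straight (by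
    simp [block, Prog.Keeps, h10, h3]
    omega)
  obtain ⟨τ, hrun, hc', -, h10τ, -, h23', -, -, hmem, hmatch⟩ := Runs.iterate (M := M) (ω := ω)
    (p := tryPair) (a := 30) (K := Q'.length) (c := 11 * T.m + 12) (I := I)
    (fun k hk τ h => by
      obtain ⟨-, -, -, -, -, -, h, -⟩ := h
      have := T'.addr_lt hk
      omega)
    (fun τ h => by
      obtain ⟨-, -, -, -, -, -, h, -⟩ := h
      omega)
    (fun k hk τ h => by
      obtain ⟨hc, h8, h10, h12, h23, h29, -, hmem, hmatch⟩ := h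
      obtain ⟨e, he⟩ : ∃ e, Q'[k]? = some e := ⟨_, List.getElem?_eq_getElem hk⟩
      rw [← hmem] at hQ hQ' hs hmatch
      obtain ⟨τ', hr, hmem', h29', h30', hmat'⟩ := tryPair_spec (M := M) (ω := ω)
        (p' := p ∨ ∃ k' < k + 1, ∃ e, Q'[k']? = some e ∧ pairCell T T' τ.mem X l e ≠ 0)
        hm hc hQ hQ' hs hX hM hM' h8 h12 hq he h23 h29 hmatch (by
          rintro (h | ⟨k', hk', e', he', hne⟩)
          · exact Or.inl (Or.inl h)
          · rcases Nat.lt_succ_iff_lt_or_eq.1 hk' with hk' | rfl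
            · exact Or.inl (Or.inr ⟨k', hk', e', he', hne⟩)
            · rw [he] at he'
              obtain rfl := Option.some.inj he'
              exact Or.inr hne)
      rw [hmem] at hmat'
      exact ⟨τ', hr, hc.of_runs hr (by decide), by rw [hr.reg_eq (by decide), h8],
        by rw [hr.reg_eq (by decide), h10], by rw [hr.reg_eq (by decide), h12],
        by rw [hr.reg_eq (by decide), h23], h29', h30', hmem'.trans hmem, hmat'⟩)
    (σ := (block [.add 29 10 3, .sub 30 12 29]).eval σ)
    ⟨hc.of_runs hini (by decide), by rw [hini.reg_eq (by decide), h8],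
      by rw [hini.reg_eq (by decide), h10], by rw [hini.reg_eq (by decide), h12],
      by rw [hini.reg_eq (by decide), h23],
      by simp [block, Prog.eval, State.setReg, h10, h3],
      by simp [block, Prog.eval, State.setReg, h10, h12, h3],
      by simp [block, Prog.eval, State.setReg], by
        rw [hini.reg_eq (by decide), hini.reg_eq (by decide)]
        simpa using hmat⟩
  have h34 := hc'.width
  have hlast : Runs M ω (block [.add 23 23 34, .sub 25 10 23]) τ 2 _ := Runs.straight (by
    simp [block, Prog.Keeps, h23', h34]
    omega)
  refine ⟨_, (hini.seq (hrun.seq hlast)).mono ?_, ?_, ?_, ?_, ?_⟩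
  · change 2 + ((11 * T.m + 13) * Q'.length + 1 + 2) ≤ _
    omega
  · simp [block, Prog.eval, State.setReg, hmem]
  · simp [block, Prog.eval, State.setReg, Tree.addr_succ, h23', h34]
  · simp [block, Prog.eval, State.setReg, Tree.addr_succ, h23', h34, h10τ, h10']
  · rw [hlast.reg_eq (by decide), hlast.reg_eq (by decide)]
    obtain ⟨l₁, l₂, h1, h2⟩ := hmatch
    refine ⟨l₁, l₂, h1, fun h => h2 ?_⟩
    rcases hp h with h | ⟨e, he, hne⟩
    · exact Or.inl h
    · obtain ⟨k, hk⟩ := List.mem_iff_getElem?.1 he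
      exact Or.inr ⟨k, (List.getElem?_eq_some_iff.1 hk).1, e, hk, hne⟩

lemma search_spec (hm : T'.m = T.m)
    (hc : σ.HasConsts T.m R) (hQ : T.Holds σ.mem Q) (hQ' : T'.Holds σ.mem Q')
    (h0 : Q[0]? = some [])
    (hs : T.TableSound σ.mem Q X) (hX : X + 2 ^ T.m ≤ M) (hM : T.addr Q.length ≤ M)
    (hM' : T'.addr Q'.length ≤ M) (h8 : σ.reg 8 = X) (h9 : σ.reg 9 = T.addr 0)
    (h10 : σ.reg 10 = T'.addr 0) (h10' : T.addr Q.length = T'.addr 0)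
    (h12 : σ.reg 12 = T'.addr Q'.length) :
    ∃ τ, Runs M ω search σ (((11 * T.m + 13) * Q'.length + 6) * Q.length + 5) τ ∧
      τ.mem = σ.mem ∧ T.Match T' Q Q'
        (∃ l ∈ Q, ∃ e ∈ Q', pairCell T T' σ.mem X l e ≠ 0) (τ.reg 26) (τ.reg 27) := by
  have h01 := T.addr_lt (List.getElem?_eq_some_iff.1 h0).1
  let I : ℕ → State → Prop := fun q τ => τ.HasConsts T.m R ∧ τ.reg 8 = X ∧
    τ.reg 10 = T'.addr 0 ∧ τ.reg 12 = T'.addr Q'.length ∧ τ.reg 23 = T.addr q ∧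
    τ.reg 25 = T.addr Q.length - T.addr q ∧ τ.mem = σ.mem ∧
    T.Match T' Q Q'
      (∃ q' < q, ∃ l, Q[q']? = some l ∧ ∃ e ∈ Q', pairCell T T' σ.mem X l e ≠ 0)
      (τ.reg 26) (τ.reg 27)
  have h3 := hc.zero
  let p := block [.add 26 9 3, .add 27 9 3, .add 23 9 3, .sub 25 10 23]
  have hp : Runs M ω p σ 4 (p.eval σ) := Runs.straight (by
    simp [p, block, Prog.Keeps, Prog.eval, State.setReg, h3, h9]
    omega)
  obtain ⟨τ, hrun, -, -, -, -, -, -, hmem, hmatch⟩ := Runs.iterate (M := M) (ω := ω)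
    (p := tryNode) (a := 25) (K := Q.length) (c := (11 * T.m + 13) * Q'.length + 5) (I := I)
    (fun k hk τ h => by
      obtain ⟨-, -, -, -, -, h, -⟩ := h
      have := T.addr_lt hk
      omega)
    (fun τ h => by
      obtain ⟨-, -, -, -, -, h, -⟩ := h
      omega)
    (fun q hq τ h => by
      obtain ⟨hc, h8, h10, h12, h23, -, hmem, hmatch⟩ := h
      obtain ⟨l, hl⟩ : ∃ l, Q[q]? = some l := ⟨_, List.getElem?_eq_getElem hq⟩
      rw [← hmem] at hQ hQ' hs hmatch
      obtain ⟨τ', hr, hmem', h23', h25', hmat'⟩ := tryNode_spec (M := M) (ω := ω)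
        (p' := ∃ q' < q + 1, ∃ l, Q[q']? = some l ∧ ∃ e ∈ Q', pairCell T T' τ.mem X l e ≠ 0)
        hm hc hQ hQ' hs hX hM hM' h8 h10 h10' h12 hl h23 hmatch (by
          rintro ⟨q', hq', l', hl', hne⟩
          rcases Nat.lt_succ_iff_lt_or_eq.1 hq' with hq' | rfl
          · exact Or.inl ⟨q', hq', l', hl', hne⟩
          · rw [hl] at hl'
            obtain rfl := Option.some.inj hl'
            exact Or.inr hne)
      rw [hmem] at hmat'
      exact ⟨τ', hr, hc.of_runs hr (by decide), by rw [hr.reg_eq (by decide), h8],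
        by rw [hr.reg_eq (by decide), h10], by rw [hr.reg_eq (by decide), h12],
        h23', h25', hmem'.trans hmem, hmat'⟩)
    (σ := p.eval σ)
    ⟨hc.of_runs hp (by decide), by rw [hp.reg_eq (by decide), h8],
      by rw [hp.reg_eq (by decide), h10], by rw [hp.reg_eq (by decide), h12],
      by simp [p, block, Prog.eval, State.setReg, h9, h3],
      by simp [p, block, Prog.eval, State.setReg, h9, h10, h10', h3],
      by simp [p, block, Prog.eval, State.setReg], by
        -- The default record is the root paired with itself, so that the output phase has a valid
        -- pair even without a hit.
        refine ⟨[], [], ⟨0, 0, h0, h0, ?_, ?_⟩, fun ⟨q', hq', _⟩ => by omega⟩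
        · simp [p, block, Prog.eval, State.setReg, h9, h3]
        · simp [p, block, Prog.eval, State.setReg, h9, h3]⟩
  refine ⟨τ, (hp.seq hrun).mono ?_, hmem, ?_⟩
  · change 4 + (((11 * T.m + 13) * Q'.length + 6) * Q.length + 1) ≤ _
    omega
  · obtain ⟨l₁, l₂, h1, h2⟩ := hmatch
    refine ⟨l₁, l₂, h1, fun ⟨l, hl, h⟩ => h2 ?_⟩
    obtain ⟨q, hq⟩ := List.mem_iff_getElem?.1 hl
    exact ⟨q, (List.getElem?_eq_some_iff.1 hq).1, l, hq, h⟩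

end

/-! ### Setting up -/

/-- The number of samples, up to a constant factor, divided by `k`. -/
def logRatio (n k : ℕ) : ℕ := Nat.log 2 (n / k) + 1

/-- The number of samples. -/
def sampleCount (n k : ℕ) : ℕ := 256 * k * logRatio n k

/-- Together with `lt_mul_two_pow`, this lets the machine find `logRatio n k` without division: it
is the number of doublings of `k` needed to exceed `n`. -/
lemma mul_two_pow_le {n k q : ℕ} (hk : 1 ≤ k) (hkn : k ≤ n) (hq : q < logRatio n k) :
    k * 2 ^ q ≤ n := by
  have h0 : n / k ≠ 0 := by
    have := Nat.div_pos hkn hk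
    omega
  have : 2 ^ q ≤ n / k := by
    rw [← Nat.le_log_iff_pow_le (by norm_num) h0]
    simp only [logRatio] at hq
    omega
  rw [mul_comm]
  exact (Nat.le_div_iff_mul_le hk).1 this

lemma lt_mul_two_pow {n k : ℕ} (hk : 1 ≤ k) : n < k * 2 ^ logRatio n k := by
  rw [mul_comm, ← Nat.div_lt_iff_lt_mul hk]
  exact Nat.lt_pow_succ_log_self (by norm_num) _

/-- Compute the number of samples. -/
def countSamples : Prog :=
  .seq (block [.const 2 1, .const 32 3, .add 29 1 3, .add 29 29 29, .add 29 29 29, .add 29 29 29,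
    .add 29 29 29, .add 29 29 29, .add 29 29 29, .add 29 29 29, .add 29 29 29, .add 30 1 3,
    .add 31 0 2, .sub 25 31 30])
  (.loop 25 (block [.add 4 4 29, .add 30 30 30, .sub 25 31 30]))

/-- Eight doublings give `256 * k`. Register 25 holds `n + 1 - k * 2 ^ q`, which vanishes as soon as
the doubling passes `n`. -/
lemma countSamples_spec {M n k : ℕ} {ω : ℕ → Example n} (hk : 1 ≤ k) (hkn : k ≤ n)
    (hM : 2 * n + 3 ≤ M) (hM' : sampleCount n k ≤ M) :
    ∃ τ, Runs M ω countSamples (State.init n k) (4 * logRatio n k + 15) τ ∧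
      τ.reg 4 = sampleCount n k ∧ τ.reg 2 = 1 ∧ τ.reg 32 = 3 ∧ τ.reg 31 = n + 1 ∧
      τ.mem = fun _ => 0 := by
  have hL : 1 ≤ logRatio n k := Nat.le_add_left _ _
  have hkM : 256 * k ≤ M := (Nat.le_mul_of_pos_right _ hL).trans hM'
  let p := block [.const 2 1, .const 32 3, .add 29 1 3, .add 29 29 29, .add 29 29 29,
    .add 29 29 29, .add 29 29 29, .add 29 29 29, .add 29 29 29, .add 29 29 29, .add 29 29 29,
    .add 30 1 3, .add 31 0 2, .sub 25 31 30]
  let σ := p.eval (State.init n k)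
  have hp : Runs M ω p (State.init n k) 14 σ := Runs.straight (by
    simp [p, block, Prog.Keeps, Prog.eval, State.setReg, State.init]
    omega)
  let I : ℕ → State → Prop := fun q τ => τ.reg 4 = 256 * k * q ∧ τ.reg 29 = 256 * k ∧
    τ.reg 30 = k * 2 ^ q ∧ τ.reg 31 = n + 1 ∧ τ.reg 25 = n + 1 - k * 2 ^ q ∧
    τ.mem = fun _ => 0
  obtain ⟨τ, hrun, h4, -, -, h31, -, hmem⟩ := Runs.iterate (M := M) (ω := ω)
    (p := block [.add 4 4 29, .add 30 30 30, .sub 25 31 30]) (a := 25) (K := logRatio n k)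
    (c := 3) (I := I)
    (fun q hq τ h => by
      obtain ⟨-, -, -, -, h, -⟩ := h
      have := mul_two_pow_le hk hkn hq
      omega)
    (fun τ h => by
      obtain ⟨-, -, -, -, h, -⟩ := h
      have := lt_mul_two_pow (n := n) hk
      omega)
    (fun q hq τ h => by
      obtain ⟨h4, h29, h30, h31, -, hmem⟩ := h
      have h1 := mul_two_pow_le hk hkn hq
      have h2 : 256 * k * q + 256 * k ≤ M := by
        rw [← Nat.mul_succ]
        exact (Nat.mul_le_mul_left _ hq).trans hM'
      refine ⟨_, Runs.straight ?_, ?_⟩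
      · simp [block, Prog.Keeps, Prog.eval, State.setReg, h4, h29, h30]
        omega
      · simp only [I]
        simp [block, Prog.eval, State.setReg, h4, h29, h30, h31, hmem, pow_succ]
        refine ⟨by ring, by ring, ?_⟩
        congr 1
        ring)
    (σ := σ) (by
      simp [I, σ, p, block, Prog.eval, State.setReg, State.init]
      ring)
  refine ⟨τ, (hp.seq hrun).mono (by omega), h4, ?_, ?_, h31, hmem⟩
  · rw [hrun.reg_eq (by decide)]
    simp [σ, p, block, Prog.eval, State.setReg]
  · rw [hrun.reg_eq (by decide)]
    simp [σ, p, block, Prog.eval, State.setReg]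

/-- Divide `r 30` by `r 33` and round up. -/
def divUp (d : ℕ) : Prog := .loop 30 (block [.add d d 2, .sub 30 30 33])

/-- Truncated subtraction of `b` reaches zero after exactly `⌈v / b⌉` rounds. -/
lemma divUp_spec {M n d v b : ℕ} {ω : ℕ → Example n} {σ : State} (hd : d ∉ [30, 33, 2])
    (h30 : σ.reg 30 = v) (h33 : σ.reg 33 = b) (h2 : σ.reg 2 = 1) (h0 : σ.reg d = 0) (hb : 1 ≤ b)
    (hM : v + b ≤ M) :
    ∃ τ, Runs M ω (divUp d) σ (3 * ((v + b - 1) / b) + 1) τ ∧ τ.reg d = (v + b - 1) / b ∧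
      τ.mem = σ.mem := by
  simp only [List.mem_cons, not_or, List.not_mem_nil, not_false_eq_true, and_true] at hd
  obtain ⟨hd1, hd2, hd3⟩ := hd
  let I : ℕ → State → Prop := fun q τ => τ.reg 30 = v - b * q ∧ τ.reg 33 = b ∧ τ.reg 2 = 1 ∧
    τ.reg d = q ∧ τ.mem = σ.mem
  obtain ⟨τ, hrun, -, -, -, hd', hmem⟩ := Runs.iterate (M := M) (ω := ω)
    (p := block [.add d d 2, .sub 30 30 33]) (a := 30) (K := (v + b - 1) / b) (c := 2) (I := I)
    (fun q hq τ h => by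
      obtain ⟨h, -⟩ := h
      have h1 := (Nat.le_div_iff_mul_le hb).1 (Nat.succ_le_of_lt hq)
      have h2 : (q + 1) * b = b * q + b := by ring
      simp only [Nat.succ_eq_add_one] at h1
      omega)
    (fun τ h => by
      obtain ⟨h, -⟩ := h
      have h1 := Nat.lt_mul_div_succ (v + b - 1) (show 0 < b by omega)
      rw [Nat.mul_succ] at h1
      omega)
    (fun q hq τ h => by
      obtain ⟨h30, h33, h2, hd, hmem⟩ := h
      have hqM : q + 1 ≤ M := by
        have := Nat.div_le_self (v + b - 1) b
        omega
      refine ⟨_, Runs.straight ?_, ?_⟩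
      · simp [block, Prog.Keeps, hd, h2, hqM]
      · simp only [I]
        simp [block, Prog.eval, State.setReg, Ne.symm hd1, hd1, Ne.symm hd2, Ne.symm hd3,
          hd, h2, h33, h30, hmem,
          Nat.mul_succ, Nat.sub_sub])
    (σ := σ) ⟨by simpa using h30, h33, h2, h0, rfl⟩
  exact ⟨τ, hrun, hd', hmem⟩

/-- The entry in row `i` and column `c` of the sample matrix: the examples, the labels, and an
identity matrix. -/
def entry {n : ℕ} (ω : ℕ → Example n) (i c : ℕ) : ZMod 2 :=
  if h : c < n then (ω i).1 ⟨c, h⟩ else if c = n then (ω i).2 else if c = n + 1 + i then 1 else 0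

/-- Draw one example and write an identity entry. -/
def drawBody : Prog :=
  .seq (.draw 15) (block [.store 16 2, .add 15 15 5, .add 16 16 33, .sub 18 18 2])

/-- Draw all examples. -/
def drawAll : Prog :=
  .seq (block [.add 5 31 4, .add 33 5 2, .add 34 4 32, .add 15 0 3, .add 16 0 31, .add 18 4 3])
    (.loop 18 drawBody)

/-- Each row holds an example, its label and a row of the identity matrix. The position of the
diagonal entry advances by `R + 1`; the other entries of the identity block are zeros of the initial
memory. -/
lemma drawAll_spec {M n m R : ℕ} {ω : ℕ → Example n} {σ : State} (h0 : σ.reg 0 = n)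
    (h2 : σ.reg 2 = 1) (h3 : σ.reg 3 = 0) (h4 : σ.reg 4 = m) (h31 : σ.reg 31 = n + 1)
    (h32 : σ.reg 32 = 3) (hmem : σ.mem = fun _ => 0) (hdr : σ.drawn = 0) (hR : R = n + 1 + m)
    (hM : 2 * n + 3 + m + R * (m + 1) ≤ M) :
    ∃ τ, Runs M ω drawAll σ ((n + 6) * m + 7) τ ∧ τ.HasConsts m R ∧ τ.reg 15 = n + R * m ∧
      τ.drawn = m ∧ (∀ i < m, ∀ c < R, τ.mem (n + R * i + c) = (entry ω i c).val) ∧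
      (∀ x < n, τ.mem x = 0) ∧ ∀ x, n + R * m ≤ x → τ.mem x = 0 := by
  have hRm : R * (m + 1) = R * m + R := by ring
  let p := block [.add 5 31 4, .add 33 5 2, .add 34 4 32, .add 15 0 3, .add 16 0 31, .add 18 4 3]
  have hp : Runs M ω p σ 6 (p.eval σ) := Runs.straight (by
    simp [p, block, Prog.Keeps, Prog.eval, State.setReg, h0, h2, h3, h4, h31, h32]
    omega)
  let I : ℕ → State → Prop := fun j τ => ∃ e, e + j = m ∧ τ.reg 18 = j ∧ τ.reg 2 = 1 ∧
    τ.reg 5 = R ∧ τ.reg 33 = R + 1 ∧ τ.reg 15 = n + R * e ∧ τ.reg 16 = n + R * e + (n + 1 + e) ∧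
    τ.drawn = e ∧ (∀ i < e, ∀ c < R, τ.mem (n + R * i + c) = (entry ω i c).val) ∧
    (∀ x < n, τ.mem x = 0) ∧ ∀ x, n + R * e ≤ x → τ.mem x = 0
  have hstep : ∀ j τ, I (j + 1) τ → ∃ τ', Runs M ω drawBody τ (n + 5) τ' ∧ I j τ' := by
    rintro j τ ⟨e, he, h18, h2, h5, h33, h15, h16, hdr, hrow, hlow, hhigh⟩
    have hRe : R * (e + 1) ≤ R * m := Nat.mul_le_mul_left _ (by omega)
    rw [Nat.mul_succ] at hRe
    have hd : Runs M ω (.draw 15) τ (n + 1) (τ.putExample (n + R * e) (ω e)) := by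
      have := Runs.draw (M := M) (ω := ω) (σ := τ) (a := 15) (by omega) (by omega)
      rwa [h15, hdr] at this
    let σ' := τ.putExample (n + R * e) (ω e)
    have hreg : σ'.reg = τ.reg := rfl
    let p := block [.store 16 2, .add 15 15 5, .add 16 16 33, .sub 18 18 2]
    have hp : Runs M ω p σ' 4 (p.eval σ') := Runs.straight (by
      simp [p, block, Prog.Keeps, Prog.eval, State.setReg, State.setMem, hreg, h5, h15, h16, h33]
      omega)
    have hpm : (p.eval σ').mem = fun x => if x = n + R * e + (n + 1 + e) then 1 else σ'.mem x := by
      funext x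
      simp [p, block, Prog.eval, State.setReg, State.setMem, hreg, h2, h16, Function.update_apply]
    have hnew : ∀ x, (x < n + R * e ∨ n + R * e + R ≤ x) → (p.eval σ').mem x = τ.mem x := by
      intro x hx
      rw [hpm]
      simp only [σ', State.putExample]
      rw [if_neg (by omega), dif_neg (by omega), if_neg (by omega)]
    refine ⟨_, (hd.seq hp).mono (by omega), e + 1, by omega, ?_, ?_, ?_, ?_, ?_, ?_, ?_, ?_, ?_, ?_⟩
    · simp [p, block, Prog.eval, State.setReg, State.setMem, hreg, h2, h18]
    · rw [hp.reg_eq (by decide), hreg, h2]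
    · rw [hp.reg_eq (by decide), hreg, h5]
    · rw [hp.reg_eq (by decide), hreg, h33]
    · simp [p, block, Prog.eval, State.setReg, State.setMem, hreg, h5, h15]
      ring
    · simp [p, block, Prog.eval, State.setReg, State.setMem, hreg, h5, h16, h33]
      ring
    · rw [hp.drawn_eq (by decide)]
      simp [σ', State.putExample, hdr]
    · intro i hi c hc
      rcases Nat.lt_succ_iff_lt_or_eq.1 hi with hi | rfl
      · have : R * (i + 1) ≤ R * e := Nat.mul_le_mul_left _ hi
        rw [Nat.mul_succ] at this
        rw [hnew _ (by omega), hrow i hi c hc]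
      · rw [hpm]
        simp only [σ', State.putExample, entry]
        by_cases h1 : c < n
        · rw [if_neg (by omega), dif_pos ⟨by omega, by omega⟩, dif_pos h1]
          congr 3
          simp
        · rw [dif_neg h1, dif_neg (by omega)]
          by_cases h3 : c = n
          · rw [if_neg (by omega), if_pos (by omega), if_pos h3]
          · rw [if_neg h3]
            by_cases h4 : c = n + 1 + i
            · rw [if_pos (by omega), if_pos h4]
              rfl
            · rw [if_neg (by omega), if_neg (by omega), if_neg h4, hhigh _ (by omega)]
              rfl
    · intro x hx
      rw [hnew x (by omega), hlow x hx]
    · intro x hx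
      rw [Nat.mul_succ] at hx
      rw [hnew x (by omega), hhigh x (by omega)]
  have hpm : (p.eval σ).mem = σ.mem := by simp [p, block, Prog.eval, State.setReg]
  obtain ⟨τ, hrun, e, he, -, -, h5', -, h15, -, hdr', hrow, hlow, hhigh⟩ :=
    Runs.countdown (M := M) (ω := ω) (p := drawBody) (σ := p.eval σ) (a := 18) (I := I)
      (c := n + 5) (i := m) (fun i τ h => by
        obtain ⟨e, -, h, -⟩ := h
        exact h) hstep
      ⟨0, by omega, by simp [p, block, Prog.eval, State.setReg, h3, h4],
        by simp [p, block, Prog.eval, State.setReg, h2],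
        by simp [p, block, Prog.eval, State.setReg, h31, h4, hR],
        by simp [p, block, Prog.eval, State.setReg, h31, h4, h2, hR],
        by simp [p, block, Prog.eval, State.setReg, h0, h3],
        by simp [p, block, Prog.eval, State.setReg, h0, h31],
        by rw [hp.drawn_eq (by decide), hdr], by omega, by simp [hpm, hmem],
        by simp [hpm, hmem]⟩
  obtain rfl : e = m := by omega
  refine ⟨τ, (hp.seq hrun).mono ?_, ⟨?_, ?_, ?_, h5', ?_, ?_⟩, h15, hdr', hrow, hlow, hhigh⟩
  · change 6 + ((n + 6) * e + 1) ≤ _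
    omega
  · rw [hrun.reg_eq (by decide), hp.reg_eq (by decide), h2]
  · rw [hrun.reg_eq (by decide), hp.reg_eq (by decide), h3]
  · rw [hrun.reg_eq (by decide), hp.reg_eq (by decide), h4]
  · rw [hrun.reg_eq (by decide), hp.reg_eq (by decide), h32]
  · rw [hrun.reg_eq (by decide)]
    simp [p, block, Prog.eval, State.setReg, h4, h32]

/-- Fix the address `r 8` of the table and the address `r 9` of the first tree. -/
def placeTable : Prog :=
  .seq (block [.add 8 15 3, .const 9 1, .add 18 4 3])
    (.seq (.loop 18 (block [.add 9 9 9, .sub 18 18 2])) (.add 9 9 8))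

/-- Only the end of the table is computed, by `m` doublings. Its `2 ^ m` cells are left as they are,
which avoids a cost of order `2 ^ m`. -/
lemma placeTable_spec {M n m R X : ℕ} {ω : ℕ → Example n} {σ : State} (hc : σ.HasConsts m R)
    (h15 : σ.reg 15 = X) (hM : X + 2 ^ m + m ≤ M) :
    ∃ τ, Runs M ω placeTable σ (3 * m + 5) τ ∧ τ.reg 8 = X ∧ τ.reg 9 = X + 2 ^ m ∧
      τ.mem = σ.mem := by
  have h2 := hc.one
  have h3 := hc.zero
  have h4 := hc.len
  have hpow : 1 ≤ 2 ^ m := Nat.one_le_two_pow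
  let p := block [.add 8 15 3, .const 9 1, .add 18 4 3]
  have hp : Runs M ω p σ 3 (p.eval σ) := Runs.straight (by
    simp [p, block, Prog.Keeps, Prog.eval, State.setReg, h3, h4, h15]
    omega)
  let I : ℕ → State → Prop := fun j τ => ∃ e, e + j = m ∧ τ.reg 18 = j ∧ τ.reg 2 = 1 ∧
    τ.reg 9 = 2 ^ e ∧ τ.mem = σ.mem
  obtain ⟨τ, hrun, e, he, -, -, h9, hmem⟩ :=
    Runs.countdown (M := M) (ω := ω) (p := block [.add 9 9 9, .sub 18 18 2]) (σ := p.eval σ)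
      (a := 18) (I := I) (c := 2) (i := m) (fun i τ h => by
        obtain ⟨e, -, h, -⟩ := h
        exact h) (fun i τ h => by
        obtain ⟨e, he, h18, h2, h9, hmem⟩ := h
        have : 2 ^ (e + 1) ≤ 2 ^ m := Nat.pow_le_pow_right (by norm_num) (by omega)
        rw [pow_succ] at this
        refine ⟨_, Runs.straight ?_, e + 1, by omega, ?_⟩
        · simp [block, Prog.Keeps, h9]
          omega
        · simp [block, Prog.eval, State.setReg, h9, h18, h2, hmem, pow_succ]
          omega)
      ⟨0, by simp [p, block, Prog.eval, State.setReg, h2, h3, h4]⟩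
  obtain rfl : e = m := by omega
  have h8 : τ.reg 8 = X := by
    rw [hrun.reg_eq (by decide)]
    simp [p, block, Prog.eval, State.setReg, h15, h3]
  have hadd : Runs M ω (.add 9 9 8) τ 1 _ := Runs.straight (p := .add 9 9 8) (by
    simp only [Prog.Keeps]
    omega)
  refine ⟨_, (hp.seq (hrun.seq hadd)).mono (by omega), ?_, ?_, hmem⟩
  · simp [Prog.eval, State.setReg, h8]
  · simp [Prog.eval, State.setReg, h8, h9, add_comm]

/-! ### The learner -/

/-- Compute all parameters, draw the examples, and place the table. -/
def prepare (b : ℕ) : Prog :=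
  .seq countSamples (.seq (block [.add 30 1 3, .const 33 2]) (.seq (divUp 6)
    (.seq (block [.add 30 4 3, .const 33 b]) (.seq (divUp 7) (.seq drawAll placeTable)))))

lemma prepare_spec {M n k b m h t R X : ℕ} {ω : ℕ → Example n} (hk : 1 ≤ k) (hkn : k ≤ n)
    (hb : 1 ≤ b) (hm : m = sampleCount n k) (hh : h = (k + 1) / 2) (ht : t = (m + b - 1) / b)
    (hR : R = n + 1 + m) (hX : X = n + R * m) (hM : 2 * n + 3 + m + b + R * (m + 1) ≤ M)
    (hM' : X + 2 ^ m + m ≤ M) :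
    ∃ τ, Runs M ω (prepare b) (State.init n k)
        (4 * logRatio n k + 3 * h + 3 * t + (n + 9) * m + 33) τ ∧
      τ.HasConsts m R ∧ τ.reg 0 = n ∧ τ.reg 6 = h ∧ τ.reg 7 = t ∧ τ.reg 31 = n + 1 ∧
      τ.reg 8 = X ∧ τ.reg 9 = X + 2 ^ m ∧ τ.drawn = m ∧
      (∀ i < m, ∀ c < R, τ.mem (n + R * i + c) = (entry ω i c).val) ∧
      (∀ x < n, τ.mem x = 0) ∧ ∀ x, X ≤ x → τ.mem x = 0 := by
  obtain ⟨σ₁, r₁, h4, h2, h32, h31, hmem₁⟩ := countSamples_spec (M := M) (ω := ω) hk hkn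
    (by omega) (by omega)
  have h0 : σ₁.reg 0 = n := by rw [r₁.reg_eq (by decide)]; rfl
  have h1 : σ₁.reg 1 = k := by rw [r₁.reg_eq (by decide)]; rfl
  have h3 : σ₁.reg 3 = 0 := by rw [r₁.reg_eq (by decide)]; rfl
  have h6 : σ₁.reg 6 = 0 := by rw [r₁.reg_eq (by decide)]; rfl
  have h7 : σ₁.reg 7 = 0 := by rw [r₁.reg_eq (by decide)]; rfl
  have hd : σ₁.drawn = 0 := by rw [r₁.drawn_eq (by decide)]; rfl
  have r₂ : Runs M ω (block [.add 30 1 3, .const 33 2]) σ₁ 2 _ := Runs.straight (by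
    simp [block, Prog.Keeps, h1, h3]
    omega)
  set σ₂ := (block [.add 30 1 3, .const 33 2]).eval σ₁ with hσ₂
  have hmem₂ : σ₂.mem = σ₁.mem := by simp [hσ₂, block, Prog.eval, State.setReg]
  obtain ⟨σ₃, r₃, h6₃, hmem₃⟩ := divUp_spec (M := M) (ω := ω) (σ := σ₂) (d := 6) (v := k) (b := 2)
    (by decide) (by simp [hσ₂, block, Prog.eval, State.setReg, h1, h3])
    (by simp [hσ₂, block, Prog.eval, State.setReg])
    (by rw [r₂.reg_eq (by decide), h2]) (by rw [r₂.reg_eq (by decide), h6]) (by norm_num)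
    (by omega)
  have q₃ := r₂.seq r₃
  have h3₃ : σ₃.reg 3 = 0 := by rw [q₃.reg_eq (by decide), h3]
  have h4₃ : σ₃.reg 4 = m := by rw [q₃.reg_eq (by decide), h4, hm]
  have r₄ : Runs M ω (block [.add 30 4 3, .const 33 b]) σ₃ 2 _ := Runs.straight (by
    simp [block, Prog.Keeps, h4₃, h3₃]
    omega)
  set σ₄ := (block [.add 30 4 3, .const 33 b]).eval σ₃ with hσ₄
  have hmem₄ : σ₄.mem = σ₃.mem := by simp [hσ₄, block, Prog.eval, State.setReg]
  have hr₄ : ∀ r ∉ (block [.add 30 4 3, .const 33 b]).writes, σ₄.reg r = σ₃.reg r :=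
    fun r hr => r₄.reg_eq hr
  have hw₄ : (block [.add 30 4 3, .const 33 b]).writes = [30, 33] := rfl
  rw [hw₄] at hr₄
  obtain ⟨σ₅, r₅, h7₅, hmem₅⟩ := divUp_spec (M := M) (ω := ω) (σ := σ₄) (d := 7) (v := m) (b := b)
    (by decide) (by simp [hσ₄, block, Prog.eval, State.setReg, h4₃, h3₃])
    (by simp [hσ₄, block, Prog.eval, State.setReg])
    (by rw [hr₄ _ (by decide), q₃.reg_eq (by decide), h2])
    (by rw [hr₄ _ (by decide), q₃.reg_eq (by decide), h7]) hb (by omega)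
  have hreg₅ : ∀ r ∉ [6, 7, 30, 33], σ₅.reg r = σ₁.reg r := by
    intro r hr
    simp only [List.mem_cons, not_or, List.not_mem_nil, not_false_eq_true, and_true] at hr
    rw [r₅.reg_eq (by simp [divUp, block, Prog.writes]; omega), hr₄ _ (by simp; omega),
      q₃.reg_eq (by simp [divUp, block, Prog.writes]; omega)]
  have hdr₅ : σ₅.drawn = 0 := by
    rw [r₅.drawn_eq (by decide), r₄.drawn_eq (by rfl), q₃.drawn_eq (by decide), hd]
  have hmem₅' : σ₅.mem = fun _ => 0 := by rw [hmem₅, hmem₄, hmem₃, hmem₂, hmem₁]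
  obtain ⟨σ₆, r₆, hc₆, h15, hdr₆, hrow, hlow, hhigh⟩ := drawAll_spec (M := M) (ω := ω) (σ := σ₅)
    (m := m) (R := R) (by rw [hreg₅ _ (by decide), h0]) (by rw [hreg₅ _ (by decide), h2])
    (by rw [hreg₅ _ (by decide), h3]) (by rw [hreg₅ _ (by decide), h4, hm])
    (by rw [hreg₅ _ (by decide), h31]) (by rw [hreg₅ _ (by decide), h32]) hmem₅' hdr₅ hR (by omega)
  obtain ⟨τ, r₇, h8, h9, hmem₇⟩ := placeTable_spec (M := M) (ω := ω) hc₆ h15 (by omega)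
  have q₇ := r₆.seq r₇
  refine ⟨τ, (r₁.seq (r₂.seq (r₃.seq (r₄.seq (r₅.seq (r₆.seq r₇)))))).mono ?_,
    hc₆.of_runs r₇ (by decide), ?_, ?_, ?_, ?_, ?_, ?_, ?_, ?_, ?_, ?_⟩
  · have h1 : (n + 9) * m = (n + 6) * m + 3 * m := by ring
    rw [← ht, h1]
    have h2 : (k + 2 - 1) / 2 = h := by rw [hh]; rfl
    rw [h2]
    omega
  · rw [q₇.reg_eq (by decide), hreg₅ _ (by decide), h0]
  · rw [q₇.reg_eq (by decide), r₅.reg_eq (by decide), hr₄ _ (by decide), h6₃, hh]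
    rfl
  · rw [q₇.reg_eq (by decide), h7₅, ht]
  · rw [q₇.reg_eq (by decide), hreg₅ _ (by decide), h31]
  · rw [h8, hX]
  · rw [h9, hX]
  · rw [r₇.drawn_eq (by decide), hdr₆]
  · rw [hmem₇]
    exact hrow
  · rw [hmem₇]
    exact hlow
  · rw [hmem₇, hX]
    exact hhigh

/-- The tree of sets of at most `h` of the `n` coordinates. -/
def vectorTree {n : ℕ} (ω : ℕ → Example n) (m h base : ℕ) : Tree where
  m := m
  depth := h
  cols := n
  base := base
  parent := 0
  root := fun _ => 0
  col := entry ω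

/-- The tree of sets of at most `t` of the `m` examples, with the labels added. -/
def errorTree {n : ℕ} (ω : ℕ → Example n) (m t base parent : ℕ) : Tree where
  m := m
  depth := t
  cols := m
  base := base
  parent := parent
  root := fun i => entry ω i n
  col := fun i j => entry ω i (n + 1 + j)

/-- Generate both trees. -/
def growTrees : Prog :=
  .seq (block [.store 9 6, .add 17 9 2, .store 17 0, .add 12 9 34, .add 11 9 3, .add 28 0 3])
    (.seq expand
      (.seq (block [.add 10 12 3, .add 13 7 3, .add 14 4 3, .add 11 9 3, .add 15 0 0])
        (.seq pushNode (.seq (block [.add 11 10 3, .add 28 0 31]) expand))))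

/-- The list contains every increasing list of at most `h` numbers that are less than `n`. -/
def IsComplete (n h : ℕ) (Q : List (List ℕ)) : Prop :=
  ∀ l : List ℕ, l.Pairwise (· < ·) → (∀ j ∈ l, j < n) → l.length ≤ h → l ∈ Q

/-- An increasing list arises from the empty one by prepending its elements from the largest to the
smallest, and each step is an instance of the closure property. -/
lemma Tree.isComplete {T : Tree} {Q : List (List ℕ)} (hnil : [] ∈ Q)
    (hcl : ∀ l ∈ Q, l.length < T.depth → ∀ j < T.last l, j :: l ∈ Q) :
    IsComplete T.cols T.depth Q := by
  intro l
  induction l with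
  | nil => exact fun _ _ _ => hnil
  | cons j l ih =>
    intro hp hlt hlen
    rw [List.pairwise_cons] at hp
    refine hcl l (ih hp.2 (fun x hx => hlt x (List.mem_cons_of_mem _ hx)) (by simp at hlen; omega))
      (by simp at hlen; omega) j ?_
    cases l with
    | nil => exact hlt j (by simp)
    | cons x l => exact hp.1 x (by simp)

-- The root of the second tree is written by the ordinary node routine, as the zero root of the
-- first tree plus the column of labels. Its nodes therefore carry labels plus error pattern, the
-- error columns being those of the identity block.
set_option maxHeartbeats 1000000 in
lemma growTrees_spec {M n m h t R X Q₀ V V' : ℕ} {ω : ℕ → Example n} {σ : State}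
    (hc : σ.HasConsts m R) (hR : R = n + 1 + m) (h0 : σ.reg 0 = n) (h6 : σ.reg 6 = h)
    (h7 : σ.reg 7 = t) (h31 : σ.reg 31 = n + 1) (h9 : σ.reg 9 = Q₀) (hX : X = n + R * m)
    (hQ₀ : Q₀ = X + 2 ^ m)
    (hrow : ∀ i < m, ∀ c < R, σ.mem (n + R * i + c) = (entry ω i c).val)
    (hhigh : ∀ x, X ≤ x → σ.mem x = 0) (hV : V = subsetCount n h) (hV' : V' = subsetCount m t)
    (ht : t ≤ M)
    (hM : 2 * n + 1 + m + R * m ≤ M) (hM' : Q₀ + (m + 3) * (V + V') ≤ M) :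
    ∃ (Q Q' : List (List ℕ)) (τ : State), Runs M ω growTrees σ
        ((11 * m + 22) * V + (11 * m + 22) * V' + 11 * m + 27) τ ∧
      (vectorTree ω m h Q₀).Holds τ.mem Q ∧
      (errorTree ω m t ((vectorTree ω m h Q₀).addr V) Q₀).Holds τ.mem Q' ∧
      Q.length = V ∧ Q'.length = V' ∧ Q[0]? = some [] ∧ IsComplete n h Q ∧ IsComplete m t Q' ∧
      τ.reg 10 = (vectorTree ω m h Q₀).addr V ∧
      τ.reg 12 = (errorTree ω m t ((vectorTree ω m h Q₀).addr V) Q₀).addr V' ∧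
      ∀ x < Q₀, τ.mem x = σ.mem x := by
  set T := vectorTree ω m h Q₀ with hT
  set T' := errorTree ω m t (T.addr V) Q₀ with hT'
  have hTm : T.m = m := rfl
  have hTm' : T'.m = m := rfl
  have hT0 : T.addr 0 = Q₀ := by simp [Tree.addr, hT, vectorTree]
  have hT1 : T.addr 1 = Q₀ + (m + 3) := by simp [Tree.addr, hT, vectorTree]
  have hV1 : 1 ≤ V := hV ▸ subsetCount_pos _ _
  have hV1' : 1 ≤ V' := hV' ▸ subsetCount_pos _ _
  have haV : T.addr V = Q₀ + (m + 3) * V := rfl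
  have haV' : T'.addr V' = Q₀ + (m + 3) * V + (m + 3) * V' := rfl
  have ha1V : T.addr 0 + (m + 3) ≤ T.addr V := T.addr_lt hV1
  have haV1' : T'.addr 0 + (m + 3) ≤ T'.addr V' := T'.addr_lt hV1'
  have hmulV : (m + 3) * (V + V') = (m + 3) * V + (m + 3) * V' := by ring
  have hT'0 : T'.addr 0 = T.addr V := by simp [Tree.addr, hT', errorTree]
  have hT'1 : T'.addr 1 = T.addr V + (m + 3) := by simp [Tree.addr, hT', errorTree]
  have hRi : ∀ i < m, R * i + R ≤ R * m := fun i hi => by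
    rw [← Nat.mul_succ]
    exact Nat.mul_le_mul_left _ hi
  have hpow : 1 ≤ 2 ^ m := Nat.one_le_two_pow
  -- the root of the first tree
  have h2 := hc.one
  have h3 := hc.zero
  have h34 := hc.width
  let p₁ := block [.store 9 6, .add 17 9 2, .store 17 0, .add 12 9 34, .add 11 9 3, .add 28 0 3]
  have r₁ : Runs M ω p₁ σ 6 (p₁.eval σ) := Runs.straight (by
    simp [p₁, block, Prog.Keeps, Prog.eval, State.setReg, State.setMem, h0, h2, h3, h9, h34]
    omega)
  have hm₁ : (p₁.eval σ).mem = fun x => if x = Q₀ + 1 then n else if x = Q₀ then h else σ.mem x := by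
    funext x
    simp [p₁, block, Prog.eval, State.setReg, State.setMem, h0, h2, h6, h9, Function.update_apply]
  have hroot : T.Holds (p₁.eval σ).mem [[]] := by
    have key : ∀ {q : ℕ} {l : List ℕ}, ([[]] : List (List ℕ))[q]? = some l → q = 0 ∧ l = [] := by
      intro q l hq
      cases q with
      | zero => simpa using hq.symm
      | succ q => simp at hq
    refine ⟨?_, ?_, ?_, ?_, ?_, ?_, ?_⟩
    · intro q l hq
      obtain ⟨rfl, rfl⟩ := key hq
      rw [hm₁, hT0]
      simp [hT, vectorTree]
    · intro q l hq
      obtain ⟨rfl, rfl⟩ := key hq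
      rw [hm₁, hT0]
      simp [hT, vectorTree, Tree.last]
    · intro q l hq i hi
      obtain ⟨rfl, rfl⟩ := key hq
      rw [hm₁, hT0]
      simp only
      rw [if_neg (by omega), if_neg (by omega), hhigh _ (by omega)]
      simp [hT, vectorTree, Tree.bits]
    · intro q hq
      obtain ⟨rfl, -⟩ := key hq
      rw [hm₁, hT0]
      simp only
      rw [if_neg (by omega), if_neg (by omega), hhigh _ (by omega)]
      rfl
    · intro q j l hq
      have := (key hq).2
      simp at this
    · intro l hl
      rw [List.mem_singleton.1 hl]
      simp
    · intro l hl
      rw [List.mem_singleton.1 hl]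
      simp
  have hlow₁ : ∀ x < Q₀, (p₁.eval σ).mem x = σ.mem x := by
    intro x hx
    rw [hm₁]
    simp only
    rw [if_neg (by omega), if_neg (by omega)]
  obtain ⟨Q, σ₂, r₂, hQ, hQlen, h12₂, hQ0, hcl, hlow₂⟩ := expand_spec (M := M) (ω := ω)
    (σ := p₁.eval σ) (T := T) (R := R) (off := n) (V := V) (hc.of_runs r₁ (by decide))
    ⟨fun i hi j hj => by
      have := hRi i hi
      change n + j + R * i < Q₀
      change j < n at hj
      omega, fun i hi j hj => by
      have := hRi i hi
      change j < n at hj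
      rw [hlow₁ _ (by omega), show n + j + R * i = n + R * i + j by ring,
        hrow i hi j (by omega)]
      rfl⟩ hV.symm (by omega) (by change n + n + R * m ≤ M; omega) hroot
    (by simp [p₁, block, Prog.eval, State.setReg, State.setMem, h9, h3, hT0])
    (by simp [p₁, block, Prog.eval, State.setReg, State.setMem, h9, h34, hT1])
    (by simp [p₁, block, Prog.eval, State.setReg, State.setMem, h0, h3])
  rw [hTm] at r₂
  -- the root of the second tree
  have q₂ := r₁.seq r₂
  have hc₂ : σ₂.HasConsts m R := hc.of_runs q₂ (by decide)
  have h3₂ := hc₂.zero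
  have h4₂ := hc₂.len
  have h0₂ : σ₂.reg 0 = n := by rw [q₂.reg_eq (by decide), h0]
  have h7₂ : σ₂.reg 7 = t := by rw [q₂.reg_eq (by decide), h7]
  have h9₂ : σ₂.reg 9 = Q₀ := by rw [q₂.reg_eq (by decide), h9]
  have hlow₂' : ∀ x < Q₀, σ₂.mem x = σ.mem x := fun x hx => by rw [hlow₂ x hx, hlow₁ x hx]
  let p₃ := block [.add 10 12 3, .add 13 7 3, .add 14 4 3, .add 11 9 3, .add 15 0 0]
  have r₃ : Runs M ω p₃ σ₂ 5 (p₃.eval σ₂) := Runs.straight (by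
    simp [p₃, block, Prog.Keeps, Prog.eval, State.setReg, h0₂, h3₂, h4₂, h7₂, h9₂, h12₂]
    omega)
  have hm₃ : (p₃.eval σ₂).mem = σ₂.mem := by simp [p₃, block, Prog.eval, State.setReg]
  obtain ⟨σ₄, r₄, h12₄, hb0, hb1, hb2, hb3, hlow₄⟩ := pushNode_spec (M := M) (ω := ω)
    (σ := p₃.eval σ₂) (f := T.bits []) (g := fun i => entry ω i n) (m := m) (R := R)
    (T := T.addr V) (A := T.addr 0) (r := t) (j := m) (a := n + n) (hc₂.of_runs r₃ (by decide))
    (by simp [p₃, block, Prog.eval, State.setReg, h12₂])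
    (by simp [p₃, block, Prog.eval, State.setReg, h9₂, h3₂, hT0])
    (by simp [p₃, block, Prog.eval, State.setReg, h7₂, h3₂])
    (by simp [p₃, block, Prog.eval, State.setReg, h4₂, h3₂])
    (by simp [p₃, block, Prog.eval, State.setReg, h0₂])
    (by
      rw [hm₃]
      exact hQ.bits 0 [] hQ0)
    (fun i hi => by
      have := hRi i hi
      rw [hm₃, hlow₂' _ (by omega), show n + n + R * i = n + R * i + n by ring,
        hrow i hi n (by omega)])
    (by omega) (fun i hi => by
      have := hRi i hi
      omega) (by omega) (by omega)
  rw [hm₃] at hlow₄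
  have q₄ := r₃.seq r₄
  have hroot' : T'.Holds σ₄.mem [[]] := by
    have key : ∀ {q : ℕ} {l : List ℕ}, ([[]] : List (List ℕ))[q]? = some l → q = 0 ∧ l = [] := by
      intro q l hq
      cases q with
      | zero => simpa using hq.symm
      | succ q => simp at hq
    refine ⟨?_, ?_, ?_, ?_, ?_, ?_, ?_⟩
    · intro q l hq
      obtain ⟨rfl, rfl⟩ := key hq
      rw [hT'0, hb0]
      rfl
    · intro q l hq
      obtain ⟨rfl, rfl⟩ := key hq
      rw [hT'0, hb1]
      rfl
    · intro q l hq i hi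
      obtain ⟨rfl, rfl⟩ := key hq
      rw [hT'0, hb3 i hi]
      simp [hT, hT', vectorTree, errorTree, Tree.bits]
    · intro q hq
      obtain ⟨rfl, -⟩ := key hq
      rw [hT'0, hb2, hT0]
      rfl
    · intro q j l hq
      have := (key hq).2
      simp at this
    · intro l hl
      rw [List.mem_singleton.1 hl]
      simp
    · intro l hl
      rw [List.mem_singleton.1 hl]
      simp
  have hc₄ : σ₄.HasConsts m R := hc₂.of_runs q₄ (by decide)
  have h3₄ := hc₄.zero
  have h0₄ : σ₄.reg 0 = n := by rw [q₄.reg_eq (by decide), h0₂]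
  have h31₄ : σ₄.reg 31 = n + 1 := by rw [q₄.reg_eq (by decide), q₂.reg_eq (by decide), h31]
  have h10₄ : σ₄.reg 10 = T.addr V := by
    rw [r₄.reg_eq (by decide)]
    simp [p₃, block, Prog.eval, State.setReg, h12₂, h3₂]
  let p₅ := block [.add 11 10 3, .add 28 0 31]
  have r₅ : Runs M ω p₅ σ₄ 2 (p₅.eval σ₄) := Runs.straight (by
    simp [p₅, block, Prog.Keeps, Prog.eval, State.setReg, h0₄, h3₄, h10₄, h31₄]
    omega)
  have hm₅ : (p₅.eval σ₄).mem = σ₄.mem := by simp [p₅, block, Prog.eval, State.setReg]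
  have hlow₄' : ∀ x < Q₀, σ₄.mem x = σ.mem x := fun x hx => by
    rw [hlow₄ x (by omega), hlow₂' x hx]
  obtain ⟨Q', τ, r₆, hQ', hQlen', h12, hQ0', hcl', hlow₆⟩ := expand_spec (M := M) (ω := ω)
    (σ := p₅.eval σ₄) (T := T') (R := R) (off := n + (n + 1)) (V := V')
    (hc₄.of_runs r₅ (by decide))
    ⟨fun i hi j hj => by
      have := hRi i hi
      change n + (n + 1) + j + R * i < T.addr V
      change j < m at hj
      omega, fun i hi j hj => by
      have := hRi i hi
      change j < m at hj
      rw [hm₅, hlow₄' _ (by omega),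
        show n + (n + 1) + j + R * i = n + R * i + (n + 1 + j) by ring, hrow i hi _ (by omega)]
      rfl⟩ hV'.symm (by omega) (by change n + (n + 1) + m + R * m ≤ M; omega)
    (by rw [hm₅]; exact hroot')
    (by simp [p₅, block, Prog.eval, State.setReg, h10₄, h3₄, hT'0])
    (by simp [p₅, block, Prog.eval, State.setReg, h12₄, hT'1])
    (by simp [p₅, block, Prog.eval, State.setReg, h0₄, h31₄])
  rw [hTm'] at r₆
  have hlow : ∀ x < T.addr V, τ.mem x = σ₂.mem x := fun x hx => by
    rw [hlow₆ x hx, hm₅, hlow₄ x hx]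
  have q₆ := r₅.seq r₆
  refine ⟨Q, Q', τ, (r₁.seq (r₂.seq (r₃.seq (r₄.seq (r₅.seq r₆))))).mono (by omega),
    hQ.congr_lt (by rw [hQlen]; exact hlow), hQ', hQlen, hQlen', hQ0,
    Tree.isComplete (T := T) (List.mem_of_getElem? hQ0) hcl,
    Tree.isComplete (T := T') (List.mem_of_getElem? hQ0') hcl', ?_, h12, fun x hx => ?_⟩
  · rw [q₆.reg_eq (by decide), h10₄]
  · rw [hlow x (by omega), hlow₂' x hx]

/-- The learner, for a noise rate less than `1 / b`. -/
def learner (b : ℕ) : Prog :=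
  .seq (prepare b) (.seq growTrees (.seq fillTable (.seq search
    (.seq (.add 23 26 3) (.seq flipSet (.seq (.add 23 27 3) flipSet))))))

/-- The number of steps of the learner. -/
def learnerSteps (n k m h t V V' : ℕ) : ℕ :=
  4 * logRatio n k + 21 * h + 3 * t + (n + 20) * m + (22 * m + 32) * V + (11 * m + 22) * V' +
    ((11 * m + 13) * V' + 6) * V + 79

/-- A solution of the match equation is among the tried triples, because both trees are complete,
and it hits the table, because every node was entered. The recorded pair then solves the equation
too, possibly with other sets; that this suffices is a matter of uniqueness, settled in
`learner_outputs`. -/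
lemma learner_spec {M n k b m h t R V V' : ℕ} (ω : ℕ → Example n) (hk : 1 ≤ k) (hkn : k ≤ n)
    (hb : 1 ≤ b) (hm : m = sampleCount n k) (hh : h = (k + 1) / 2) (ht : t = (m + b - 1) / b)
    (hR : R = n + 1 + m) (hV : V = subsetCount n h) (hV' : V' = subsetCount m t)
    (hM : 2 * n + 3 + m + b + R * (m + 1) ≤ M)
    (hM' : n + R * m + 2 ^ m + (m + 3) * (V + V') ≤ M) :
    ∃ (τ : State) (l₁ l₂ : List ℕ),
      Runs M ω (learner b) (State.init n k) (learnerSteps n k m h t V V') τ ∧ τ.drawn = m ∧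
      (∀ j ∈ l₁, j < n) ∧ (∀ j ∈ l₂, j < n) ∧ l₁.length ≤ h ∧ l₂.length ≤ h ∧
      (∀ x < n, τ.mem x = (l₁.count x + l₂.count x : ZMod 2).val) ∧
      ((∃ l l' e : List ℕ, l.Pairwise (· < ·) ∧ (∀ j ∈ l, j < n) ∧ l.length ≤ h ∧
          l'.Pairwise (· < ·) ∧ (∀ j ∈ l', j < n) ∧ l'.length ≤ h ∧
          e.Pairwise (· < ·) ∧ (∀ j ∈ e, j < m) ∧ e.length ≤ t ∧
          ∀ i < m, (l'.map (entry ω i)).sum = (l.map (entry ω i)).sum +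
            (entry ω i n + (e.map fun j => entry ω i (n + 1 + j)).sum)) →
        ∃ e : List ℕ, e.length ≤ t ∧
          ∀ i < m, (l₂.map (entry ω i)).sum = (l₁.map (entry ω i)).sum +
            (entry ω i n + (e.map fun j => entry ω i (n + 1 + j)).sum)) := by
  have hV1 : 1 ≤ V := hV ▸ subsetCount_pos _ _
  have hmV : m + 3 ≤ (m + 3) * (V + V') := Nat.le_mul_of_pos_right _ (by omega)
  have hmulV : (m + 3) * (V + V') = (m + 3) * V + (m + 3) * V' := by ring
  have hRm : R * (m + 1) = R * m + R := by ring
  have hpow : 1 ≤ 2 ^ m := Nat.one_le_two_pow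
  have htm : t ≤ m + b - 1 := ht ▸ Nat.div_le_self _ _
  obtain ⟨σ₁, r₁, hc₁, h0, h6, h7, h31, h8, h9, hdr, hrow, hlow, hhigh⟩ := prepare_spec (M := M)
    (ω := ω) hk hkn hb hm hh ht hR rfl hM (by omega)
  set X := n + R * m with hX
  set Q₀ := X + 2 ^ m with hQ₀
  obtain ⟨Q, Q', σ₂, r₂, hQ, hQ', hQlen, hQlen', hQ0, hcomp, hcomp', h10, h12, hlow₂⟩ :=
    growTrees_spec (M := M) (ω := ω) hc₁ hR h0 h6 h7 h31 h9 hX hQ₀ hrow hhigh hV hV' (by omega)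
      (by omega) (by omega)
  set T := vectorTree ω m h Q₀ with hT
  set T' := errorTree ω m t (T.addr V) Q₀ with hT'
  have hT0 : T.addr 0 = Q₀ := by simp [Tree.addr, hT, vectorTree]
  have haV : T.addr V = Q₀ + (m + 3) * V := rfl
  have haV' : T'.addr V' = Q₀ + (m + 3) * V + (m + 3) * V' := rfl
  have hT'0 : T'.addr 0 = T.addr V := by simp [Tree.addr, hT', errorTree]
  have hc₂ : σ₂.HasConsts m R := hc₁.of_runs r₂ (by decide)
  have h8₂ : σ₂.reg 8 = X := by rw [r₂.reg_eq (by decide), h8]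
  have h9₂ : σ₂.reg 9 = T.addr 0 := by rw [r₂.reg_eq (by decide), h9, hT0]
  obtain ⟨σ₃, r₃, hQ₃, hsound, hfull, hoth⟩ := fillTable_spec (M := M) (ω := ω) (T := T)
    (R := R) (X := X) hc₂ hQ hQ0 (fun _ => rfl) h8₂ h9₂ (by rw [h10, hQlen])
    (le_of_eq hQ₀.symm)
    (fun κ hκ => by
      change κ < 2 ^ m at hκ
      rw [hlow₂ _ (by omega), hhigh _ (by omega)]) (by rw [hQlen]; omega)
  have hTm : T.m = m := rfl
  rw [hTm] at r₃
  have hc₃ : σ₃.HasConsts m R := hc₂.of_runs r₃ (by decide)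
  have hQ'₃ : T'.Holds σ₃.mem Q' := hQ'.congr fun q _ x hx _ => by
    refine hoth x (Or.inr ?_)
    have : T'.base ≤ T'.addr q := Nat.le_add_right _ _
    change T.addr V ≤ T'.addr q at this
    rw [hTm]
    omega
  obtain ⟨σ₄, r₄, hmem₄, l₁, l₂, ⟨q₁, q₂, hq₁, hq₂, h26, h27⟩, hmatch⟩ := search_spec (M := M)
    (ω := ω) (T := T) (T' := T') (R := R) (X := X) rfl hc₃ hQ₃ hQ'₃ hQ0 hsound
    (by rw [hTm]; omega) (by rw [hQlen]; omega) (by rw [hQlen']; omega)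
    (by rw [r₃.reg_eq (by decide), h8₂]) (by rw [r₃.reg_eq (by decide), h9₂])
    (by rw [r₃.reg_eq (by decide), h10, hT'0]) (by rw [hQlen, hT'0])
    (by rw [r₃.reg_eq (by decide), h12, hQlen'])
  rw [hTm] at r₄
  have hc₄ : σ₄.HasConsts m R := hc₃.of_runs r₄ (by decide)
  have hQ₄ : T.Holds σ₄.mem Q := by rwa [hmem₄]
  have hzero : ∀ x < n, σ₄.mem x = 0 := fun x hx => by
    rw [hmem₄, hoth x (Or.inl (by omega)), hlow₂ x (by omega), hlow x hx]
  have hMQ : T.addr Q.length ≤ M := by rw [hQlen]; omega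
  have hq₁a := T.addr_lt (List.getElem?_eq_some_iff.1 hq₁).1
  have hq₂a := T.addr_lt (List.getElem?_eq_some_iff.1 hq₂).1
  have h3₄ := hc₄.zero
  have hnb : T.cols < T.base := by
    change n < Q₀
    omega
  have r₅ : Runs M ω (.add 23 26 3) σ₄ 1 _ := Runs.straight (p := .add 23 26 3) (by
    simp only [Prog.Keeps]
    omega)
  obtain ⟨σ₆, r₆, hcol₆, hoth₆⟩ := flipSet_spec (M := M) (ω := ω) (T := T) (q := q₁) (l := l₁)
    (f := fun _ => 0) (R := R) rfl hnb hMQ (hc₄.of_runs r₅ (by decide)) hQ₄ hq₁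
    (by simp [Prog.eval, State.setReg, h26, h3₄]) (fun x hx => hzero x hx)
  have r₅₆ := r₅.seq r₆
  have hc₆ : σ₆.HasConsts m R := hc₄.of_runs r₅₆ (by decide)
  have h3₆ := hc₆.zero
  have h27₆ : σ₆.reg 27 = T.addr q₂ := by rw [r₅₆.reg_eq (by decide), h27]
  have hQ₆ : T.Holds σ₆.mem Q := hQ₄.congr fun q _ x hx _ => by
    have : T.base ≤ T.addr q := Nat.le_add_right _ _
    exact hoth₆ x (by omega)
  have r₇ : Runs M ω (.add 23 27 3) σ₆ 1 _ := Runs.straight (p := .add 23 27 3) (by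
    simp only [Prog.Keeps]
    omega)
  obtain ⟨τ, r₈, hcol, -⟩ := flipSet_spec (M := M) (ω := ω) (T := T) (q := q₂) (l := l₂)
    (f := fun x => 0 + l₁.count x) (R := R) rfl hnb hMQ (hc₆.of_runs r₇ (by decide)) hQ₆ hq₂
    (by simp [Prog.eval, State.setReg, h27₆, h3₆]) hcol₆
  have hl₁ : l₁.length ≤ h := hQ₃.length_le l₁ (List.mem_of_getElem? hq₁)
  have hl₂ : l₂.length ≤ h := hQ₃.length_le l₂ (List.mem_of_getElem? hq₂)
  refine ⟨τ, l₁, l₂, (r₁.seq (r₂.seq (r₃.seq (r₄.seq (r₅.seq (r₆.seq (r₇.seq r₈))))))).mono ?_,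
    ?_, hQ₃.lt l₁ (List.mem_of_getElem? hq₁), hQ₃.lt l₂ (List.mem_of_getElem? hq₂), hl₁, hl₂,
    fun x hx => ?_, ?_⟩
  · rw [hQlen, hQlen']
    simp only [learnerSteps]
    have e1 : (n + 20) * m = (n + 9) * m + 11 * m := by ring
    have e2 : (22 * m + 32) * V = (11 * m + 22) * V + (11 * m + 10) * V := by ring
    omega
  · rw [r₈.drawn_eq (by decide), r₇.drawn_eq (by decide), r₆.drawn_eq (by decide),
      r₅.drawn_eq (by decide), r₄.drawn_eq (by decide), r₃.drawn_eq (by decide),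
      r₂.drawn_eq (by decide), hdr]
  · rw [hcol x hx, zero_add]
  · rintro ⟨l, l', e, hl1, hl2, hl3, hl1', hl2', hl3', he1, he2, he3, heq⟩
    have hl'Q : l' ∈ Q := hcomp l' hl1' hl2' hl3'
    obtain ⟨e', he', hee⟩ := hmatch ⟨l, hcomp l hl1 hl2 hl3, e, hcomp' e he1 he2 he3, by
      -- The sum has the same key as `l'`, and the cell of `l'` is nonzero.
      have hd : digitsVal (fun i => T.bits l i + T'.bits e i) T.m = digitsVal (T.bits l') T.m :=
        digitsVal_inj.2 fun i hi => by
          simp only [Tree.bits, hT, hT', vectorTree, errorTree, zero_add]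
          exact (heq i hi).symm
      rw [pairCell, hd]
      exact hfull l' hl'Q⟩
    refine ⟨e', hQ'₃.length_le e' he', fun i hi => ?_⟩
    have := hee i hi
    simpa only [Tree.bits, hT, hT', vectorTree, errorTree, zero_add] using this

/-! ### From lists of columns to vectors -/

/-- The vector that a list of coordinates describes. -/
def vec (n : ℕ) (l : List ℕ) : Fin n → ZMod 2 := fun c => (l.count (c : ℕ) : ZMod 2)

/-- The number of examples, among the first `m`, that disagree with the vector `z`. -/
def errCount {n : ℕ} (ω : ℕ → Example n) (m : ℕ) (z : Fin n → ZMod 2) : ℕ :=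
  ((Finset.range m).filter fun i => (ω i).2 ≠ (ω i).1 ⬝ᵥ z).card

lemma vec_nil (n : ℕ) : vec n [] = 0 := by
  funext c
  simp [vec]

lemma vec_cons {n j : ℕ} (hj : j < n) (l : List ℕ) :
    vec n (j :: l) = vec n l + Pi.single ⟨j, hj⟩ 1 := by
  funext c
  simp only [vec, List.count_cons, Pi.add_apply, Pi.single_apply, Nat.cast_add]
  congr 1
  by_cases h : c = ⟨j, hj⟩
  · simp [h]
  · have : ¬ j = c := fun e => h (Fin.ext e.symm)
    simp [h, this]

lemma sum_entry {n : ℕ} (ω : ℕ → Example n) (i : ℕ) {l : List ℕ} (hl : ∀ j ∈ l, j < n) :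
    (l.map (entry ω i)).sum = (ω i).1 ⬝ᵥ vec n l := by
  induction l with
  | nil => simp [vec_nil]
  | cons j l ih =>
    have hj : j < n := hl j (by simp)
    rw [List.map_cons, List.sum_cons, ih fun x hx => hl x (List.mem_cons_of_mem _ hx),
      vec_cons hj, dotProduct_add, dotProduct_single_one, entry, dif_pos hj, add_comm]

/-- Columns of the identity matrix touch row `i` only through the column `i`, so a list of them adds
the error pattern it encodes. -/
lemma sum_identity {n : ℕ} (ω : ℕ → Example n) (i : ℕ) (e : List ℕ) :
    (e.map fun j => entry ω i (n + 1 + j)).sum = (e.count i : ZMod 2) := by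
  induction e with
  | nil => simp
  | cons j e ih =>
    rw [List.map_cons, List.sum_cons, ih, List.count_cons, entry, dif_neg (by omega),
      if_neg (by omega), Nat.cast_add, add_comm]
    congr 1
    by_cases h : j = i
    · simp [h]
    · simp [h]

lemma hammingNorm_vec_add_le (n : ℕ) (l l' : List ℕ) :
    hammingNorm (vec n l + vec n l') ≤ l.length + l'.length := by
  rw [← List.length_append]
  refine le_trans ?_ (List.toFinset_card_le _)
  rw [hammingNorm]
  refine Finset.card_le_card_of_injOn (fun c => (c : ℕ)) (fun c hc => ?_)
    (fun a _ b _ h => Fin.ext h)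
  have hc := (Finset.mem_filter.1 (Finset.mem_coe.1 hc)).2
  simp only [Pi.add_apply, vec] at hc
  rw [Finset.mem_coe, List.mem_toFinset, List.mem_append]
  by_contra h
  rw [not_or] at h
  rw [List.count_eq_zero_of_not_mem h.1, List.count_eq_zero_of_not_mem h.2] at hc
  simp at hc

lemma exists_sorted_list {n : ℕ} (x : Fin n → ZMod 2) :
    ∃ l : List ℕ, l.Pairwise (· < ·) ∧ (∀ j ∈ l, j < n) ∧ l.length = hammingNorm x ∧
      vec n l = x := by
  let S : Finset ℕ := (Finset.univ.filter fun i => x i ≠ 0).map Fin.valEmbedding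
  refine ⟨S.sort (· ≤ ·), Finset.sortedLT_sort S |>.pairwise, fun j hj => ?_, ?_, ?_⟩
  · rw [Finset.mem_sort, Finset.mem_map] at hj
    obtain ⟨c, -, rfl⟩ := hj
    exact c.2
  · rw [Finset.length_sort, Finset.card_map]
    rfl
  · funext c
    have hnd := S.sort_nodup (· ≤ ·)
    have hmem : (c : ℕ) ∈ S.sort (· ≤ ·) ↔ x c ≠ 0 := by
      rw [Finset.mem_sort, Finset.mem_map]
      constructor
      · rintro ⟨d, hd, hdc⟩
        have : d = c := Fin.ext hdc
        simpa [this] using hd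
      · intro h
        exact ⟨c, by simpa using h, rfl⟩
    have h01 : ∀ y : ZMod 2, y ≠ 0 → y = 1 := by decide
    rw [vec, hnd.count]
    by_cases h : x c = 0
    · rw [if_neg (fun h' => hmem.1 h' h), h]
      rfl
    · rw [if_pos (hmem.2 h), h01 _ h]
      rfl

lemma vec_append (n : ℕ) (l l' : List ℕ) : vec n (l ++ l') = vec n l + vec n l' := by
  funext c
  simp [vec]

/-- If the hidden vector is the only vector of weight at most `2 h` that disagrees with few
examples, then the learner outputs it. -/
lemma learner_outputs {n k m h t : ℕ} {ω : ℕ → Example n} {x : Fin n → ZMod 2} {l₁ l₂ : List ℕ}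
    {τ : State} (hh : h = (k + 1) / 2) (hx : hammingNorm x = k) (hxt : errCount ω m x ≤ t)
    (huniq : ∀ z, hammingNorm z ≤ 2 * h → errCount ω m z ≤ t → z = x)
    (hl₁ : ∀ j ∈ l₁, j < n) (hl₂ : ∀ j ∈ l₂, j < n) (hlen₁ : l₁.length ≤ h) (hlen₂ : l₂.length ≤ h)
    (hout : ∀ x < n, τ.mem x = (l₁.count x + l₂.count x : ZMod 2).val)
    (hmatch : (∃ l l' e : List ℕ, l.Pairwise (· < ·) ∧ (∀ j ∈ l, j < n) ∧ l.length ≤ h ∧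
          l'.Pairwise (· < ·) ∧ (∀ j ∈ l', j < n) ∧ l'.length ≤ h ∧
          e.Pairwise (· < ·) ∧ (∀ j ∈ e, j < m) ∧ e.length ≤ t ∧
          ∀ i < m, (l'.map (entry ω i)).sum = (l.map (entry ω i)).sum +
            (entry ω i n + (e.map fun j => entry ω i (n + 1 + j)).sum)) →
        ∃ e : List ℕ, e.length ≤ t ∧
          ∀ i < m, (l₂.map (entry ω i)).sum = (l₁.map (entry ω i)).sum +
            (entry ω i n + (e.map fun j => entry ω i (n + 1 + j)).sum)) :
    τ.Outputs x := by
  -- Terms change sides freely modulo two, which turns the match equation into a statement about the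
  -- sum of the two halves.
  have h2 : ∀ a b c d : ZMod 2, b = a + (c + d) ↔ a + b = c + d := by decide
  have hentry : ∀ i, entry ω i n = (ω i).2 := fun i => by simp [entry]
  have hbits : ∀ (l l' e : List ℕ) (i : ℕ), (∀ j ∈ l, j < n) → (∀ j ∈ l', j < n) →
      ((l'.map (entry ω i)).sum = (l.map (entry ω i)).sum +
            (entry ω i n + (e.map fun j => entry ω i (n + 1 + j)).sum) ↔
        (ω i).1 ⬝ᵥ (vec n l + vec n l') = (ω i).2 + e.count i) := by
    intro l l' e i hl hl'
    rw [sum_entry ω i hl, sum_entry ω i hl', sum_identity, hentry, h2, dotProduct_add]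
  obtain ⟨e, he, hee⟩ := hmatch (by
    obtain ⟨l, hp, hlt, hlen, hvec⟩ := exists_sorted_list x
    let E := (Finset.range m).filter fun i => (ω i).2 ≠ (ω i).1 ⬝ᵥ x
    -- The sorted support of `x` is cut after `h` elements, leaving at most `k - h ≤ h`; the error
    -- pattern is the set of examples that disagree with `x`.
    refine ⟨l.take h, l.drop h, E.sort (· ≤ ·), hp.sublist (List.take_sublist _ _),
      fun j hj => hlt j (List.mem_of_mem_take hj), by simp, hp.sublist (List.drop_sublist _ _),
      fun j hj => hlt j (List.mem_of_mem_drop hj), ?_, Finset.sortedLT_sort E |>.pairwise, ?_, ?_, ?_⟩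
    · rw [List.length_drop]
      omega
    · intro j hj
      rw [Finset.mem_sort, Finset.mem_filter, Finset.mem_range] at hj
      exact hj.1
    · rw [Finset.length_sort]
      exact hxt
    · intro i hi
      rw [hbits _ _ _ i (fun j hj => hlt j (List.mem_of_mem_take hj))
        (fun j hj => hlt j (List.mem_of_mem_drop hj)), ← vec_append, List.take_append_drop, hvec,
        (E.sort_nodup (· ≤ ·)).count]
      have h01 : ∀ a b : ZMod 2, a ≠ b → b = a + 1 := by decide
      by_cases h : (ω i).2 = (ω i).1 ⬝ᵥ x
      · rw [if_neg (by rw [Finset.mem_sort, Finset.mem_filter]; exact fun h' => h'.2 h), ← h]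
        simp
      · rw [if_pos (by
          rw [Finset.mem_sort, Finset.mem_filter, Finset.mem_range]
          exact ⟨hi, h⟩)]
        simpa using h01 _ _ h)
  -- Disagreements occur only at positions in `e`, so the sum meets both requirements of the
  -- uniqueness hypothesis.
  have hz : vec n l₁ + vec n l₂ = x := by
    refine huniq _ ((hammingNorm_vec_add_le n l₁ l₂).trans (by omega)) ?_
    refine le_trans (Finset.card_le_card ?_) ((List.toFinset_card_le e).trans he)
    intro i hi
    rw [Finset.mem_filter, Finset.mem_range] at hi
    rw [List.mem_toFinset]
    by_contra hie
    have := (hbits l₁ l₂ e i hl₁ hl₂).1 (hee i hi.1)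
    rw [List.count_eq_zero_of_not_mem hie] at this
    exact hi.2 (by rw [this]; simp)
  intro i
  rw [hout i i.2, ← hz]
  rfl

/-! ### The law of the examples -/

instance {n : ℕ} (x : Fin n → ZMod 2) (ν : unitInterval) :
    IsProbabilityMeasure (exampleMeasure x ν) := by
  unfold exampleMeasure
  apply Measure.isProbabilityMeasure_map
  fun_prop

instance {n : ℕ} (x : Fin n → ZMod 2) (ν : unitInterval) :
    IsProbabilityMeasure (sourceMeasure x ν) := by
  unfold sourceMeasure
  infer_instance

/-- The examples that disagree with the vector `z`. -/
def disagree {n : ℕ} (z : Fin n → ZMod 2) : Set (Example n) := {p | p.2 ≠ p.1 ⬝ᵥ z}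

/-- Disagreement with the hidden vector means precisely that the noise bit is one. -/
lemma measure_disagree_self {n : ℕ} (x : Fin n → ZMod 2) (ν : unitInterval) :
    (exampleMeasure x ν).real (disagree x) = ν := by
  have hpre : (fun p : (Fin n → ZMod 2) × ZMod 2 => (p.1, p.1 ⬝ᵥ x + p.2)) ⁻¹' disagree x =
      Set.univ ×ˢ {e : ZMod 2 | e ≠ 0} := by
    ext p
    simp [disagree]
  rw [measureReal_def, exampleMeasure, Measure.map_apply (by fun_prop) (.of_discrete), hpre,
    Measure.prod_prod, measure_univ, one_mul, ← measureReal_def,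
    bernoulliMeasure_real_apply _ (.of_discrete)]
  simp

lemma measurePreserving_add_uniform {n : ℕ} (v : Fin n → ZMod 2) :
    MeasurePreserving (fun a => a + v) (uniformOn (Set.univ : Set (Fin n → ZMod 2)))
      (uniformOn Set.univ) := by
  refine ⟨by fun_prop, ?_⟩
  ext s hs
  rw [Measure.map_apply (by fun_prop) hs, uniformOn_univ, uniformOn_univ]
  congr 1
  have := Measure.count_injective_image (f := fun a : Fin n → ZMod 2 => a + v)
    (add_left_injective v) ((fun a => a + v) ⁻¹' s)
  rw [← this, Set.image_preimage_eq]
  exact (Equiv.addRight v).surjective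

/-- Flipping `a` at a coordinate where `z` and `x` differ preserves the law and exchanges agreement
with disagreement, so both have probability one half. -/
lemma measure_disagree_ne {n : ℕ} {x z : Fin n → ZMod 2} (hz : z ≠ x) (ν : unitInterval) :
    (exampleMeasure x ν).real (disagree z) = 1 / 2 := by
  obtain ⟨j, hj⟩ := Function.ne_iff.1 hz
  let B : Set ((Fin n → ZMod 2) × ZMod 2) :=
    (fun p => (p.1, p.1 ⬝ᵥ x + p.2)) ⁻¹' disagree z
  let P := (uniformOn (Set.univ : Set (Fin n → ZMod 2))).prod (bernoulliMeasure (1 : ZMod 2) 0 ν)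
  have hP : (exampleMeasure x ν).real (disagree z) = P.real B := by
    rw [measureReal_def, exampleMeasure, Measure.map_apply (by fun_prop) (.of_discrete)]
    rfl
  have hmp : MeasurePreserving (Prod.map (fun a => a + Pi.single j 1) id) P P :=
    (measurePreserving_add_uniform _).prod (.id _)
  have hflip : Prod.map (fun a => a + Pi.single j 1) id ⁻¹' B = Bᶜ := by
    have h2 : ∀ a b c d e : ZMod 2, d ≠ c → (a + c + e ≠ b + d ↔ ¬ a + e ≠ b) := by decide
    ext p
    simp only [B, disagree, Set.mem_preimage, Set.mem_compl_iff, Prod.map_fst,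
      Prod.map_snd, id, Set.mem_ofPred_eq, add_dotProduct, single_one_dotProduct]
    exact h2 _ _ _ _ _ hj
  have h1 : P.real Bᶜ = P.real B := by
    rw [← hflip, measureReal_def, hmp.measure_preimage (MeasurableSet.of_discrete).nullMeasurableSet]
    rfl
  have h3 := probReal_compl_eq_one_sub (μ := P) (s := B) .of_discrete
  rw [hP]
  linarith

/-! ### Tail bounds -/

/-- Hoeffding's inequality: the centred indicators are independent and sub-Gaussian with parameter
`1/4`. -/
lemma measure_count_ge {E : Type*} [MeasurableSpace E] (μ : Measure E) [IsProbabilityMeasure μ]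
    {B : Set E} (hB : MeasurableSet B) [DecidablePred (· ∈ B)] (m : ℕ) {ε : ℝ} (hε : 0 ≤ ε) :
    (Measure.infinitePi fun _ : ℕ => μ).real
      {ω | (μ.real B + ε) * m ≤ ((Finset.range m).filter fun i => ω i ∈ B).card} ≤
      Real.exp (-(2 * ε ^ 2 * m)) := by
  let Y : E → ℝ := B.indicator 1
  have hY : Measurable Y := measurable_one.indicator hB
  let P := Measure.infinitePi fun _ : ℕ => μ
  have hint : ∀ i : ℕ, P[fun ω => Y (ω i)] = μ.real B := by
    intro i
    have h := integral_map (μ := P) (φ := fun ω => ω i) (f := Y)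
      (measurable_pi_apply i).aemeasurable hY.aestronglyMeasurable
    rw [← h, Measure.infinitePi_map_eval, integral_indicator_one hB]
  have hsub : ∀ i < m, HasSubgaussianMGF (fun ω : ℕ → E => Y (ω i) - μ.real B) (1 / 4) P := by
    intro i _
    have h := hasSubgaussianMGF_of_mem_Icc (μ := P) (X := fun ω => Y (ω i)) (a := 0) (b := 1)
      (hY.comp (measurable_pi_apply i)).aemeasurable (Filter.Eventually.of_forall fun ω => by
        by_cases h : ω i ∈ B <;> simp [Y, h])
    rw [hint] at h
    convert h using 1
    norm_num
  have hind : iIndepFun (fun i (ω : ℕ → E) => Y (ω i) - μ.real B) P :=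
    iIndepFun_infinitePi (X := fun _ e => Y e - μ.real B) (fun _ => hY.sub_const _)
  have h := HasSubgaussianMGF.measure_sum_range_ge_le_of_iIndepFun hind hsub (ε := ε * m) (by positivity)
  have hset : {ω : ℕ → E | (μ.real B + ε) * m ≤ ((Finset.range m).filter fun i => ω i ∈ B).card} =
      {ω | ε * m ≤ ∑ i ∈ Finset.range m, (Y (ω i) - μ.real B)} := by
    ext ω
    have : ∑ i ∈ Finset.range m, (Y (ω i) - μ.real B) =
        ((Finset.range m).filter fun i => ω i ∈ B).card - μ.real B * m := by
      rw [Finset.sum_sub_distrib, Finset.sum_const, Finset.card_range, nsmul_eq_mul, mul_comm]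
      congr 1
      rw [Finset.card_filter]
      push_cast
      refine Finset.sum_congr rfl fun i _ => ?_
      by_cases h : ω i ∈ B <;> simp [Y, h]
    simp only [Set.mem_ofPred_eq, this]
    constructor <;> intro h <;> nlinarith
  rw [hset]
  refine h.trans (Real.exp_le_exp.2 (le_of_eq ?_))
  rcases Nat.eq_zero_or_pos m with rfl | hm
  · simp
  · have : (m : ℝ) ≠ 0 := by positivity
    push_cast
    field_simp
    norm_num

/-! ### The hidden vector is determined -/

/-- Chernoff's bound in combinatorial form: as `lam ≤ 1`, every set of at most `r` elements
contributes at least `lam ^ r` to the expansion of `(1 + lam) ^ j`. The induction follows Pascal's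
recursion. -/
lemma subsetCount_mul_pow_le {lam : ℝ} (h0 : 0 ≤ lam) (h1 : lam ≤ 1) (j r : ℕ) :
    (subsetCount j r : ℝ) * lam ^ r ≤ (1 + lam) ^ j := by
  induction j generalizing r with
  | zero => simpa [subsetCount] using pow_le_one₀ h0 h1
  | succ j ih =>
    cases r with
    | zero =>
      simp only [subsetCount, pow_zero, Nat.cast_one, mul_one]
      exact one_le_pow₀ (by linarith)
    | succ r =>
      have h2 := ih (r + 1)
      have h3 := mul_le_mul_of_nonneg_left (ih r) h0
      simp only [subsetCount]
      push_cast
      rw [pow_succ (1 + lam)]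
      calc ((subsetCount j (r + 1) : ℝ) + subsetCount j r) * lam ^ (r + 1)
          = subsetCount j (r + 1) * lam ^ (r + 1) + lam * (subsetCount j r * lam ^ r) := by ring
        _ ≤ (1 + lam) ^ j + lam * (1 + lam) ^ j := add_le_add h2 h3
        _ = (1 + lam) ^ j * (1 + lam) := by ring

lemma card_hammingNorm_le (n s : ℕ) :
    (Finset.univ.filter fun z : Fin n → ZMod 2 => hammingNorm z ≤ s).card ≤ subsetCount n s := by
  classical
  rw [subsetCount_eq_sum]
  have h01 : ∀ a b : ZMod 2, (a ≠ 0 ↔ b ≠ 0) → a = b := by decide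
  calc _ ≤ ((Finset.range (s + 1)).biUnion fun i =>
        (Finset.univ : Finset (Fin n)).powersetCard i).card := by
        refine Finset.card_le_card_of_injOn (fun z => Finset.univ.filter fun i => z i ≠ 0)
          (fun z hz => ?_) (fun z _ z' _ h => ?_)
        · have hz := (Finset.mem_filter.1 (Finset.mem_coe.1 hz)).2
          rw [Finset.mem_coe, Finset.mem_biUnion]
          refine ⟨hammingNorm z, Finset.mem_range.2 (Nat.lt_succ_of_le hz), ?_⟩
          rw [Finset.mem_powersetCard]
          exact ⟨Finset.subset_univ _, rfl⟩
        · funext i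
          have := Finset.ext_iff.1 h i
          simp only [Finset.mem_filter, Finset.mem_univ, true_and] at this
          exact h01 _ _ this
    _ ≤ ∑ i ∈ Finset.range (s + 1), ((Finset.univ : Finset (Fin n)).powersetCard i).card :=
        Finset.card_biUnion_le
    _ = _ := by simp [Finset.card_powersetCard]

/-- Apply `subsetCount_mul_pow_le` with `lam = k / n`. The factor `(1 + k / n) ^ n` is at most `e ^
k`, and `(n / k) ^ (2 k)` is at most `e ^ (2 k L)` with `L = logRatio n k ≥ 1`, as `n / k ≤ 2 ^ L`.
-/
lemma subsetCount_two_mul_le {n k : ℕ} (hk : 1 ≤ k) (hkn : k ≤ n) :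
    (subsetCount n (2 * k) : ℝ) ≤ Real.exp (3 * (k * logRatio n k)) := by
  have hk' : (0 : ℝ) < k := by exact_mod_cast hk
  have hn' : (0 : ℝ) < n := by exact_mod_cast (by omega : 0 < n)
  have hkn' : (k : ℝ) ≤ n := by exact_mod_cast hkn
  have hL : (1 : ℝ) ≤ logRatio n k := by exact_mod_cast Nat.le_add_left _ _
  have h := subsetCount_mul_pow_le (lam := k / n) (by positivity) ((div_le_one hn').2 hkn') n (2 * k)
  have h1 : (1 + (k : ℝ) / n) ^ n ≤ Real.exp k := by
    calc (1 + (k : ℝ) / n) ^ n ≤ Real.exp (k / n) ^ n := by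
          refine pow_le_pow_left₀ (by positivity) ?_ _
          rw [add_comm]
          exact Real.add_one_le_exp _
      _ = Real.exp k := by
          rw [← Real.exp_nat_mul]
          congr 1
          field_simp
  have h2 : (n : ℝ) / k ≤ Real.exp (logRatio n k) := by
    rw [div_le_iff₀ hk']
    have : (n : ℝ) ≤ k * 2 ^ logRatio n k := by exact_mod_cast (lt_mul_two_pow hk).le
    refine this.trans ?_
    rw [mul_comm]
    refine mul_le_mul_of_nonneg_right ?_ hk'.le
    calc (2 : ℝ) ^ logRatio n k ≤ Real.exp 1 ^ logRatio n k :=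
          pow_le_pow_left₀ (by norm_num) (by linarith [Real.add_one_le_exp (1 : ℝ)]) _
      _ = _ := by rw [← Real.exp_nat_mul, mul_one]
  have h3 : ((n : ℝ) / k) ^ (2 * k) ≤ Real.exp (2 * (k * logRatio n k)) := by
    calc _ ≤ Real.exp (logRatio n k) ^ (2 * k) := pow_le_pow_left₀ (by positivity) h2 _
      _ = _ := by
        rw [← Real.exp_nat_mul]
        congr 1
        push_cast
        ring
  have h4 : ((k : ℝ) / n) ^ (2 * k) * ((n : ℝ) / k) ^ (2 * k) = 1 := by
    rw [← mul_pow]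
    field_simp
    simp
  calc (subsetCount n (2 * k) : ℝ)
      = subsetCount n (2 * k) * ((k : ℝ) / n) ^ (2 * k) * ((n : ℝ) / k) ^ (2 * k) := by
        rw [mul_assoc, h4, mul_one]
    _ ≤ Real.exp k * Real.exp (2 * (k * logRatio n k)) :=
        mul_le_mul (h.trans h1) h3 (by positivity) (Real.exp_pos _).le
    _ ≤ _ := by
        rw [← Real.exp_add, Real.exp_le_exp]
        nlinarith

lemma errCount_eq {n : ℕ} (ω : ℕ → Example n) (m : ℕ) (z : Fin n → ZMod 2)
    [DecidablePred (· ∈ disagree z)] :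
    errCount ω m z = ((Finset.range m).filter fun i => ω i ∈ disagree z).card := by
  unfold errCount
  congr

lemma errCount_add {n : ℕ} (ω : ℕ → Example n) (m : ℕ) (z : Fin n → ZMod 2)
    [DecidablePred (· ∈ (disagree z)ᶜ)] :
    errCount ω m z + ((Finset.range m).filter fun i => ω i ∈ (disagree z)ᶜ).card = m := by
  classical
  rw [errCount_eq]
  conv_rhs => rw [← Finset.card_range m,
    ← Finset.card_filter_add_card_filter_not (s := Finset.range m) (fun i => ω i ∈ disagree z)]
  congr

/-- A wrong vector within the threshold agrees with at least `5/8` of the examples, an excess of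
`1/8` over the mean, which has probability at most `exp (-m / 32)`. There are at most `exp (3 k L) =
exp (3 m / 256)` candidates, so the factor `256` in the number of samples leaves `exp (-m / 64)`. -/
lemma measure_unique_ge {n k m h t : ℕ} {b η : ℝ} (x : Fin n → ZMod 2) {ν : unitInterval}
    (hk : 1 ≤ k) (hkn : k ≤ n) (hm : m = sampleCount n k) (hh : h = (k + 1) / 2)
    (ht : b * m ≤ t) (ht' : 8 * t ≤ 3 * m) (hν : (ν : ℝ) ≤ η) (hη : η ≤ b) :
    1 - (Real.exp (-(2 * (b - η) ^ 2 * m)) + Real.exp (-(m / 64))) ≤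
      (sourceMeasure x ν).real {ω | errCount ω m x ≤ t ∧
        ∀ z, hammingNorm z ≤ 2 * h → errCount ω m z ≤ t → z = x} := by
  classical
  set P := sourceMeasure x ν with hP
  let A : Set (ℕ → Example n) := {ω | ((exampleMeasure x ν).real (disagree x) + (b - η)) * m ≤
    ((Finset.range m).filter fun i => ω i ∈ disagree x).card}
  let D : (Fin n → ZMod 2) → Set (ℕ → Example n) := fun z =>
    {ω | ((exampleMeasure x ν).real (disagree z)ᶜ + 1 / 8) * m ≤
      ((Finset.range m).filter fun i => ω i ∈ (disagree z)ᶜ).card}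
  let Z := Finset.univ.filter fun z : Fin n → ZMod 2 => hammingNorm z ≤ 2 * k ∧ z ≠ x
  set G : Set (ℕ → Example n) := {ω | errCount ω m x ≤ t ∧
    ∀ z, hammingNorm z ≤ 2 * h → errCount ω m z ≤ t → z = x} with hG
  have hA : P.real A ≤ Real.exp (-(2 * (b - η) ^ 2 * m)) :=
    measure_count_ge _ .of_discrete m (by linarith)
  have hD : ∀ z ∈ Z, P.real (D z) ≤ Real.exp (-(m / 32)) := by
    intro z _
    refine (measure_count_ge _ .of_discrete m (by norm_num)).trans (le_of_eq ?_)
    congr 1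
    ring
  have hcov : Set.univ ⊆ G ∪ (A ∪ ⋃ z ∈ Z, D z) := by
    intro ω _
    by_contra hω
    simp only [Set.mem_union, not_or, Set.mem_iUnion, not_exists] at hω
    obtain ⟨h1, h2, h3⟩ := hω
    refine h1 ⟨?_, fun z hz hzt => ?_⟩
    · by_contra hlt
      refine h2 ?_
      simp only [A, Set.mem_ofPred_eq]
      rw [measure_disagree_self]
      have h4 : (t : ℝ) ≤ ((Finset.range m).filter fun i => ω i ∈ disagree x).card :=
        Nat.cast_le.2 ((not_le.1 hlt).le.trans (errCount_eq ω m x).le)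
      have h5 : (0 : ℝ) ≤ m := Nat.cast_nonneg _
      nlinarith
    · by_contra hzx
      refine h3 z (Finset.mem_filter.2 ⟨Finset.mem_univ _, by omega, hzx⟩) ?_
      simp only [D, Set.mem_ofPred_eq]
      rw [probReal_compl_eq_one_sub .of_discrete, measure_disagree_ne hzx]
      have h4 := errCount_add ω m z
      have h5 : (errCount ω m z : ℝ) +
        ((Finset.range m).filter fun i => ω i ∈ (disagree z)ᶜ).card = m := by exact_mod_cast h4
      have h6 : (errCount ω m z : ℝ) ≤ t := by exact_mod_cast hzt
      have h7 : (8 * t : ℝ) ≤ 3 * m := by exact_mod_cast ht'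
      linarith
  have hunion : P.real (⋃ z ∈ Z, D z) ≤ Real.exp (-(m / 64)) := by
    calc P.real (⋃ z ∈ Z, D z) ≤ ∑ z ∈ Z, P.real (D z) := measureReal_biUnion_finset_le _ _
      _ ≤ ∑ z ∈ Z, Real.exp (-(m / 32)) := Finset.sum_le_sum hD
      _ = Z.card * Real.exp (-(m / 32)) := by rw [Finset.sum_const, nsmul_eq_mul]
      _ ≤ Real.exp (3 * (k * logRatio n k)) * Real.exp (-(m / 32)) := by
          refine mul_le_mul_of_nonneg_right ?_ (Real.exp_pos _).le
          refine le_trans ?_ (subsetCount_two_mul_le hk hkn)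
          have hsub : Z ⊆ Finset.univ.filter fun z : Fin n → ZMod 2 => hammingNorm z ≤ 2 * k :=
            fun z hz => Finset.mem_filter.2 ⟨Finset.mem_univ _, (Finset.mem_filter.1 hz).2.1⟩
          exact Nat.cast_le.2 ((Finset.card_le_card hsub).trans (card_hammingNorm_le n (2 * k)))
      _ ≤ _ := by
          rw [← Real.exp_add, Real.exp_le_exp, hm, sampleCount]
          push_cast
          have : (0 : ℝ) ≤ k * logRatio n k := by positivity
          linarith
  have h1 : (1 : ℝ) = P.real Set.univ := by simp [hP]
  have h2 : P.real Set.univ ≤ P.real (G ∪ (A ∪ ⋃ z ∈ Z, D z)) := measureReal_mono hcov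
  have h3 := measureReal_union_le (μ := P) G (A ∪ ⋃ z ∈ Z, D z)
  have h4 := measureReal_union_le (μ := P) A (⋃ z ∈ Z, D z)
  linarith

/-! ### Binomial coefficients -/

/-- The binomial coefficient is a product of quotients `(n - i) / (r - i)`, and for `q ≥ 1` each is
at least `q` once `n / r` is. -/
lemma rpow_le_choose {q : ℝ} (hq : 1 ≤ q) {n r : ℕ} (h : q * r ≤ n) : q ^ r ≤ n.choose r := by
  induction r generalizing n with
  | zero => simp
  | succ r ih =>
    cases n with
    | zero =>
      push_cast at h
      have : (0 : ℝ) ≤ r := Nat.cast_nonneg r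
      nlinarith
    | succ n =>
      push_cast at h
      have h1 := ih (n := n) (by linarith)
      have h2 : ((n + 1 : ℕ) : ℝ) * n.choose r = (n + 1).choose (r + 1) * ((r + 1 : ℕ) : ℝ) := by
        exact_mod_cast Nat.add_one_mul_choose_eq n r
      push_cast at h2
      have h3 : (0 : ℝ) < r + 1 := by positivity
      have h4 : (0 : ℝ) ≤ n.choose r := Nat.cast_nonneg _
      refine le_of_mul_le_mul_right ?_ h3
      rw [← h2, pow_succ]
      calc q ^ r * q * (r + 1) = q ^ r * (q * (r + 1)) := by ring
        _ ≤ n.choose r * (n + 1) := mul_le_mul h1 h (by positivity) h4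
        _ = _ := by ring

lemma choose_le_choose {n i h : ℕ} (hi : i ≤ h) (hh : 2 * h ≤ n + 1) :
    n.choose i ≤ n.choose h := by
  induction h, hi using Nat.le_induction with
  | base => exact le_rfl
  | succ r _ ih =>
    refine (ih (by omega)).trans ?_
    have h1 := Nat.choose_succ_right_eq n r
    have h2 : n.choose r * (r + 1) ≤ n.choose r * (n - r) := Nat.mul_le_mul_left _ (by omega)
    exact Nat.le_of_mul_le_mul_right (h2.trans h1.symm.le) (Nat.succ_pos r)

lemma le_choose {n h : ℕ} (h1 : 1 ≤ h) (hh : 2 * h ≤ n + 1) : n ≤ n.choose h := by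
  simpa using choose_le_choose h1 hh

lemma subsetCount_le {n h : ℕ} (hh : 2 * h ≤ n + 1) :
    subsetCount n h ≤ (h + 1) * n.choose h := by
  rw [subsetCount_eq_sum]
  refine (Finset.sum_le_card_nsmul _ _ (n.choose h) fun i hi => choose_le_choose ?_ hh).trans
    (by simp)
  exact Nat.lt_succ_iff.1 (Finset.mem_range.1 hi)

lemma subsetCount_mono (n : ℕ) {r r' : ℕ} (h : r ≤ r') : subsetCount n r ≤ subsetCount n r' := by
  rw [subsetCount_eq_sum, subsetCount_eq_sum]
  exact Finset.sum_le_sum_of_subset (Finset.range_subset_range.2 (by omega))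

lemma lt_subsetCount (n : ℕ) {r : ℕ} (h : 1 ≤ r) : n < subsetCount n r := by
  refine lt_of_lt_of_le ?_ (subsetCount_mono n h)
  simp [subsetCount_eq_sum, Finset.sum_range_succ]

/-- Both cases bound `n / h` from below and apply `rpow_le_choose`. If `logRatio n k = 1`, then `n /
h ≥ 4/3`, and the exponent `9` comes from `2 ≤ (4/3) ^ 3` and `k ≤ 3 h`. Otherwise `n / h ≥ 2 ^ (L -
1)` with `L ≤ 2 (L - 1)`, and there is room to spare. -/
lemma two_pow_le_choose_pow {n k h : ℕ} (hn : 2 ≤ n) (hk : 1 ≤ k) (hkn : k ≤ n) (hhk : h ≤ k)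
    (hkh : k ≤ 3 * h) (hhn : 2 * h ≤ n + 1) :
    (2 : ℝ) ^ (k * logRatio n k) ≤ (n.choose h : ℝ) ^ 9 := by
  have hL : 1 ≤ logRatio n k := Nat.le_add_left _ _
  rcases eq_or_lt_of_le hL with hL1 | hL2
  · rw [← hL1, mul_one]
    have h1 : ((4 : ℝ) / 3) ^ h ≤ n.choose h := by
      refine rpow_le_choose (by norm_num) ?_
      have h2 : (2 * h : ℝ) ≤ n + 1 := by exact_mod_cast hhn
      have h3 : (2 : ℝ) ≤ n := by exact_mod_cast hn
      linarith
    calc (2 : ℝ) ^ k ≤ (((4 : ℝ) / 3) ^ 3) ^ k := pow_le_pow_left₀ (by norm_num) (by norm_num) _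
      _ = ((4 : ℝ) / 3) ^ (3 * k) := by rw [pow_mul]
      _ ≤ ((4 : ℝ) / 3) ^ (h * 9) := pow_le_pow_right₀ (by norm_num) (by omega)
      _ = (((4 : ℝ) / 3) ^ h) ^ 9 := by rw [pow_mul]
      _ ≤ _ := pow_le_pow_left₀ (by positivity) h1 _
  · have h1 : ((2 : ℝ) ^ (logRatio n k - 1)) ^ h ≤ n.choose h := by
      refine rpow_le_choose (one_le_pow₀ (by norm_num)) ?_
      have := mul_two_pow_le (q := logRatio n k - 1) hk hkn (by omega)
      have h2 : 2 ^ (logRatio n k - 1) * h ≤ n := by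
        rw [mul_comm]
        exact (Nat.mul_le_mul_right _ hhk).trans this
      exact_mod_cast h2
    calc (2 : ℝ) ^ (k * logRatio n k) ≤ (2 : ℝ) ^ ((logRatio n k - 1) * h * 9) := by
          refine pow_le_pow_right₀ (by norm_num) ?_
          obtain ⟨r, hr⟩ : ∃ r, logRatio n k = r + 2 := ⟨logRatio n k - 2, by omega⟩
          rw [hr]
          simp only [show r + 2 - 1 = r + 1 by omega]
          nlinarith
      _ = (((2 : ℝ) ^ (logRatio n k - 1)) ^ h) ^ 9 := by rw [pow_mul, pow_mul]
      _ ≤ _ := pow_le_pow_left₀ (by positivity) h1 _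

/-! ### The number of samples -/

section
variable {n k m : ℕ}

lemma le_sampleCount (hm : m = sampleCount n k) : 256 * k ≤ m := by
  rw [hm, sampleCount]
  exact Nat.le_mul_of_pos_right _ (Nat.le_add_left _ _)

lemma logRatio_le_sampleCount (hk : 1 ≤ k) (hm : m = sampleCount n k) : logRatio n k ≤ m := by
  rw [hm, sampleCount]
  exact Nat.le_mul_of_pos_left _ (by omega)

lemma lt_two_pow_sampleCount (hk : 1 ≤ k) (hm : m = sampleCount n k) : n < 2 ^ m := by
  have hL : 1 ≤ logRatio n k := Nat.le_add_left _ _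
  refine (lt_mul_two_pow hk).trans_le ?_
  calc k * 2 ^ logRatio n k ≤ 2 ^ k * 2 ^ logRatio n k :=
        Nat.mul_le_mul_right _ Nat.lt_two_pow_self.le
    _ = 2 ^ (k + logRatio n k) := by rw [pow_add]
    _ ≤ 2 ^ m := by
        refine Nat.pow_le_pow_right (by norm_num) ?_
        rw [hm, sampleCount]
        nlinarith

/-- This makes `m` large uniformly in `k`, so that thresholds can be imposed on `n` alone. -/
lemma log_le_sampleCount (hn : 1 ≤ n) (hk : 1 ≤ k) (hm : m = sampleCount n k) :
    Real.log n ≤ m := by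
  have h1 : (n : ℝ) ≤ 2 ^ m := by exact_mod_cast (lt_two_pow_sampleCount hk hm).le
  have hn' : (0 : ℝ) < n := by exact_mod_cast hn
  have h2 := Real.log_le_log hn' h1
  rw [Real.log_pow] at h2
  have h3 := Real.log_two_lt_d9
  have h4 : (0 : ℝ) ≤ m := Nat.cast_nonneg _
  nlinarith

/-- Here `768 = 256 · 3`, and `logRatio n k ≤ 2 log₂ n ≤ 3 log n`. -/
lemma sampleCount_le (hn : 2 ≤ n) (hk : 1 ≤ k) (hkn : k ≤ n) (hm : m = sampleCount n k) :
    (m : ℝ) ≤ 768 * (k * Real.log n) := by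
  have h1 : 2 ^ (logRatio n k - 1) ≤ n :=
    (Nat.le_mul_of_pos_left _ hk).trans
      (mul_two_pow_le hk hkn (by simp only [logRatio]; omega))
  have h2 : (2 : ℝ) ^ (logRatio n k - 1) ≤ n := by exact_mod_cast h1
  have h3 := Real.log_le_log (by positivity) h2
  rw [Real.log_pow, show logRatio n k - 1 = Nat.log 2 (n / k) from rfl] at h3
  have h4 : (logRatio n k : ℝ) = Nat.log 2 (n / k) + 1 := by simp [logRatio]
  have h5 : Real.log 2 ≤ Real.log n := Real.log_le_log (by norm_num) (by exact_mod_cast hn)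
  have h6 := Real.log_two_gt_d9
  have h7 : (logRatio n k : ℝ) ≤ 3 * Real.log n := by
    rw [h4]
    have : (0 : ℝ) ≤ Nat.log 2 (n / k) := Nat.cast_nonneg _
    nlinarith
  rw [hm, sampleCount]
  push_cast
  have : (0 : ℝ) ≤ k := Nat.cast_nonneg _
  nlinarith

/-- The exponent is `2304 = 256 · 9`, with the `9` of `two_pow_le_choose_pow`. -/
lemma two_pow_sampleCount_le {h : ℕ} (hn : 2 ≤ n) (hk : 1 ≤ k) (hkn : k ≤ n) (hhk : h ≤ k)
    (hkh : k ≤ 3 * h) (hhn : 2 * h ≤ n + 1) (hm : m = sampleCount n k) :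
    (2 : ℝ) ^ m ≤ (n.choose h : ℝ) ^ 2304 := by
  have h1 := pow_le_pow_left₀ (by positivity) (two_pow_le_choose_pow hn hk hkn hhk hkh hhn) 256
  rw [← pow_mul, ← pow_mul] at h1
  refine le_trans (le_of_eq ?_) h1
  rw [hm, sampleCount]
  congr 1
  ring

lemma subsetCount_le_two_pow {h : ℕ} (hk : 1 ≤ k) (hkn : k ≤ n) (hhk : h ≤ 2 * k)
    (hm : m = sampleCount n k) : subsetCount n h ≤ 2 ^ m := by
  have h1 := subsetCount_two_mul_le hk hkn
  have h2 : (subsetCount n h : ℝ) ≤ subsetCount n (2 * k) :=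
    Nat.cast_le.2 (subsetCount_mono n hhk)
  have h3 : Real.exp (3 * (k * logRatio n k)) ≤ (2 : ℝ) ^ m := by
    rw [← Real.rpow_natCast, Real.rpow_def_of_pos (by norm_num), Real.exp_le_exp, hm, sampleCount]
    have := Real.log_two_gt_d9
    have h0 : (0 : ℝ) ≤ k * logRatio n k := by positivity
    push_cast
    nlinarith
  exact_mod_cast h2.trans (h1.trans h3)

end

/-! ### The running time -/

/-- A bound for the numbers that the learner handles. -/
def learnerBound (n b m V V' : ℕ) : ℕ :=
  2 * n + 3 + m + b + (n + 1 + m) * (m + 1) + (n + (n + 1 + m) * m + 2 ^ m + (m + 3) * (V + V'))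

/-- All quantities are at most `2 ^ m` and enter in products of at most two, so the bound has at
most `3 m` digits, even with the constants, and `2 + 6 m ≤ 7 m`. -/
lemma unitCost_learnerBound_le {n b m V V' : ℕ} (hm : 256 ≤ m) (hb : b ≤ m) (hn : n ≤ 2 ^ m)
    (hV : V ≤ 2 ^ m) (hV' : V' ≤ 2 ^ m) : unitCost (learnerBound n b m V V') ≤ 7 * m := by
  have hmP : m ≤ 2 ^ m := Nat.lt_two_pow_self.le
  have h256 : 2 ^ 8 ≤ 2 ^ m := Nat.pow_le_pow_right (by norm_num) (by omega)
  have hlt : learnerBound n b m V V' < 2 ^ (3 * m) := by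
    rw [show 3 * m = m + m + m by ring, pow_add, pow_add]
    set P := 2 ^ m with hP
    have h1 : (n + 1 + m) * (m + 1) ≤ (3 * P) * (2 * P) := Nat.mul_le_mul (by omega) (by omega)
    have h2 : (n + 1 + m) * m ≤ (3 * P) * P := Nat.mul_le_mul (by omega) (by omega)
    have h3 : (m + 3) * (V + V') ≤ (2 * P) * (2 * P) := Nat.mul_le_mul (by omega) (by omega)
    have h4 : 256 * (P * P) ≤ P * P * P := by
      rw [mul_comm (P * P)]
      exact Nat.mul_le_mul_right _ h256
    have h5 : 256 * P ≤ P * P := Nat.mul_le_mul_right _ h256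
    simp only [learnerBound]
    nlinarith
  have := Nat.size_le.2 hlt
  simp only [unitCost]
  omega

lemma learnerSteps_le {n k m h t V V' : ℕ} (hm : 256 ≤ m) (hL : logRatio n k ≤ m) (hh : h ≤ m)
    (ht : t ≤ m) (hV : n ≤ V) (hV1 : 1 ≤ V) (hV' : 1 ≤ V') :
    learnerSteps n k m h t V V' ≤ 100 * (m * (V * V')) := by
  have h1 : m ≤ m * (V * V') := Nat.le_mul_of_pos_right _ (Nat.mul_pos hV1 hV')
  have h2 : m * n ≤ m * (V * V') :=
    Nat.mul_le_mul_left _ (hV.trans (Nat.le_mul_of_pos_right _ hV'))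
  have h3 : m * V ≤ m * (V * V') := Nat.mul_le_mul_left _ (Nat.le_mul_of_pos_right _ hV')
  have h4 : m * V' ≤ m * (V * V') := Nat.mul_le_mul_left _ (Nat.le_mul_of_pos_left _ hV1)
  have h5 : 256 * V ≤ m * V := Nat.mul_le_mul_right _ hm
  have h6 : 256 * V' ≤ m * V' := Nat.mul_le_mul_right _ hm
  have h7 : 256 * (V * V') ≤ m * (V * V') := Nat.mul_le_mul_right _ hm
  have e : learnerSteps n k m h t V V' = 4 * logRatio n k + 21 * h + 3 * t + m * n + 20 * m +
      22 * (m * V) + 38 * V + 11 * (m * V') + 22 * V' + 11 * (m * (V * V')) + 13 * (V * V') +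
      79 := by
    simp only [learnerSteps]
    ring
  rw [e]
  omega

/-! ### Entropy estimates and the choice of the threshold `1 / b`. -/

lemma entropy_mul_log_two (p : ℝ) : entropy p * Real.log 2 = Real.binEntropy p := by
  have h : Real.log 2 ≠ 0 := (Real.log_pos (by norm_num)).ne'
  simp only [entropy, Real.logb, Real.binEntropy, one_div]
  field_simp

/-- Take `lam = 1 / (b - 1)`, the odds of probability `1 / b`, in `subsetCount_mul_pow_le`: the
exponents combine to the entropy at `1 / b`. Rounding `t` up costs one more factor `b - 1`. -/
lemma subsetCount_le_exp {b m t : ℕ} (hb : 2 ≤ b) (ht : (t : ℝ) ≤ m / b + 1) :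
    (subsetCount m t : ℝ) ≤ b * Real.exp (m * Real.binEntropy (1 / b)) := by
  have hb2 : (2 : ℝ) ≤ b := by exact_mod_cast hb
  have hb0 : (0 : ℝ) < b := by linarith
  have hc0 : (0 : ℝ) < b - 1 := by linarith
  have h := subsetCount_mul_pow_le (lam := 1 / ((b : ℝ) - 1)) (by positivity)
    ((div_le_one hc0).2 (by linarith)) m t
  have h1 : (1 + 1 / ((b : ℝ) - 1)) ^ m = Real.exp (m * (Real.log b - Real.log (b - 1))) := by
    rw [← Real.log_div hb0.ne' hc0.ne', ← Real.log_pow, Real.exp_log (by positivity)]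
    congr 1
    field_simp
    ring
  have h2 : ((b : ℝ) - 1) ^ t ≤ b * Real.exp (m / b * Real.log (b - 1)) := by
    have hlog : 0 ≤ Real.log ((b : ℝ) - 1) := Real.log_nonneg (by linarith)
    calc ((b : ℝ) - 1) ^ t = Real.exp (t * Real.log (b - 1)) := by
          rw [← Real.log_pow, Real.exp_log (by positivity)]
      _ ≤ Real.exp ((m / b + 1) * Real.log (b - 1)) :=
          Real.exp_le_exp.2 (mul_le_mul_of_nonneg_right ht hlog)
      _ = (b - 1) * Real.exp (m / b * Real.log (b - 1)) := by
          rw [add_mul, one_mul, Real.exp_add, Real.exp_log hc0, mul_comm]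
      _ ≤ _ := mul_le_mul_of_nonneg_right (by linarith) (Real.exp_pos _).le
  have h3 : (1 / ((b : ℝ) - 1)) ^ t * ((b : ℝ) - 1) ^ t = 1 := by
    rw [← mul_pow, one_div, inv_mul_cancel₀ hc0.ne', one_pow]
  have h4 : Real.binEntropy (1 / b) =
      Real.log b - Real.log (b - 1) + 1 / b * Real.log (b - 1) := by
    have e : (1 - 1 / (b : ℝ))⁻¹ = b / (b - 1) := by
      field_simp
    rw [Real.binEntropy, e, Real.log_div hb0.ne' hc0.ne', one_div, inv_inv]
    ring
  calc (subsetCount m t : ℝ)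
      = subsetCount m t * (1 / ((b : ℝ) - 1)) ^ t * ((b : ℝ) - 1) ^ t := by
        rw [mul_assoc, h3, mul_one]
    _ ≤ Real.exp (m * (Real.log b - Real.log (b - 1))) *
        (b * Real.exp (m / b * Real.log (b - 1))) :=
        mul_le_mul (h.trans h1.le) h2 (by positivity) (Real.exp_pos _).le
    _ = b * Real.exp (m * Real.binEntropy (1 / b)) := by
        rw [h4, mul_left_comm, ← Real.exp_add]
        congr 2
        ring

/-- The largest integer `b` below `1 / η` is at least `3`, and `1 / η ≤ b + 1 ≤ 1.5 b`. This
rounding is the source of the factor `1.5`. -/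
lemma exists_nat_inv_between {η : ℝ} (h0 : 0 < η) (h1 : η < 1 / 3) :
    ∃ b : ℕ, 3 ≤ b ∧ η < 1 / b ∧ 1 / (b : ℝ) ≤ 1.5 * η := by
  obtain ⟨b, hb⟩ : ∃ b : ℕ, ⌈1 / η⌉₊ = b + 1 :=
    Nat.exists_eq_succ_of_ne_zero (Nat.ceil_pos.2 (by positivity)).ne'
  have h3 : (3 : ℝ) < 1 / η := by
    rw [lt_div_iff₀ h0]
    linarith
  have hlt : (b : ℝ) < 1 / η := Nat.lt_ceil.1 (by omega)
  have hle : 1 / η ≤ b + 1 := by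
    have := Nat.le_ceil (1 / η)
    rw [hb] at this
    exact_mod_cast this
  have hb3 : 3 ≤ b := by
    have : (3 : ℝ) < b + 1 := h3.trans_le hle
    have : 3 < b + 1 := by exact_mod_cast this
    omega
  have hb3' : (3 : ℝ) ≤ b := by exact_mod_cast hb3
  have hb0 : (0 : ℝ) < b := by linarith
  refine ⟨b, hb3, ?_, ?_⟩
  · rwa [lt_div_iff₀ hb0, mul_comm, ← lt_div_iff₀ h0]
  · rw [div_le_iff₀ h0] at hle
    rw [div_le_iff₀ hb0]
    nlinarith

/-- The entropy increases on `[0, 1/2]`, and `1.5 η < 1/2` is the assumption `η < 1/3`. -/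
lemma binEntropy_inv_le {b : ℕ} {η : ℝ} (h1 : η < 1 / 3) (hb : 1 / (b : ℝ) ≤ 1.5 * η) :
    Real.binEntropy (1 / b) ≤ entropy (1.5 * η) * Real.log 2 := by
  rw [entropy_mul_log_two]
  have h0 : (0 : ℝ) ≤ 1 / b := by positivity
  refine Real.binEntropy_strictMonoOn.monotoneOn ⟨h0, ?_⟩ ⟨h0.trans hb, ?_⟩ hb <;> norm_num at * <;>
    linarith

lemma entropy_pos {η : ℝ} (h0 : 0 < η) (h1 : η < 1 / 3) : 0 < entropy (1.5 * η) := by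
  have h := Real.binEntropy_pos (p := 1.5 * η) (by linarith) (by linarith)
  rw [← entropy_mul_log_two] at h
  exact pos_of_mul_pos_left h (Real.log_pos (by norm_num)).le

/-- The running time is bounded by a power of a binomial coefficient. -/
lemma cost_le {n m h b V V' : ℕ} {B H E : ℝ} (hB : 1 < B) (hH : 0 ≤ H) (hh : h + 1 ≤ m)
    (h2m : (2 : ℝ) ^ m ≤ B ^ 2304) (hE : E ≤ H * Real.log 2)
    (hV : V ≤ (h + 1) * n.choose h) (hV' : (V' : ℝ) ≤ b * Real.exp (m * E))
    (hpoly : 700 * b * (4000 * Real.log B) ^ 3 ≤ B ^ H) (hB1 : (n.choose h : ℝ) ≤ B ^ (1 + H)) :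
    ((100 * (m * (V * V')) * (7 * m) : ℕ) : ℝ) ≤ B ^ (1 + 3000 * H) := by
  have hB0 : 0 < B := by linarith
  have hlogB := Real.log_pos hB
  have hm : (m : ℝ) ≤ 4000 * Real.log B := by
    have h1 := Real.log_le_log (by positivity) h2m
    rw [Real.log_pow, Real.log_pow] at h1
    have h3 := Real.log_two_gt_d9
    have h4 : (0 : ℝ) ≤ m := Nat.cast_nonneg _
    push_cast at h1
    nlinarith
  -- As `2 ^ m` is a bounded power of `B`, guessing the errors costs only a power of `B`
  -- proportional to the entropy.
  have hexp : Real.exp (m * E) ≤ B ^ (2304 * H) := by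
    calc Real.exp (m * E) ≤ Real.exp (m * (H * Real.log 2)) :=
          Real.exp_le_exp.2 (mul_le_mul_of_nonneg_left hE (Nat.cast_nonneg _))
      _ = ((2 : ℝ) ^ m) ^ H := by
          rw [← Real.rpow_natCast, ← Real.rpow_mul (by norm_num), Real.rpow_def_of_pos (by norm_num)]
          congr 1
          ring
      _ ≤ (B ^ 2304) ^ H := Real.rpow_le_rpow (by positivity) h2m hH
      _ = B ^ (2304 * H) := by
          rw [← Real.rpow_natCast, ← Real.rpow_mul hB0.le]
          norm_num
  have hV1 : (V : ℝ) ≤ m * B ^ (1 + H) := by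
    calc (V : ℝ) ≤ ((h + 1) * n.choose h : ℕ) := Nat.cast_le.2 hV
      _ ≤ (m * n.choose h : ℕ) := Nat.cast_le.2 (Nat.mul_le_mul_right _ hh)
      _ = m * (n.choose h : ℝ) := by push_cast; ring
      _ ≤ _ := mul_le_mul_of_nonneg_left hB1 (Nat.cast_nonneg _)
  have hV2 : (V' : ℝ) ≤ b * B ^ (2304 * H) :=
    hV'.trans (mul_le_mul_of_nonneg_left hexp (Nat.cast_nonneg _))
  have hVV : (V : ℝ) * V' ≤ (m * B ^ (1 + H)) * (b * B ^ (2304 * H)) :=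
    mul_le_mul hV1 hV2 (Nat.cast_nonneg _) (by positivity)
  have hm3 : (m : ℝ) ^ 3 ≤ (4000 * Real.log B) ^ 3 := pow_le_pow_left₀ (Nat.cast_nonneg _) hm 3
  push_cast
  calc (100 * ((m : ℝ) * (V * V')) * (7 * m)) = 700 * m ^ 2 * (V * V') := by ring
    _ ≤ 700 * m ^ 2 * ((m * B ^ (1 + H)) * (b * B ^ (2304 * H))) :=
        mul_le_mul_of_nonneg_left hVV (by positivity)
    _ = 700 * b * m ^ 3 * (B ^ (1 + H) * B ^ (2304 * H)) := by ring
    _ ≤ B ^ H * (B ^ (1 + H) * B ^ (2304 * H)) := by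
        refine mul_le_mul_of_nonneg_right (le_trans ?_ hpoly) (by positivity)
        exact mul_le_mul_of_nonneg_left hm3 (by positivity)
    _ = B ^ (H + ((1 + H) + 2304 * H)) := by rw [← Real.rpow_add hB0, ← Real.rpow_add hB0]
    -- The exponents add up to `1 + 2306 H`.
    _ ≤ B ^ (1 + 3000 * H) := Real.rpow_le_rpow_of_exponent_le hB.le (by linarith)

/-- For large `k`, the rounding of `k / 2` does not matter. -/
lemma choose_succ_le_rpow {n h j : ℕ} {H : ℝ} (hH : 0 < H) (hj : 2 / H ≤ j) (hjh : j ≤ h)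
    (hhn : 2 * h ≤ n) (hjn : j ^ 2 ≤ n) :
    (n.choose (h + 1) : ℝ) ≤ (n.choose h : ℝ) ^ (1 + H) := by
  have hj0 : 0 < j := by
    have : (0 : ℝ) < j := lt_of_lt_of_le (by positivity) hj
    exact_mod_cast this
  have hj0' : (0 : ℝ) < j := by exact_mod_cast hj0
  have hn0 : 0 < n := by omega
  have hn1 : (1 : ℝ) ≤ n := by exact_mod_cast hn0
  have hsq : (j : ℝ) ≤ Real.sqrt n := by
    refine Real.le_sqrt_of_sq_le ?_
    exact_mod_cast hjn
  have hs1 : 1 ≤ Real.sqrt n := by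
    rw [Real.one_le_sqrt]
    exact hn1
  have h1 : Real.sqrt n ^ j ≤ n.choose h := by
    have h2 : Real.sqrt n ^ j ≤ n.choose j := by
      refine rpow_le_choose hs1 ?_
      calc Real.sqrt n * j ≤ Real.sqrt n * Real.sqrt n := by gcongr
        _ = n := Real.mul_self_sqrt (by linarith)
    exact h2.trans (Nat.cast_le.2 (choose_le_choose hjh (by omega)))
  -- The coefficient is at least `√n ^ j`, and `j H ≥ 2`.
  have h3 : (n : ℝ) ≤ (n.choose h : ℝ) ^ H := by
    calc (n : ℝ) = Real.sqrt n ^ (2 : ℝ) := by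
          rw [Real.rpow_two, Real.sq_sqrt (by linarith)]
      _ ≤ Real.sqrt n ^ (j * H) := by
          refine Real.rpow_le_rpow_of_exponent_le hs1 ?_
          rwa [div_le_iff₀ hH] at hj
      _ = (Real.sqrt n ^ j) ^ H := by rw [Real.rpow_mul (by linarith), Real.rpow_natCast]
      _ ≤ _ := Real.rpow_le_rpow (by positivity) h1 hH.le
  have h4 : n.choose (h + 1) ≤ n * n.choose h := by
    have h5 := Nat.choose_succ_right_eq n h
    calc n.choose (h + 1) ≤ n.choose (h + 1) * (h + 1) := Nat.le_mul_of_pos_right _ (Nat.succ_pos h)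
      _ = n.choose h * (n - h) := h5
      _ ≤ n.choose h * n := Nat.mul_le_mul_left _ (Nat.sub_le _ _)
      _ = _ := mul_comm _ _
  have hpos : (0 : ℝ) < n.choose h := by
    exact_mod_cast Nat.choose_pos (by omega)
  rw [Real.rpow_add hpos, Real.rpow_one]
  calc (n.choose (h + 1) : ℝ) ≤ (n * n.choose h : ℕ) := Nat.cast_le.2 h4
    _ = n.choose h * n := by push_cast; ring
    _ ≤ _ := mul_le_mul_of_nonneg_left h3 hpos.le

end LPN

/-! ### The theorem: choice of the thresholds and conclusion. -/

theorem mainTheorem5 :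
    ∃ C : ℝ, 0 < C ∧ ∀ δ : ℝ, 0 < δ → δ < 1 → ∀ η : ℝ, 0 < η → η < 1 / 3 →
      ∃ (p : LPN.Prog) (n₀ : ℕ), ∀ n k : ℕ, n₀ ≤ n → 1 ≤ k → k ≤ n →
        ∀ h : ℕ, (h = (k + 1) / 2 ∨ (n₀ ≤ k ∧ h = k / 2)) →
          LPN.Solves p n k η δ (C * (k * Real.log n))
            ((n.choose h : ℝ) ^ (1 + C * LPN.entropy (1.5 * η))) := by
  -- One constant serves for the samples, where `768` would do, and for the exponent of the running
  -- time.
  refine ⟨3000, by norm_num, fun δ hδ0 _ η hη0 hη3 => ?_⟩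
  obtain ⟨b, hb3, hηb, hbη⟩ := LPN.exists_nat_inv_between hη0 hη3
  have hH := LPN.entropy_pos hη0 hη3
  set H := LPN.entropy (1.5 * η) with hHdef
  have hE := LPN.binEntropy_inv_le hη3 hbη
  rw [← hHdef] at hE
  have hb0 : (0 : ℝ) < b := by
    have : (3 : ℝ) ≤ b := by exact_mod_cast hb3
    linarith
  have hgap : 0 < 1 / (b : ℝ) - η := by linarith
  -- thresholds
  have hprob : ∀ᶠ y : ℝ in Filter.atTop,
      Real.exp (-(2 * (1 / (b : ℝ) - η) ^ 2 * y)) + Real.exp (-(y / 64)) ≤ δ := by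
    have h1 : Filter.Tendsto (fun y : ℝ => Real.exp (-(2 * (1 / (b : ℝ) - η) ^ 2 * y)) +
        Real.exp (-(y / 64))) Filter.atTop (nhds (0 + 0)) := by
      refine Filter.Tendsto.add ?_ ?_
      · refine Real.tendsto_exp_neg_atTop_nhds_zero.comp ?_
        exact Filter.tendsto_id.const_mul_atTop (by positivity)
      · refine Real.tendsto_exp_neg_atTop_nhds_zero.comp ?_
        exact Filter.tendsto_id.atTop_div_const (by norm_num)
    rw [add_zero] at h1
    exact (h1.eventually (gt_mem_nhds hδ0)).mono fun y hy => hy.le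
  obtain ⟨Y, hY⟩ := Filter.eventually_atTop.1 (hprob.and (Filter.eventually_ge_atTop (b : ℝ)))
  have hlog : ∀ᶠ N : ℕ in Filter.atTop, Y ≤ Real.log N :=
    (Real.tendsto_log_atTop.comp tendsto_natCast_atTop_atTop).eventually_ge_atTop Y
  -- The overhead `700 b m ^ 3` with `m ≤ 4000 log y` is swallowed by `y ^ H`.
  have hpoly : ∀ᶠ y : ℝ in Filter.atTop, 700 * b * (4000 * Real.log y) ^ 3 ≤ y ^ H := by
    have h1 := (isLittleO_log_rpow_rpow_atTop 3 hH).bound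
      (show (0 : ℝ) < 1 / (700 * b * 4000 ^ 3) by positivity)
    filter_upwards [h1, Filter.eventually_ge_atTop 1] with y hy hy1
    have h2 := Real.log_nonneg hy1
    rw [Real.norm_of_nonneg (by positivity), Real.norm_of_nonneg (by positivity), one_div,
      inv_mul_eq_div, le_div_iff₀ (by positivity)] at hy
    have h3 : Real.log y ^ (3 : ℝ) = Real.log y ^ 3 := by
      rw [← Real.rpow_natCast]
      norm_num
    rw [h3] at hy
    calc _ = Real.log y ^ 3 * (700 * b * 4000 ^ 3) := by ring
      _ ≤ _ := hy
  obtain ⟨Y', hY'⟩ := Filter.eventually_atTop.1 hpoly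
  obtain ⟨N₁, hN₁⟩ := Filter.eventually_atTop.1 hlog
  obtain ⟨N₂, hN₂⟩ := exists_nat_ge Y'
  obtain ⟨j, hj⟩ := exists_nat_ge (2 / H)
  -- `N₁` forces `m ≥ Y`, `N₂` makes the binomial coefficient at least `Y'`, and `j ^ 2 + 2 * j`
  -- serves the rounding of `k / 2`. The `3` yields `k ≤ 3 h` when `h` is rounded down; the extreme
  -- case is `k = 3`, `h = 1`.
  refine ⟨LPN.learner b, N₁ + N₂ + j ^ 2 + 2 * j + 3, fun n k hn hk hkn h hcase => ?_⟩
  -- parameters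
  obtain ⟨m, hm⟩ : ∃ m, m = LPN.sampleCount n k := ⟨_, rfl⟩
  obtain ⟨h₁, hh₁⟩ : ∃ h₁, h₁ = (k + 1) / 2 := ⟨_, rfl⟩
  obtain ⟨t, ht⟩ : ∃ t, t = (m + b - 1) / b := ⟨_, rfl⟩
  have hkm := LPN.le_sampleCount hm
  have hYm : Y ≤ m := (hN₁ n (by omega)).trans (LPN.log_le_sampleCount (by omega) hk hm)
  obtain ⟨hδm, hbm⟩ := hY m hYm
  have hbm' : b ≤ m := by exact_mod_cast hbm
  have htm : t ≤ m := by
    rw [ht]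
    have := Nat.le_mul_of_pos_left m (show 0 < b by omega)
    exact (Nat.div_le_iff_le_mul_add_pred (by omega)).2 (by omega)
  have htb : t * b ≤ m + b - 1 := ht ▸ Nat.div_mul_le_self _ _
  have hmt : m ≤ b * t := by
    have h1 := Nat.lt_mul_div_succ (m + b - 1) (show 0 < b by omega)
    rw [← ht, Nat.mul_succ] at h1
    omega
  -- As `b ≥ 3`, `t` is at most `m / 3` rounded up, and `m ≥ 256` absorbs the rounding.
  have ht8 : 8 * t ≤ 3 * m := by
    have : t * 3 ≤ t * b := Nat.mul_le_mul_left _ hb3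
    by_contra hlt
    have h1 : (t - 1) * b ≤ m := by
      have : t = t - 1 + 1 := by omega
      rw [this, Nat.add_mul] at htb
      omega
    have h2 : (t - 1) * 3 ≤ (t - 1) * b := Nat.mul_le_mul_left _ hb3
    omega
  have hcases : h ≤ k ∧ k ≤ 3 * h ∧ 2 * h ≤ n + 1 := by
    rcases hcase with rfl | ⟨h1, rfl⟩ <;> omega
  obtain ⟨hhk, hkh, hhn⟩ := hcases
  obtain ⟨V, hV⟩ : ∃ V, V = LPN.subsetCount n h₁ := ⟨_, rfl⟩
  obtain ⟨V', hV'⟩ : ∃ V', V' = LPN.subsetCount m t := ⟨_, rfl⟩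
  have hV2 : V ≤ 2 ^ m := hV ▸ LPN.subsetCount_le_two_pow hk hkn (by omega) hm
  have hV2' : V' ≤ 2 ^ m := by
    have := LPN.subsetCount_mul_pow_le zero_le_one le_rfl m t
    rw [one_pow, mul_one, one_add_one_eq_two] at this
    rw [hV']
    exact_mod_cast this
  have hunit := LPN.unitCost_learnerBound_le (b := b) (by omega) hbm'
    (LPN.lt_two_pow_sampleCount hk hm).le hV2 hV2'
  have hsteps := LPN.learnerSteps_le (n := n) (k := k) (m := m) (h := h₁) (t := t) (V := V)
    (V' := V') (by omega) (LPN.logRatio_le_sampleCount hk hm) (by omega) htm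
    (hV ▸ (LPN.lt_subsetCount n (by omega)).le) (hV ▸ LPN.subsetCount_pos _ _)
    (hV' ▸ LPN.subsetCount_pos _ _)
  have hnB : n ≤ n.choose h := LPN.le_choose (by omega) hhn
  have hnB' : (n : ℝ) ≤ n.choose h := Nat.cast_le.2 hnB
  have hB1 : (1 : ℝ) < n.choose h := by
    have : 1 < n.choose h := by omega
    exact_mod_cast this
  -- The program always works with `h₁ = ⌈k / 2⌉`, whichever rounding the bound uses; if the two
  -- differ, it is by one.
  have hchoose : (n.choose h₁ : ℝ) ≤ (n.choose h : ℝ) ^ (1 + H) := by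
    by_cases heq : h = h₁
    · rw [← heq]
      calc (n.choose h : ℝ) = (n.choose h : ℝ) ^ (1 : ℝ) := (Real.rpow_one _).symm
        _ ≤ _ := Real.rpow_le_rpow_of_exponent_le hB1.le (by linarith)
    · obtain ⟨h1, h2⟩ := hcase.resolve_left (fun h3 => heq (h3.trans hh₁.symm))
      have h3 : h₁ = h + 1 := by omega
      rw [h3]
      exact LPN.choose_succ_le_rpow hH hj (by omega) (by omega) (by omega)
  have htreal : (t : ℝ) ≤ m / b + 1 := by
    have h1 : ((t * b : ℕ) : ℝ) ≤ (m + b : ℕ) := Nat.cast_le.2 (by omega)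
    push_cast at h1
    rw [div_add_one hb0.ne', le_div_iff₀ hb0]
    exact h1
  have hcost := LPN.cost_le (n := n) (m := m) (h := h₁) (b := b) (V := V) (V' := V') hB1 hH.le
    (by omega) (LPN.two_pow_sampleCount_le (by omega) hk hkn hhk hkh hhn hm) hE
    (hV ▸ LPN.subsetCount_le (by omega)) (hV' ▸ LPN.subsetCount_le_exp (by omega) htreal)
    (hY' _ ((hN₂.trans (Nat.cast_le.2 (show N₂ ≤ n by omega))).trans hnB')) hchoose
  have hspec := fun ω : ℕ → LPN.Example n => LPN.learner_spec
    (M := LPN.learnerBound n b m V V') ω hk hkn (by omega) hm hh₁ ht rfl hV hV'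
    (by simp only [LPN.learnerBound]; omega) (by simp only [LPN.learnerBound]; omega)
  refine ⟨fun ω => ?_, fun x hx ν hν => ?_⟩
  · obtain ⟨τ, -, -, ⟨c, hc, hbound⟩, hdr, -⟩ := hspec ω
    have hinit : (LPN.State.init n k).Bounded (LPN.learnerBound n b m V V') := by
      refine ⟨fun r => ?_, fun a => Nat.zero_le _⟩
      simp only [LPN.State.init, LPN.learnerBound]
      split_ifs <;> omega
    refine ⟨c, τ, hc, ?_, ?_⟩
    · have h1 := (hbound hinit).2.trans (Nat.mul_le_mul hsteps hunit)
      exact (Nat.cast_le.2 h1).trans hcost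
    · rw [hdr]
      refine (LPN.sampleCount_le (by omega) hk hkn hm).trans ?_
      have : (0 : ℝ) ≤ k * Real.log n :=
        mul_nonneg (Nat.cast_nonneg _) (Real.log_natCast_nonneg n)
      linarith
  · have hgood := LPN.measure_unique_ge (m := m) (h := h₁) (t := t) (b := 1 / b) (η := η) x hk hkn
      hm hh₁ (by
        rw [one_div, inv_mul_eq_div, div_le_iff₀ hb0, mul_comm]
        exact_mod_cast hmt) ht8 hν hηb.le
    -- It remains to see that the learner succeeds on every sequence of the uniqueness event;
    -- inclusion of events suffices.
    refine (ENNReal.ofReal_le_ofReal (show 1 - δ ≤ _ by linarith [hgood])).trans ?_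
    rw [measureReal_def, ENNReal.ofReal_toReal (measure_ne_top _ _)]
    refine measure_mono fun ω hω => ?_
    obtain ⟨hxt, huniq⟩ := hω
    obtain ⟨τ, l₁, l₂, ⟨c, hc, -⟩, -, hl₁, hl₂, hlen₁, hlen₂, hout, hmatch⟩ := hspec ω
    exact ⟨c, τ, hc, LPN.learner_outputs hh₁ hx hxt huniq hl₁ hl₂ hlen₁ hlen₂ hout hmatch⟩
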